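/- **Conventions.** A *2D oriented spacetime* is a smooth 2-dimensional Hausdorff paracompact manifold $M$ (not necessarily connected) with a smooth Lorentzian metric $g$ of signature $(-+)$, a time-orientation (represented by an everywhere-timelike smooth vector field $T$) and an orientation (represented by a nowhere-vanishing smooth 2-form $\Omega$). A non-zero vector $v$ with $g(v,v)\le 0$ is *future-directed* if $g(T,v)<0$ and *past-directed* if $g(T,v)>0$; a non-zero $v$ with $g(v,v)\ge 0$ is *right-pointing* if $\Omega(T,v)>0$ and *left-pointing* if $\Omega(T,v)<0$. Let $\mathsf{CSpTm}$ be the category of 2D oriented spacetimes and smooth maps $f:(M,g)\to(N,h)$ with $f^*h=e^{\omega}g$ for some $\omega\in C^\infty(M)$ which preserve orientation and time-orientation. For an interval $I\subseteq\mathbb{R}$, a smooth curve $\gamma:I\to M$ is *right-moving null* if $\dot\gamma$ is null, future-directed and right-pointing on the interior of $I$; it is *right-chiral* if, on the interior of $I$, $\dot\gamma$ is either everywhere null, future-directed and right-pointing, or everywhere null, past-directed and left-pointing. It is *inextendable* if it has no limit in $M$ at either end of $I$. The *right-chiral relation* $\chi^+_M$ is the set of $(p,q)\in M\times M$ such that $p=q$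 or there is a right-moving null curve $\gamma:[0,1]\to M$ from $p$ to $q$; $s\chi^+_M$ is its symmetric closure. A map $f:M\to N$ *reflects* $\chi^+$ if $(f(p),f(q))\in\chi^+_N$ implies $(p,q)\in\chi^+_M$. A subset $U\subseteq M$ is *$\chi^+$-convex* if every right-chiral curve $[0,1]\to M$ with both endpoints in $U$ stays in $U$. A *$\chi^+$-Cauchy surface* is a smoothly embedded 1-dimensional submanifold $S\subseteq M$ such that every inextendable right-chiral curve $\gamma:I\to M$ has $\gamma(t)\in S$ for exactly one $t\in I$. A 2D oriented spacetime $M$ is *$\chi^+$-simple* if $\chi^+_M$ is antisymmetric and topologically closed in $M\times M$; *$\chi^+$-initial* if it contains a $\chi^+$-Cauchy surface; *globally hyperbolic* if it has no closed causal curves and all its causal diamonds $J^+(p)\cap J^-(q)$ are compact, where $J$ is the causal relation defined by piecewise-smooth future-directed causal curves. Write $\chi^+\mathsf{SimCSpTm}$, $\chi^+\mathsf{InitCSpTm}$, $\mathsf{GlobHypCSpTm}$ for the corresponding full subcategories of $\mathsf{CSpTm}$. Each carries the *right-chiral disjointness relation*: for $f_1:M_1\to N\leftarrow M_2:f_2$,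 $f_1\bowtie_{\chi^+}f_2$ if $s\chi^+_N$ does not intersect $f_1(M_1)\times f_2(M_2)$. A morphism $h:c\to d$ of one of these categories is *overlap-monic* in it if for all morphisms $f_1:b_1\to c\leftarrow b_2:f_2$ of that category, $f_1\bowtie_{\chi^+}f_2$ implies $h\circ f_1\bowtie_{\chi^+}h\circ f_2$. Let $\chi\mathsf{Loc}$ be the subcategory of $\chi^+\mathsf{InitCSpTm}$ with all its objects and only its overlap-monic morphisms. **Theorem.** Let $\mathsf{C}$ be any of $\chi^+\mathsf{SimCSpTm}$, $\chi^+\mathsf{InitCSpTm}$, $\mathsf{GlobHypCSpTm}$, with the right-chiral disjointness relation. A morphism $f:M\to N$ of $\mathsf{C}$ is overlap-monic in $\mathsf{C}$ if and only if the following equivalent conditions hold: 1. $f$ reflects $\chi^+$; 2. $f$ is injective and its image $f(M)$ is $\chi^+$-convex in $N$. Consequently, the objects of $\chi\mathsf{Loc}$ are exactly the 2D oriented spacetimes that contain a $\chi^+$-Cauchy surface, and its morphisms $M\to N$ are exactly the orientation- and time-orientation-preserving injective conformal maps $f:M\to N$ whose image $f(M)$ is $\chi^+$-convex in $N$. -/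

import Mathlib

open Set Filter Topology Manifold Bundle CategoryTheory
open scoped ContDiff

universe v u

/-! ## Categories with a disjointness relation -/

/-- A disjointness relation on a category: a symmetric relation on pairs of morphisms with common
codomain, stable under pre-composition and under post-composition by isomorphisms. -/
structure DisjointnessRelation (C : Type u) [Category.{v} C] where
  Rel : ∀ {b₁ b₂ c : C}, (b₁ ⟶ c) → (b₂ ⟶ c) → Prop
  symm : ∀ {b₁ b₂ c : C} (f₁ : b₁ ⟶ c) (f₂ : b₂ ⟶ c), Rel f₁ f₂ → Rel f₂ f₁
  precomp : ∀ {a₁ a₂ b₁ b₂ c : C} (f₁ : b₁ ⟶ c) (f₂ : b₂ ⟶ c) (g₁ : a₁ ⟶ b₁) (g₂ : a₂ ⟶ b₂),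
    Rel f₁ f₂ → Rel (g₁ ≫ f₁) (g₂ ≫ f₂)
  postcomp_iso : ∀ {b₁ b₂ c d : C} (f₁ : b₁ ⟶ c) (f₂ : b₂ ⟶ c) (h : c ⟶ d), IsIso h →
    Rel f₁ f₂ → Rel (f₁ ≫ h) (f₂ ≫ h)

namespace DisjointnessRelation

/-- The pullback of a disjointness relation along a functor. Along the inclusion of a full
subcategory it is the restricted relation. -/
def pullback {C : Type*} [Category* C] {D : Type*} [Category* D] (R : DisjointnessRelation D)
    (F : C ⥤ D) : DisjointnessRelation C where
  Rel f₁ f₂ := R.Rel (F.map f₁) (F.map f₂)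
  symm _ _ h := R.symm _ _ h
  precomp f₁ f₂ g₁ g₂ h := by
    simpa only [F.map_comp] using R.precomp _ _ (F.map g₁) (F.map g₂) h
  postcomp_iso f₁ f₂ h hh H := by
    simpa only [F.map_comp] using R.postcomp_iso _ _ (F.map h) inferInstance H

/-- A morphism is overlap-monic if post-composing with it preserves disjointness. -/
def OverlapMonic {C : Type*} [Category* C] (R : DisjointnessRelation C) : MorphismProperty C :=
  fun c _ h => ∀ (b₁ b₂ : C) (f₁ : b₁ ⟶ c) (f₂ : b₂ ⟶ c), R.Rel f₁ f₂ → R.Rel (f₁ ≫ h) (f₂ ≫ h)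

instance {C : Type*} [Category* C] (R : DisjointnessRelation C) :
    R.OverlapMonic.IsMultiplicative where
  id_mem _ := fun _ _ _ _ h => by simpa using h
  comp_mem f g hf hg := fun _ _ _ _ h => by
    simpa only [Category.assoc] using hg _ _ _ _ (hf _ _ _ _ h)

/-- The wide subcategory of all objects and only the overlap-monic morphisms. -/
abbrev OverlapMonics {C : Type*} [Category* C] (R : DisjointnessRelation C) : Type _ :=
  WideSubcategory R.OverlapMonic

end DisjointnessRelation

/-! ## Two-dimensional oriented spacetimes -/

/-- The model space of 2-dimensional manifolds. -/
abbrev Plane : Type := EuclideanSpace ℝ (Fin 2)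

section Fields

variable {M : Type u} [TopologicalSpace M] [ChartedSpace Plane M] [IsManifold (𝓡 2) ∞ M]

/-- A field of bilinear forms on the tangent spaces is smooth. -/
def IsSmoothBilinField (B : ∀ x : M, TangentSpace (𝓡 2) x →L[ℝ] TangentSpace (𝓡 2) x →L[ℝ] ℝ) :
    Prop :=
  ContMDiff (𝓡 2) ((𝓡 2).prod 𝓘(ℝ, Plane →L[ℝ] Plane →L[ℝ] ℝ)) ∞
    (fun x => TotalSpace.mk' (Plane →L[ℝ] Plane →L[ℝ] ℝ) x (B x))

/-- A Lorentzian metric of signature `(-+)` on a surface. -/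
structure IsLorentzMetric
    (g : ∀ x : M, TangentSpace (𝓡 2) x →L[ℝ] TangentSpace (𝓡 2) x →L[ℝ] ℝ) : Prop where
  smooth : IsSmoothBilinField g
  symm : ∀ x v w, g x v w = g x w v
  signature : ∀ x, ∃ e₀ e₁ : TangentSpace (𝓡 2) x,
    g x e₀ e₀ = -1 ∧ g x e₀ e₁ = 0 ∧ g x e₁ e₁ = 1

/-- A smooth everywhere-timelike vector field. -/
def IsTimelikeField (g : ∀ x : M, TangentSpace (𝓡 2) x →L[ℝ] TangentSpace (𝓡 2) x →L[ℝ] ℝ)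
    (T : ∀ x : M, TangentSpace (𝓡 2) x) : Prop :=
  ContMDiff (𝓡 2) (𝓡 2).tangent ∞ (fun x => (⟨x, T x⟩ : TangentBundle (𝓡 2) M)) ∧
    ∀ x, g x (T x) (T x) < 0

/-- A smooth nowhere-vanishing 2-form. -/
structure IsVolumeForm
    (Ω : ∀ x : M, TangentSpace (𝓡 2) x →L[ℝ] TangentSpace (𝓡 2) x →L[ℝ] ℝ) : Prop where
  smooth : IsSmoothBilinField Ω
  alternating : ∀ x v, Ω x v v = 0
  ne_zero : ∀ x, Ω x ≠ 0

end Fields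

/-- A 2D oriented spacetime: a (not necessarily connected) Hausdorff paracompact smooth surface with
a Lorentzian metric, a time-orientation (an equivalence class of everywhere-timelike vector fields)
and an orientation (an equivalence class of nowhere-vanishing 2-forms). -/
structure OrientedSpacetime : Type (u + 1) where
  carrier : Type u
  [topologicalSpace : TopologicalSpace carrier]
  [chartedSpace : ChartedSpace Plane carrier]
  [isManifold : IsManifold (𝓡 2) ∞ carrier]
  [t2Space : T2Space carrier]
  [paracompactSpace : ParacompactSpace carrier]
  metric : ∀ x : carrier, TangentSpace (𝓡 2) x →L[ℝ] TangentSpace (𝓡 2) x →L[ℝ] ℝ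
  isLorentzMetric : IsLorentzMetric metric
  timeOrientation : Set (∀ x : carrier, TangentSpace (𝓡 2) x)
  isTimeOrientation : ∃ T, IsTimelikeField metric T ∧
    timeOrientation = {T' | IsTimelikeField metric T' ∧ ∀ x, metric x (T x) (T' x) < 0}
  orientation : Set (∀ x : carrier, TangentSpace (𝓡 2) x →L[ℝ] TangentSpace (𝓡 2) x →L[ℝ] ℝ)
  isOrientation : ∃ Ω, IsVolumeForm Ω ∧
    orientation = {Ω' | IsVolumeForm Ω' ∧ ∀ x, ∃ c : ℝ, 0 < c ∧ Ω' x = c • Ω x}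

attribute [instance] OrientedSpacetime.topologicalSpace OrientedSpacetime.chartedSpace
  OrientedSpacetime.isManifold OrientedSpacetime.t2Space OrientedSpacetime.paracompactSpace

namespace OrientedSpacetime

instance : CoeSort OrientedSpacetime.{u} (Type u) := ⟨OrientedSpacetime.carrier⟩

section Vectors

variable (M : OrientedSpacetime.{u}) {x : M}

/-- A null tangent vector (by convention non-zero). -/
def IsNull (w : TangentSpace (𝓡 2) x) : Prop := w ≠ 0 ∧ M.metric x w w = 0

/-- A non-zero, non-spacelike vector in the future lightcone. -/
def IsFutureDirected (w : TangentSpace (𝓡 2) x) : Prop :=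
  w ≠ 0 ∧ M.metric x w w ≤ 0 ∧ ∃ T ∈ M.timeOrientation, M.metric x (T x) w < 0

/-- A non-zero, non-spacelike vector in the past lightcone. -/
def IsPastDirected (w : TangentSpace (𝓡 2) x) : Prop :=
  w ≠ 0 ∧ M.metric x w w ≤ 0 ∧ ∃ T ∈ M.timeOrientation, 0 < M.metric x (T x) w

/-- The pair `(w, w')` is a positively oriented basis. -/
def IsPositivelyOriented (w w' : TangentSpace (𝓡 2) x) : Prop :=
  ∃ Ω ∈ M.orientation, 0 < Ω x w w'

/-- A non-zero, non-timelike, right-pointing vector. -/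
def IsRightPointing (w : TangentSpace (𝓡 2) x) : Prop :=
  w ≠ 0 ∧ 0 ≤ M.metric x w w ∧
    ∃ Ω ∈ M.orientation, ∃ T ∈ M.timeOrientation, 0 < Ω x (T x) w

/-- A non-zero, non-timelike, left-pointing vector. -/
def IsLeftPointing (w : TangentSpace (𝓡 2) x) : Prop :=
  w ≠ 0 ∧ 0 ≤ M.metric x w w ∧
    ∃ Ω ∈ M.orientation, ∃ T ∈ M.timeOrientation, Ω x (T x) w < 0

end Vectors

section Curves

variable (M : OrientedSpacetime.{u})

/-- The velocity of a curve. It is only used at interior points of intervals on which the curve is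
smooth. -/
noncomputable def velocity (γ : ℝ → M) (t : ℝ) : TangentSpace (𝓡 2) (γ t) :=
  (mfderiv 𝓘(ℝ, ℝ) (𝓡 2) γ t : ℝ →L[ℝ] TangentSpace (𝓡 2) (γ t)) (1 : ℝ)

/-- A right-moving null curve on the interval `I`: smooth on `I`, and with null, future-directed,
right-pointing velocity on the interior of `I`. -/
def IsRightMoving (γ : ℝ → M) (I : Set ℝ) : Prop :=
  ContMDiffOn 𝓘(ℝ, ℝ) (𝓡 2) ∞ γ I ∧ ∀ t ∈ interior I,
    M.IsNull (M.velocity γ t) ∧ M.IsFutureDirected (M.velocity γ t) ∧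
      M.IsRightPointing (M.velocity γ t)

/-- A right-chiral curve on the interval `I`: smooth on `I`, and with velocity on the interior of
`I` either everywhere null, future-directed and right-pointing, or everywhere null, past-directed
and left-pointing. -/
def IsRightChiral (γ : ℝ → M) (I : Set ℝ) : Prop :=
  ContMDiffOn 𝓘(ℝ, ℝ) (𝓡 2) ∞ γ I ∧
    ((∀ t ∈ interior I, M.IsNull (M.velocity γ t) ∧ M.IsFutureDirected (M.velocity γ t) ∧
        M.IsRightPointing (M.velocity γ t)) ∨
     (∀ t ∈ interior I, M.IsNull (M.velocity γ t) ∧ M.IsPastDirected (M.velocity γ t) ∧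
        M.IsLeftPointing (M.velocity γ t)))

/-- A curve on the interval `I` has no endpoint: it has a limit at neither end of `I`. (If `I`
contains its infimum, the filter `atBot` on `I` is the principal filter there, so that the limit
exists; similarly for the supremum.) -/
def IsInextendable (γ : ℝ → M) (I : Set ℝ) : Prop :=
  (¬ ∃ p : M, Tendsto (fun t : I => γ t) atBot (𝓝 p)) ∧
  (¬ ∃ p : M, Tendsto (fun t : I => γ t) atTop (𝓝 p))

/-- The right-chiral relation `χ⁺`. -/
def chi (p q : M) : Prop :=
  p = q ∨ ∃ γ : ℝ → M, M.IsRightMoving γ (Icc 0 1) ∧ γ 0 = p ∧ γ 1 = q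

/-- The symmetric closure `sχ⁺` of the right-chiral relation. -/
def sChi (p q : M) : Prop := M.chi p q ∨ M.chi q p

/-- A subset is `χ⁺`-convex if it contains any right-chiral curve with endpoints in it. -/
def IsChiConvex (U : Set M) : Prop :=
  ∀ γ : ℝ → M, M.IsRightChiral γ (Icc 0 1) → γ 0 ∈ U → γ 1 ∈ U → γ '' Icc 0 1 ⊆ U

/-- `χ⁺`-simple: the right-chiral relation is antisymmetric and topologically closed. -/
def IsChiSimple : Prop :=
  (∀ p q, M.chi p q → M.chi q p → p = q) ∧ IsClosed {z : M × M | M.chi z.1 z.2}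

/-- A smoothly embedded 1-dimensional submanifold (without boundary), via local slice charts. -/
def IsEmbeddedCurve (S : Set M) : Prop :=
  ∀ p ∈ S, ∃ φ ∈ IsManifold.maximalAtlas (𝓡 2) ∞ M,
    p ∈ φ.source ∧ ∀ x ∈ φ.source, x ∈ S ↔ (φ x) 1 = 0

/-- A `χ⁺`-Cauchy surface: a smoothly embedded 1-dimensional submanifold that every inextendable
right-chiral curve meets at exactly one parameter value. -/
def IsChiCauchySurface (S : Set M) : Prop :=
  M.IsEmbeddedCurve S ∧
    ∀ (I : Set ℝ) (γ : ℝ → M), I.Nonempty → I.OrdConnected → M.IsRightChiral γ I →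
      M.IsInextendable γ I → ∃! t, t ∈ I ∧ γ t ∈ S

/-- `χ⁺`-initial: there is a `χ⁺`-Cauchy surface. -/
def IsChiInitial : Prop := ∃ S : Set M, M.IsChiCauchySurface S

/-- A (continuous, piecewise-smooth) future-directed causal curve on `[0, 1]`. -/
def IsFutureCausalCurve (γ : ℝ → M) : Prop :=
  ContinuousOn γ (Icc 0 1) ∧ ∃ (n : ℕ) (s : Fin (n + 1) → ℝ), StrictMono s ∧ s 0 = 0 ∧
    s (Fin.last n) = 1 ∧ ∀ i : Fin n,
      ContMDiffOn 𝓘(ℝ, ℝ) (𝓡 2) ∞ γ (Icc (s i.castSucc) (s i.succ)) ∧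
      ∀ t ∈ Ioo (s i.castSucc) (s i.succ), M.IsFutureDirected (M.velocity γ t)

/-- The causal relation `J`. -/
def causalRel (p q : M) : Prop :=
  p = q ∨ ∃ γ : ℝ → M, M.IsFutureCausalCurve γ ∧ γ 0 = p ∧ γ 1 = q

/-- Globally hyperbolic: there are no closed causal curves and all causal diamonds are compact. -/
def IsGloballyHyperbolic : Prop :=
  (¬ ∃ γ : ℝ → M, M.IsFutureCausalCurve γ ∧ γ 0 = γ 1) ∧
    ∀ p q : M, IsCompact {r : M | M.causalRel p r ∧ M.causalRel r q}

end Curves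

/-! ## The category of 2D oriented spacetimes -/

/-- A smooth conformal map which preserves orientation and time-orientation. -/
structure IsConformalMorphism (M N : OrientedSpacetime.{u}) (f : M → N) : Prop where
  smooth : ContMDiff (𝓡 2) (𝓡 2) ∞ f
  conformal : ∃ σ : M → ℝ, ContMDiff (𝓡 2) 𝓘(ℝ, ℝ) ∞ σ ∧
    ∀ (x : M) (w w' : TangentSpace (𝓡 2) x),
      N.metric (f x) (mfderiv (𝓡 2) (𝓡 2) f x w) (mfderiv (𝓡 2) (𝓡 2) f x w') =
        Real.exp (σ x) * M.metric x w w'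
  orientation : ∀ (x : M) (w w' : TangentSpace (𝓡 2) x), M.IsPositivelyOriented w w' →
    N.IsPositivelyOriented (mfderiv (𝓡 2) (𝓡 2) f x w) (mfderiv (𝓡 2) (𝓡 2) f x w')
  timeOrientation : ∀ (x : M) (w : TangentSpace (𝓡 2) x), M.IsFutureDirected w →
    N.IsFutureDirected (mfderiv (𝓡 2) (𝓡 2) f x w)

/-- Morphisms of 2D oriented spacetimes. -/
@[ext]
structure Hom (M N : OrientedSpacetime.{u}) where
  toFun : M → N
  isConformalMorphism : IsConformalMorphism M N toFun

theorem IsConformalMorphism.id (M : OrientedSpacetime.{u}) : IsConformalMorphism M M id where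
  smooth := contMDiff_id
  conformal := ⟨fun _ => 0, contMDiff_const, fun x w w' => by
    rw [mfderiv_id]; simp⟩
  orientation x w w' h := by rw [mfderiv_id]; exact h
  timeOrientation x w h := by rw [mfderiv_id]; exact h

theorem IsConformalMorphism.comp {M N P : OrientedSpacetime.{u}} {g : N → P} {f : M → N}
    (hg : IsConformalMorphism N P g) (hf : IsConformalMorphism M N f) :
    IsConformalMorphism M P (g ∘ f) := by
  have key : ∀ (x : M) (w : TangentSpace (𝓡 2) x), mfderiv (𝓡 2) (𝓡 2) (g ∘ f) x w =
      mfderiv (𝓡 2) (𝓡 2) g (f x) (mfderiv (𝓡 2) (𝓡 2) f x w) := fun x w =>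
    mfderiv_comp_apply x (hg.smooth.mdifferentiableAt (by simp))
      (hf.smooth.mdifferentiableAt (by simp)) w
  obtain ⟨σ, hσ, h1⟩ := hf.conformal
  obtain ⟨τ, hτ, h2⟩ := hg.conformal
  refine ⟨hg.smooth.comp hf.smooth, ⟨fun x => τ (f x) + σ x, ?_, ?_⟩, ?_, ?_⟩
  · exact (hτ.comp hf.smooth).add hσ
  · intro x w w'
    rw [key, key, Real.exp_add, mul_assoc, ← h1]
    exact h2 _ _ _
  · intro x w w' h
    rw [key, key]
    exact hg.orientation _ _ _ (hf.orientation _ _ _ h)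
  · intro x w h
    rw [key]
    exact hg.timeOrientation _ _ (hf.timeOrientation _ _ h)

/-- The category of 2D oriented spacetimes and smooth conformal maps preserving orientation and
time-orientation, composing as functions. -/
instance : Category.{u} OrientedSpacetime.{u} where
  Hom M N := Hom M N
  id M := ⟨_root_.id, .id M⟩
  comp f g := ⟨g.toFun ∘ f.toFun, g.isConformalMorphism.comp f.isConformalMorphism⟩

end OrientedSpacetime

/-! ## The right-chiral disjointness relation -/

namespace OrientedSpacetime

/-- Whether a non-timelike vector is right-pointing does not depend on the future-directed
timelike vector used to test it. -/
theorem volume_pos_of_volume_pos (g Ω : Plane →L[ℝ] Plane →L[ℝ] ℝ)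
    (hsymm : ∀ v w, g v w = g w v)
    (hsig : ∃ e₀ e₁ : Plane, g e₀ e₀ = -1 ∧ g e₀ e₁ = 0 ∧ g e₁ e₁ = 1)
    (hΩ : ∀ v, Ω v v = 0) {a b w : Plane} (ha : g a a < 0) (hb : g b b < 0) (hab : g a b < 0)
    (hw : w ≠ 0) (hww : 0 ≤ g w w) (h : 0 < Ω a w) : 0 < Ω b w := by
  obtain ⟨e₀, e₁, h00, h01, h11⟩ := hsig
  have h10 : g e₁ e₀ = 0 := by rw [hsymm, h01]
  have hli : LinearIndependent ℝ ![e₀, e₁] := by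
    rw [LinearIndependent.pair_iff]
    intro s t hst
    have e1 := congrArg (fun z => g e₀ z) hst
    have e2 := congrArg (fun z => g e₁ z) hst
    simp [h00, h01, h10, h11] at e1 e2
    exact ⟨e1, e2⟩
  have hspan : ∀ z : Plane, ∃ s t : ℝ, z = s • e₀ + t • e₁ := by
    intro z
    have hz : z ∈ Submodule.span ℝ (Set.range ![e₀, e₁]) := by
      rw [hli.span_eq_top_of_card_eq_finrank (by simp)]
      trivial
    simp only [Matrix.range_cons, Matrix.range_empty, Set.union_empty, Set.singleton_union] at hz
    obtain ⟨s, t, hz⟩ := Submodule.mem_span_pair.1 hz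
    exact ⟨s, t, hz.symm⟩
  have hΩ10 : Ω e₁ e₀ = - Ω e₀ e₁ := by
    have := hΩ (e₀ + e₁)
    simp [hΩ] at this
    linarith
  obtain ⟨a0, a1, rfl⟩ := hspan a
  obtain ⟨b0, b1, rfl⟩ := hspan b
  obtain ⟨x, y, rfl⟩ := hspan w
  have hxy : 0 < x ^ 2 + y ^ 2 := by
    by_contra hcon
    have hx : x = 0 := by nlinarith [sq_nonneg x, sq_nonneg y]
    have hy : y = 0 := by nlinarith [sq_nonneg x, sq_nonneg y]
    exact hw (by simp [hx, hy])
  simp [h00, h01, h10, h11, hΩ, hΩ10] at *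
  generalize Ω e₀ e₁ = k at h ⊢
  have hy : 0 < y * y := by nlinarith
  have main : ∀ c d : ℝ, d * d < c * c → 0 < (c * y - d * x) * (c * y) := by
    intro c d hcd
    have h1 : (d * x) * (d * x) < (c * y) * (c * y) := by
      have h2 : (d * d) * (x * x) ≤ (d * d) * (y * y) :=
        mul_le_mul_of_nonneg_left hww (mul_self_nonneg d)
      have h3 : (d * d) * (y * y) < (c * c) * (y * y) := mul_lt_mul_of_pos_right hcd hy
      nlinarith
    nlinarith [sq_nonneg (c * y - d * x)]
  have hA := main a0 a1 ha
  have hB := main b0 b1 hb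
  have hpos : 0 < a0 * b0 := by
    have h1 : (a1 * b1) * (a1 * b1) < (a0 * b0) * (a0 * b0) := by
      have h2 := mul_lt_mul'' ha hb (mul_self_nonneg a1) (mul_self_nonneg b1)
      nlinarith
    by_contra hc
    nlinarith
  have hk : 0 < k * (a0 * y) := by
    have h1 : 0 < k * (a0 * y - a1 * x) := by linarith
    have h2 : 0 < (k * (a0 * y)) * (a0 * y - a1 * x) ^ 2 := by
      have := mul_pos h1 hA
      nlinarith
    exact pos_of_mul_pos_left h2 (sq_nonneg _)
  have hk' : 0 < k * (b0 * y) := by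
    have h2 : 0 < (k * (b0 * y)) * (a0 * y) ^ 2 := by
      have : 0 < (k * (a0 * y)) * ((a0 * b0) * (y * y)) := by positivity
      nlinarith
    exact pos_of_mul_pos_left h2 (sq_nonneg _)
  have h3 : 0 < (k * (b0 * y - b1 * x)) * (b0 * y) ^ 2 := by
    have := mul_pos hk' hB
    nlinarith
  have h4 := pos_of_mul_pos_left h3 (sq_nonneg _)
  linarith

/-- A conformal morphism maps right-moving null vectors to such vectors. -/
theorem IsConformalMorphism.map_right {M N : OrientedSpacetime.{u}} {f : M → N}
    (hf : IsConformalMorphism M N f) {x : M} {w : TangentSpace (𝓡 2) x}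
    (hn : M.IsNull w) (hw : M.IsFutureDirected w) (hr : M.IsRightPointing w) :
    N.IsNull (mfderiv (𝓡 2) (𝓡 2) f x w) ∧ N.IsFutureDirected (mfderiv (𝓡 2) (𝓡 2) f x w) ∧
      N.IsRightPointing (mfderiv (𝓡 2) (𝓡 2) f x w) := by
  obtain ⟨σ, -, hσ⟩ := hf.conformal
  have hF := hf.timeOrientation x w hw
  have h0 : N.metric (f x) (mfderiv (𝓡 2) (𝓡 2) f x w) (mfderiv (𝓡 2) (𝓡 2) f x w) = 0 := by
    rw [hσ, hn.2, mul_zero]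
  refine ⟨⟨hF.1, h0⟩, hF, hF.1, h0.ge, ?_⟩
  obtain ⟨-, -, Ω, hΩ, T, hT, hpos⟩ := hr
  obtain ⟨Ω', hΩ', hpos'⟩ := hf.orientation x (T x) w ⟨Ω, hΩ, hpos⟩
  obtain ⟨T₀, hT₀, hMT⟩ := M.isTimeOrientation
  have hTT := hT
  rw [hMT] at hTT
  have hTneg : M.metric x (T x) (T x) < 0 := hTT.1.2 x
  have hTfut : M.IsFutureDirected (T x) := by
    refine ⟨?_, hTneg.le, T₀, ?_, hTT.2 x⟩
    · intro h
      rw [h] at hTneg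
      simp at hTneg
    · rw [hMT]
      exact ⟨hT₀, hT₀.2⟩
  obtain ⟨-, -, T', hT', hTT'⟩ := hf.timeOrientation x (T x) hTfut
  refine ⟨Ω', hΩ', T', hT', ?_⟩
  obtain ⟨T₁, hT₁, hNT⟩ := N.isTimeOrientation
  obtain ⟨Ω₁, hΩ₁, hNΩ⟩ := N.isOrientation
  have hT'' := hT'
  rw [hNT] at hT''
  have hΩ'' := hΩ'
  rw [hNΩ] at hΩ''
  refine volume_pos_of_volume_pos (N.metric (f x)) (Ω' (f x)) (N.isLorentzMetric.symm _)
    (N.isLorentzMetric.signature _) (hΩ''.1.alternating _) ?_ (hT''.1.2 (f x)) ?_ hF.1 h0.ge hpos'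
  · exact (hσ x (T x) (T x)).trans_lt (mul_neg_of_pos_of_neg (Real.exp_pos _) hTneg)
  · exact (N.isLorentzMetric.symm _ _ _).trans_lt hTT'

theorem IsConformalMorphism.map_isRightMoving {M N : OrientedSpacetime.{u}} {f : M → N}
    (hf : IsConformalMorphism M N f) {γ : ℝ → M} {I : Set ℝ} (hγ : M.IsRightMoving γ I) :
    N.IsRightMoving (f ∘ γ) I := by
  refine ⟨hf.smooth.comp_contMDiffOn hγ.1, fun t ht => ?_⟩
  have hγt : MDifferentiableAt 𝓘(ℝ, ℝ) (𝓡 2) γ t :=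
    (hγ.1.contMDiffAt (mem_interior_iff_mem_nhds.1 ht)).mdifferentiableAt (by simp)
  have key : N.velocity (f ∘ γ) t = mfderiv (𝓡 2) (𝓡 2) f (γ t) (M.velocity γ t) :=
    mfderiv_comp_apply t (hf.smooth.mdifferentiableAt (by simp)) hγt _
  rw [key]
  exact hf.map_right (hγ.2 t ht).1 (hγ.2 t ht).2.1 (hγ.2 t ht).2.2

theorem IsConformalMorphism.map_chi {M N : OrientedSpacetime.{u}} {f : M → N}
    (hf : IsConformalMorphism M N f) {p q : M} (h : M.chi p q) : N.chi (f p) (f q) := by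
  rcases h with rfl | ⟨γ, hγ, rfl, rfl⟩
  · exact Or.inl rfl
  · exact Or.inr ⟨f ∘ γ, hf.map_isRightMoving hγ, rfl, rfl⟩

theorem IsConformalMorphism.map_sChi {M N : OrientedSpacetime.{u}} {f : M → N}
    (hf : IsConformalMorphism M N f) {p q : M} (h : M.sChi p q) : N.sChi (f p) (f q) :=
  h.imp hf.map_chi hf.map_chi

/-- The right-chiral disjointness relation: `f₁` and `f₂` are disjoint if `sχ⁺` does not intersect
the product of their images. -/
def chiralDisjointness : DisjointnessRelation OrientedSpacetime.{u} where
  Rel {M₁ M₂ N} f₁ f₂ := ∀ (p₁ : M₁) (p₂ : M₂), ¬ N.sChi (f₁.toFun p₁) (f₂.toFun p₂)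
  symm _ _ h p₂ p₁ H := h p₁ p₂ H.symm
  precomp _ _ g₁ g₂ h p₁ p₂ := h (g₁.toFun p₁) (g₂.toFun p₂)
  postcomp_iso f₁ f₂ h _ H p₁ p₂ hs := by
    apply H p₁ p₂
    have h1 := (inv h).isConformalMorphism.map_sChi hs
    have h2 : ∀ z, (inv h).toFun (h.toFun z) = z := fun z =>
      congrArg (fun k => Hom.toFun k z) (IsIso.hom_inv_id h)
    have h3 : ∀ z, (inv h).toFun ((f₁ ≫ h).toFun z) = f₁.toFun z := fun z => h2 _
    have h4 : ∀ z, (inv h).toFun ((f₂ ≫ h).toFun z) = f₂.toFun z := fun z => h2 _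
    rwa [h3, h4] at h1

/-- A map of spacetimes reflects the right-chiral relation. -/
def ReflectsChi {M N : OrientedSpacetime.{u}} (f : M → N) : Prop :=
  ∀ p q : M, N.chi (f p) (f q) → M.chi p q

/-- The property of objects of being `χ⁺`-simple. -/
def chiSimple : ObjectProperty OrientedSpacetime.{u} := fun M => M.IsChiSimple

/-- The property of objects of being `χ⁺`-initial. -/
def chiInitial : ObjectProperty OrientedSpacetime.{u} := fun M => M.IsChiInitial

/-- The property of objects of being globally hyperbolic. -/
def globallyHyperbolic : ObjectProperty OrientedSpacetime.{u} := fun M => M.IsGloballyHyperbolic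

/-- The right-chiral disjointness relation on the full subcategory of spacetimes with a given
property. -/
def chiralDisjointnessOn (κ : ObjectProperty OrientedSpacetime.{u}) :
    DisjointnessRelation κ.FullSubcategory :=
  chiralDisjointness.pullback κ.ι

/-- The category `χLoc`: the wide subcategory of overlap-monics in the category of `χ⁺`-initial
spacetimes. -/
abbrev ChiLoc : Type (u + 1) := (chiralDisjointnessOn chiInitial.{u}).OverlapMonics

/-- The inclusion of `χLoc` into the category of 2D oriented spacetimes. -/
abbrev ChiLoc.inclusion : ChiLoc.{u} ⥤ OrientedSpacetime.{u} :=
  wideSubcategoryInclusion _ ⋙ chiInitial.ι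

end OrientedSpacetime

/-! At each point the right-moving null vectors form one ray. Normalising against a time-orienting
field turns these rays into a smooth vector field `rightField`, and `chi p q` holds exactly when its
flow carries `p` to `q` in some non-negative time (`chi_iff_flow`). Hence `chi` is a preorder, and
any two points reached from a common point are comparable.

A map reflecting `chi` is overlap-monic by unwinding the definitions. For the converse, suppose `f
p` and `f q` are related. If `p` and `q` were unrelated in both directions, closedness of `sChi`
would give neighbourhoods of `p` and `q` with no related pair between them. Each neighbourhood
contains a conformal copy of Minkowski space centred at the given point (`exists_isNullBox`). These
two copies are disjoint morphisms whose composites with `f` are not, so `f` would fail to be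
overlap-monic. Thus `p` and `q` are related, and in the right order: otherwise the image of the
curve from `q` to `p` would close up in the target and collapse by antisymmetry. The argument uses
of the category only that its objects are simple and that Minkowski space is one of them.

Simplicity of the objects is proved separately in each case. With a Cauchy surface, the time at
which a right-moving line hits the surface and the hitting point depend continuously on the starting
point, so the order passes to limits (`IsChiInitial.isChiSimple`). In a globally hyperbolic
spacetime, a failure of closedness would trap a right-moving ray in a compact diamond, where its
accumulation produces a closed causal curve (`IsGloballyHyperbolic.isChiSimple`).

Conditions 1 and 2 compare as follows. An injective conformal map is an open embedding, so
right-moving curves inside its image lift; with convexity this gives reflection. Conversely,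
reflection gives injectivity by antisymmetry, and a connectedness argument along the image of a
curve from `p` to `q` shows that it sweeps out everything between `f p` and `f q`
(`ReflectsChi.mem_range_of_chi`).

The analytic core is the existence of null coordinates. The two null line fields have smooth first
integrals, obtained from a contraction and the implicit function theorem in a space of continuous
functions. Together these integrals form a coordinate system, and squashing the plane by `arctan`
makes its domain the whole plane. -/

/-! ## Null frames -/

/-- A Lorentzian plane with a timelike vector and an area form has an adapted null basis. -/
theorem exists_null_basis (g Ω : Plane →L[ℝ] Plane →L[ℝ] ℝ)
    (hsymm : ∀ v w, g v w = g w v)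
    (hsig : ∃ e₀ e₁ : Plane, g e₀ e₀ = -1 ∧ g e₀ e₁ = 0 ∧ g e₁ e₁ = 1)
    (hΩ : ∀ v, Ω v v = 0) (hΩ0 : Ω ≠ 0) (T : Plane) (hT : g T T < 0) :
    ∃ e n : Plane, g e e = 0 ∧ g n n = 0 ∧ g e n < 0 ∧ 0 < Ω n e ∧
      (∃ a b : ℝ, 0 < a ∧ 0 < b ∧ T = a • e + b • n) := by
  obtain ⟨e₀, e₁, h00, h01, h11⟩ := hsig
  have h10 : g e₁ e₀ = 0 := by rw [hsymm, h01]
  have hli : LinearIndependent ℝ ![e₀, e₁] := by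
    rw [LinearIndependent.pair_iff]
    intro s t hst
    have e1 := congrArg (fun z => g e₀ z) hst
    have e2 := congrArg (fun z => g e₁ z) hst
    simp [h00, h01, h10, h11] at e1 e2
    exact ⟨e1, e2⟩
  have hspan : ∀ z : Plane, ∃ s t : ℝ, z = s • e₀ + t • e₁ := by
    intro z
    have hz : z ∈ Submodule.span ℝ (Set.range ![e₀, e₁]) := by
      rw [hli.span_eq_top_of_card_eq_finrank (by simp)]
      trivial
    simp only [Matrix.range_cons, Matrix.range_empty, Set.union_empty, Set.singleton_union] at hz
    obtain ⟨s, t, hz⟩ := Submodule.mem_span_pair.1 hz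
    exact ⟨s, t, hz.symm⟩
  have hΩ10 : Ω e₁ e₀ = - Ω e₀ e₁ := by
    have := hΩ (e₀ + e₁)
    simp [hΩ] at this
    linarith
  have hk : Ω e₀ e₁ ≠ 0 := by
    intro h
    apply hΩ0
    ext v w
    obtain ⟨a, b, rfl⟩ := hspan v
    obtain ⟨c, d, rfl⟩ := hspan w
    simp [hΩ, hΩ10, h]
  obtain ⟨a, b, rfl⟩ := hspan T
  simp [h00, h01, h10, h11] at hT
  -- the sign of the time component
  obtain ⟨s, hs, hsa, hsb⟩ : ∃ s : ℝ, s * s = 1 ∧ 0 < s * a + s * b ∧ 0 < s * a - s * b := by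
    have h1 : 0 < (a + b) * (a - b) := by nlinarith
    rcases pos_and_pos_or_neg_and_neg_of_mul_pos h1 with ⟨h2, h3⟩ | ⟨h2, h3⟩
    · exact ⟨1, by norm_num, by linarith, by linarith⟩
    · exact ⟨-1, by norm_num, by linarith, by linarith⟩
  -- The null directions are those of `e₀ + e₁` and `e₀ - e₁`; the sign of the area form decides
  -- which of them is right-moving.
  rcases lt_or_gt_of_ne hk with hk | hk
  · refine ⟨s • e₀ - s • e₁, s • e₀ + s • e₁, ?_, ?_, ?_, ?_, (s * a - s * b) / 2,
      (s * a + s * b) / 2, by linarith, by linarith, ?_⟩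
    · simp [h00, h01, h10, h11]
    · simp [h00, h01, h10, h11]
    · simp [h00, h01, h10, h11]; nlinarith
    · simp [hΩ, hΩ10]; nlinarith
    · linear_combination (norm := module) (-hs) • (a • e₀ + b • e₁)
  · refine ⟨s • e₀ + s • e₁, s • e₀ - s • e₁, ?_, ?_, ?_, ?_, (s * a + s * b) / 2,
      (s * a - s * b) / 2, by linarith, by linarith, ?_⟩
    · simp [h00, h01, h10, h11]
    · simp [h00, h01, h10, h11]
    · simp [h00, h01, h10, h11]; nlinarith
    · simp [hΩ, hΩ10]; nlinarith
    · linear_combination (norm := module) (-hs) • (a • e₀ + b • e₁)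

theorem exists_coord_null_basis (g : Plane →L[ℝ] Plane →L[ℝ] ℝ) (hsymm : ∀ v w, g v w = g w v)
    {e n : Plane} (hee : g e e = 0) (hnn : g n n = 0) (hen : g e n < 0) (w : Plane) :
    ∃ x y : ℝ, w = x • e + y • n := by
  have hne : g n e = g e n := hsymm _ _
  have hli : LinearIndependent ℝ ![e, n] := by
    rw [LinearIndependent.pair_iff]
    intro s t hst
    have e1 := congrArg (fun z => g e z) hst
    have e2 := congrArg (fun z => g n z) hst
    simp [hee, hnn, hne, hen.ne] at e1 e2
    exact ⟨e2, e1⟩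
  have hz : w ∈ Submodule.span ℝ (Set.range ![e, n]) := by
    rw [hli.span_eq_top_of_card_eq_finrank (by simp)]
    trivial
  simp only [Matrix.range_cons, Matrix.range_empty, Set.union_empty, Set.singleton_union] at hz
  obtain ⟨s, t, hz⟩ := Submodule.mem_span_pair.1 hz
  exact ⟨s, t, hz.symm⟩

/-- A combination is timelike when its two coefficients have the same sign, since the product of the
two null vectors is negative. The pairing with a vector of positive coefficients then fixes this
sign. -/
theorem pos_of_null_basis (g : Plane →L[ℝ] Plane →L[ℝ] ℝ) (hsymm : ∀ v w, g v w = g w v)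
    {e n : Plane} (hee : g e e = 0) (hnn : g n n = 0) (hen : g e n < 0) {a b c d : ℝ}
    (ha : 0 < a) (hb : 0 < b) (h1 : g (a • e + b • n) (c • e + d • n) < 0)
    (h2 : g (c • e + d • n) (c • e + d • n) < 0) : 0 < c ∧ 0 < d := by
  simp only [map_add, map_smul, _root_.add_apply, _root_.smul_apply, smul_eq_mul, hee, hnn,
    hsymm n e] at h1 h2
  have h3 : 0 < a * d + b * c := by
    by_contra hc
    push Not at hc
    nlinarith [mul_nonneg_of_nonpos_of_nonpos hc hen.le]
  have h4 : 0 < c * d := by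
    by_contra hc
    push Not at hc
    nlinarith [mul_nonneg_of_nonpos_of_nonpos hc hen.le]
  rcases pos_and_pos_or_neg_and_neg_of_mul_pos h4 with h | ⟨h5, h6⟩
  · exact h
  · nlinarith

namespace OrientedSpacetime

/-- A basis of a tangent space made of a right-moving and a left-moving future-directed null
vector. -/
structure IsNullFrame (M : OrientedSpacetime.{u}) (x : M) (e n : TangentSpace (𝓡 2) x) :
    Prop where
  ee : M.metric x e e = 0
  nn : M.metric x n n = 0
  en : M.metric x e n < 0
  time : ∀ T ∈ M.timeOrientation, ∃ a b : ℝ, 0 < a ∧ 0 < b ∧ T x = a • e + b • n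
  orient : ∀ Ω ∈ M.orientation, 0 < Ω x n e

theorem timeOrientation_nonempty (M : OrientedSpacetime.{u}) : M.timeOrientation.Nonempty := by
  obtain ⟨T, hT, h⟩ := M.isTimeOrientation
  exact ⟨T, by rw [h]; exact ⟨hT, hT.2⟩⟩

theorem orientation_nonempty (M : OrientedSpacetime.{u}) : M.orientation.Nonempty := by
  obtain ⟨Ω, hΩ, h⟩ := M.isOrientation
  exact ⟨Ω, by rw [h]; exact ⟨hΩ, fun x => ⟨1, one_pos, by simp⟩⟩⟩

variable (M : OrientedSpacetime.{u})

theorem exists_isNullFrame (x : M) : ∃ e n, M.IsNullFrame x e n := by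
  obtain ⟨T, hT, hMT⟩ := M.isTimeOrientation
  obtain ⟨Ω, hΩ, hMΩ⟩ := M.isOrientation
  obtain ⟨e, n, hee, hnn, hen, hne, a, b, ha, hb, hTx⟩ := exists_null_basis (M.metric x) (Ω x)
    (M.isLorentzMetric.symm x) (M.isLorentzMetric.signature x) (hΩ.alternating x) (hΩ.ne_zero x)
    (T x) (hT.2 x)
  refine ⟨e, n, hee, hnn, hen, fun T' hT' => ?_, fun Ω' hΩ' => ?_⟩
  · rw [hMT] at hT'
    have h1 := hT'.2 x
    have h2 := hT'.1.2 x
    obtain ⟨c, d, hcd⟩ := exists_coord_null_basis (M.metric x) (M.isLorentzMetric.symm x)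
      hee hnn hen (T' x)
    obtain ⟨hc, hd⟩ := pos_of_null_basis (M.metric x) (M.isLorentzMetric.symm x) hee hnn hen ha hb
      (c := c) (d := d) (by rw [← hcd, ← hTx]; exact h1) (by rw [← hcd]; exact h2)
    exact ⟨c, d, hc, hd, hcd⟩
  · rw [hMΩ] at hΩ'
    obtain ⟨c, hc, h⟩ := hΩ'.2 x
    rw [h]
    exact mul_pos hc hne

variable {M} {x : M} {e n w w' : TangentSpace (𝓡 2) x}

namespace IsNullFrame

theorem ne (h : M.IsNullFrame x e n) : M.metric x n e < 0 := by
  rw [M.isLorentzMetric.symm]; exact h.en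

theorem exists_coord (h : M.IsNullFrame x e n) (w : TangentSpace (𝓡 2) x) :
    ∃ a b : ℝ, w = a • e + b • n :=
  exists_coord_null_basis (M.metric x) (M.isLorentzMetric.symm x) h.ee h.nn h.en w

theorem metric_apply (h : M.IsNullFrame x e n) (a b c d : ℝ) :
    M.metric x (a • e + b • n) (c • e + d • n) = (a * d + b * c) * M.metric x e n := by
  simp only [map_add, map_smul, _root_.add_apply, _root_.smul_apply,
      smul_eq_mul, h.ee, h.nn, M.isLorentzMetric.symm x n e]
  ring

theorem orientation_apply (_h : M.IsNullFrame x e n) {Ω} (hΩ : Ω ∈ M.orientation) (a b c d : ℝ) :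
    Ω x (a • e + b • n) (c • e + d • n) = (b * c - a * d) * Ω x n e := by
  obtain ⟨Ω₀, hΩ₀, hM⟩ := M.isOrientation
  have halt : ∀ v, Ω x v v = 0 := by
    rw [hM] at hΩ
    exact hΩ.1.alternating x
  have hsk : Ω x e n = - Ω x n e := by
    have := halt (e + n)
    simp only [map_add, _root_.add_apply, halt] at this
    linarith
  simp only [map_add, map_smul, _root_.add_apply, _root_.smul_apply,
      smul_eq_mul, halt, hsk]
  ring

theorem smul_add_eq_zero (h : M.IsNullFrame x e n) {a b : ℝ} :
    a • e + b • n = 0 ↔ a = 0 ∧ b = 0 := by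
  refine ⟨fun h0 => ?_, by rintro ⟨rfl, rfl⟩; simp⟩
  have h1 := h.metric_apply a b 1 0
  have h2 := h.metric_apply a b 0 1
  rw [h0] at h1 h2
  simp [h.en.ne] at h1 h2
  exact ⟨h2, h1⟩

/-- The square of `a • e + b • n` is `2ab` times a negative number, so non-spacelike vectors fill
two opposite closed quadrants of the coefficient plane. A time-orienting vector has positive
coefficients and selects one of them. -/
theorem isFutureDirected_iff (h : M.IsNullFrame x e n) {a b : ℝ} :
    M.IsFutureDirected (a • e + b • n) ↔ 0 ≤ a ∧ 0 ≤ b ∧ 0 < a + b := by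
  have hen := h.en
  obtain ⟨T₀, hT₀⟩ := M.timeOrientation_nonempty
  constructor
  · rintro ⟨h0, h1, T, hT, h2⟩
    obtain ⟨c, d, hc, hd, hTx⟩ := h.time T hT
    rw [hTx, h.metric_apply] at h2
    rw [h.metric_apply] at h1
    have h3 : 0 < c * b + d * a := by
      by_contra hcon
      push Not at hcon
      nlinarith [mul_nonneg_of_nonpos_of_nonpos hcon hen.le]
    have h4 : 0 ≤ a * b := by
      by_contra hcon
      push Not at hcon
      nlinarith [mul_pos_of_neg_of_neg hcon hen]
    have ha : 0 ≤ a := by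
      by_contra ha
      push Not at ha
      have hb : b ≤ 0 := by by_contra hb; push Not at hb; nlinarith
      nlinarith
    have hb : 0 ≤ b := by
      by_contra hb
      push Not at hb
      have ha : a ≤ 0 := by by_contra ha; push Not at ha; nlinarith
      nlinarith
    refine ⟨ha, hb, ?_⟩
    by_contra hab
    have ha0 : a = 0 := by linarith
    have hb0 : b = 0 := by linarith
    exact h0 (h.smul_add_eq_zero.2 ⟨ha0, hb0⟩)
  · rintro ⟨ha, hb, hab⟩
    refine ⟨?_, ?_, T₀, hT₀, ?_⟩
    · rw [Ne, h.smul_add_eq_zero]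
      rintro ⟨rfl, rfl⟩
      simp at hab
    · rw [h.metric_apply]
      nlinarith [mul_nonneg ha hb]
    · obtain ⟨c, d, hc, hd, hTx⟩ := h.time T₀ hT₀
      rw [hTx, h.metric_apply]
      apply mul_neg_of_pos_of_neg _ hen
      rcases ha.eq_or_lt with rfl | ha
      · have : 0 < b := by linarith
        positivity
      · positivity

/-- The non-timelike vectors fill the other two quadrants, and the area form paired with a
time-orienting vector separates them. -/
theorem isRightPointing_iff (h : M.IsNullFrame x e n) {a b : ℝ} :
    M.IsRightPointing (a • e + b • n) ↔ 0 ≤ a ∧ b ≤ 0 ∧ 0 < a - b := by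
  have hen := h.en
  obtain ⟨T₀, hT₀⟩ := M.timeOrientation_nonempty
  obtain ⟨Ω₀, hΩ₀⟩ := M.orientation_nonempty
  constructor
  · rintro ⟨h0, h1, Ω, hΩ, T, hT, h2⟩
    obtain ⟨c, d, hc, hd, hTx⟩ := h.time T hT
    have hk := h.orient Ω hΩ
    rw [hTx, h.orientation_apply hΩ] at h2
    rw [h.metric_apply] at h1
    have h3 : 0 < d * a - c * b := by
      by_contra hcon
      push Not at hcon
      nlinarith
    have h4 : a * b ≤ 0 := by
      by_contra hcon
      push Not at hcon
      nlinarith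
    have ha : 0 ≤ a := by
      by_contra ha
      push Not at ha
      have hb : 0 ≤ b := by by_contra hb; push Not at hb; nlinarith
      nlinarith
    have hb : b ≤ 0 := by
      by_contra hb
      push Not at hb
      have ha : a ≤ 0 := by by_contra ha; push Not at ha; nlinarith
      nlinarith
    refine ⟨ha, hb, ?_⟩
    by_contra hab
    have ha0 : a = 0 := by linarith
    have hb0 : b = 0 := by linarith
    exact h0 (h.smul_add_eq_zero.2 ⟨ha0, hb0⟩)
  · rintro ⟨ha, hb, hab⟩
    refine ⟨?_, ?_, Ω₀, hΩ₀, T₀, hT₀, ?_⟩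
    · rw [Ne, h.smul_add_eq_zero]
      rintro ⟨rfl, rfl⟩
      simp at hab
    · rw [h.metric_apply]
      nlinarith [mul_nonneg ha (neg_nonneg.2 hb)]
    · obtain ⟨c, d, hc, hd, hTx⟩ := h.time T₀ hT₀
      rw [hTx, h.orientation_apply hΩ₀]
      apply mul_pos _ (h.orient Ω₀ hΩ₀)
      rcases ha.eq_or_lt with rfl | ha
      · have : b < 0 := by linarith
        nlinarith
      · nlinarith [mul_pos hd ha]

theorem isPositivelyOriented_iff (h : M.IsNullFrame x e n) {a b c d : ℝ} :
    M.IsPositivelyOriented (a • e + b • n) (c • e + d • n) ↔ 0 < b * c - a * d := by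
  obtain ⟨Ω₀, hΩ₀⟩ := M.orientation_nonempty
  constructor
  · rintro ⟨Ω, hΩ, h1⟩
    rw [h.orientation_apply hΩ] at h1
    exact pos_of_mul_pos_left h1 (h.orient Ω hΩ).le
  · intro h1
    refine ⟨Ω₀, hΩ₀, ?_⟩
    rw [h.orientation_apply hΩ₀]
    exact mul_pos h1 (h.orient Ω₀ hΩ₀)

end IsNullFrame

/-- Null, future-directed and right-pointing vectors. -/
def IsRightNull (M : OrientedSpacetime.{u}) {x : M} (w : TangentSpace (𝓡 2) x) : Prop :=
  M.IsNull w ∧ M.IsFutureDirected w ∧ M.IsRightPointing w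

/-- Null, future-directed and left-pointing vectors. -/
def IsLeftNull (M : OrientedSpacetime.{u}) {x : M} (w : TangentSpace (𝓡 2) x) : Prop :=
  M.IsNull w ∧ M.IsFutureDirected w ∧ M.IsLeftPointing w

theorem isRightPointing_neg : M.IsRightPointing (-w) ↔ M.IsLeftPointing w := by
  simp only [IsRightPointing, IsLeftPointing, ne_eq, neg_eq_zero (a := w), map_neg,
    _root_.neg_apply, neg_neg (M.metric x w w), Left.neg_pos_iff]

theorem isFutureDirected_neg : M.IsFutureDirected (-w) ↔ M.IsPastDirected w := by
  simp [IsFutureDirected, IsPastDirected]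

theorem isNull_neg : M.IsNull (-w) ↔ M.IsNull w := by
  simp [IsNull]

/-- Lets the second alternative of `IsRightChiral` be treated as the first one with reversed
velocity. -/
theorem isRightNull_neg :
    M.IsRightNull (-w) ↔ M.IsNull w ∧ M.IsPastDirected w ∧ M.IsLeftPointing w := by
  rw [IsRightNull, isNull_neg, isFutureDirected_neg, isRightPointing_neg]

namespace IsNullFrame

theorem isRightNull_iff (h : M.IsNullFrame x e n) {a b : ℝ} :
    M.IsRightNull (a • e + b • n) ↔ 0 < a ∧ b = 0 := by
  rw [IsRightNull, h.isFutureDirected_iff, h.isRightPointing_iff]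
  constructor
  · rintro ⟨-, ⟨h1, h2, h3⟩, ⟨-, h4, -⟩⟩
    have hb : b = 0 := le_antisymm h4 h2
    exact ⟨by linarith, hb⟩
  · rintro ⟨ha, rfl⟩
    refine ⟨⟨?_, ?_⟩, ⟨ha.le, le_rfl, by linarith⟩, ha.le, le_rfl, by linarith⟩
    · rw [Ne, h.smul_add_eq_zero]
      rintro ⟨rfl, -⟩
      simp at ha
    · rw [h.metric_apply]; ring

theorem isLeftNull_iff (h : M.IsNullFrame x e n) {a b : ℝ} :
    M.IsLeftNull (a • e + b • n) ↔ 0 < b ∧ a = 0 := by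
  rw [IsLeftNull, ← isRightPointing_neg, h.isFutureDirected_iff, neg_add, ← neg_smul, ← neg_smul,
    h.isRightPointing_iff]
  constructor
  · rintro ⟨-, ⟨h1, h2, h3⟩, ⟨h5, h4, -⟩⟩
    have hb : a = 0 := le_antisymm (by linarith) h1
    exact ⟨by linarith, hb⟩
  · rintro ⟨ha, rfl⟩
    refine ⟨⟨?_, ?_⟩, ⟨le_rfl, ha.le, by linarith⟩, by simp, by linarith, by linarith⟩
    · rw [Ne, h.smul_add_eq_zero]
      rintro ⟨-, rfl⟩
      simp at ha
    · rw [h.metric_apply]; ring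

theorem isRightNull_left (h : M.IsNullFrame x e n) : M.IsRightNull e := by
  have := h.isRightNull_iff (a := 1) (b := 0)
  simp at this
  exact this

end IsNullFrame

/-- In a null frame the right-moving null vectors are the positive multiples of the first vector.
That they make up a single ray is what allows a canonical right-moving vector field. -/
theorem IsRightNull.exists_smul (hw : M.IsRightNull w) (hw' : M.IsRightNull w') :
    ∃ c : ℝ, 0 < c ∧ w' = c • w := by
  obtain ⟨e, n, h⟩ := M.exists_isNullFrame x
  obtain ⟨a, b, rfl⟩ := h.exists_coord w
  obtain ⟨c, d, rfl⟩ := h.exists_coord w'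
  rw [h.isRightNull_iff] at hw hw'
  obtain ⟨ha, rfl⟩ := hw
  obtain ⟨hc, rfl⟩ := hw'
  refine ⟨c / a, div_pos hc ha, ?_⟩
  rw [smul_add, smul_smul, smul_smul, div_mul_cancel₀ _ ha.ne', mul_zero]

theorem IsRightNull.smul (hw : M.IsRightNull w) {c : ℝ} (hc : 0 < c) : M.IsRightNull (c • w) := by
  obtain ⟨e, n, h⟩ := M.exists_isNullFrame x
  obtain ⟨a, b, rfl⟩ := h.exists_coord w
  rw [h.isRightNull_iff] at hw
  rw [smul_add, smul_smul, smul_smul, h.isRightNull_iff, hw.2]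
  exact ⟨mul_pos hc hw.1, mul_zero _⟩

/-- A right-moving and a left-moving null vector form a null frame. -/
theorem IsRightNull.isNullFrame (hw : M.IsRightNull w) (hw' : M.IsLeftNull w') :
    M.IsNullFrame x w w' := by
  obtain ⟨e, n, h⟩ := M.exists_isNullFrame x
  obtain ⟨a, b, rfl⟩ := h.exists_coord w
  obtain ⟨c, d, rfl⟩ := h.exists_coord w'
  rw [h.isRightNull_iff] at hw
  rw [h.isLeftNull_iff] at hw'
  obtain ⟨ha, rfl⟩ := hw
  obtain ⟨hd, rfl⟩ := hw'
  refine ⟨?_, ?_, ?_, fun T hT => ?_, fun Ω hΩ => ?_⟩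
  · rw [h.metric_apply]; ring
  · rw [h.metric_apply]; ring
  · rw [h.metric_apply]
    apply mul_neg_of_pos_of_neg _ h.en
    simpa using mul_pos ha hd
  · obtain ⟨s, t, hs, ht, hT⟩ := h.time T hT
    refine ⟨s / a, t / d, by positivity, by positivity, ?_⟩
    rw [hT, smul_add, smul_add, smul_smul, smul_smul, smul_smul, smul_smul,
      div_mul_cancel₀ _ ha.ne', div_mul_cancel₀ _ hd.ne']
    simp
  · rw [h.orientation_apply hΩ]
    apply mul_pos _ (h.orient Ω hΩ)
    simpa using mul_pos hd ha

theorem IsRightNull.metric_neg (hw : M.IsRightNull w) {T} (hT : T ∈ M.timeOrientation) :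
    M.metric x (T x) w < 0 := by
  obtain ⟨e, n, h⟩ := M.exists_isNullFrame x
  obtain ⟨a, b, rfl⟩ := h.exists_coord w
  rw [h.isRightNull_iff] at hw
  obtain ⟨s, t, hs, ht, hTx⟩ := h.time T hT
  rw [hTx, h.metric_apply, hw.2]
  exact mul_neg_of_pos_of_neg (by nlinarith [mul_pos ht hw.1]) h.en

theorem isRightNull_of_isNull {T Ω} (hT : T ∈ M.timeOrientation) (hΩ : Ω ∈ M.orientation)
    (h0 : M.metric x w w = 0) (h1 : M.metric x (T x) w < 0) (h2 : 0 < Ω x (T x) w) :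
    M.IsRightNull w := by
  have hw : w ≠ 0 := by rintro rfl; simp at h1
  exact ⟨⟨hw, h0⟩, ⟨hw, h0.le, T, hT, h1⟩, hw, h0.ge, Ω, hΩ, T, hT, h2⟩

theorem isLeftNull_of_isNull {T Ω} (hT : T ∈ M.timeOrientation) (hΩ : Ω ∈ M.orientation)
    (h0 : M.metric x w w = 0) (h1 : M.metric x (T x) w < 0) (h2 : Ω x (T x) w < 0) :
    M.IsLeftNull w := by
  have hw : w ≠ 0 := by rintro rfl; simp at h1
  exact ⟨⟨hw, h0⟩, ⟨hw, h0.le, T, hT, h1⟩, hw, h0.ge, Ω, hΩ, T, hT, h2⟩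

/-- The metric pulls back to a positive multiple of itself, so a vector in the kernel is orthogonal
to both members of a null frame and vanishes by non-degeneracy. -/
theorem IsConformalMorphism.injective_mfderiv {M N : OrientedSpacetime.{u}} {f : M → N}
    (hf : IsConformalMorphism M N f) (x : M) :
    Function.Injective (mfderiv (𝓡 2) (𝓡 2) f x) := by
  obtain ⟨σ, -, hσ⟩ := hf.conformal
  obtain ⟨e, n, h⟩ := M.exists_isNullFrame x
  rw [injective_iff_map_eq_zero]
  intro w hw
  obtain ⟨a, b, rfl⟩ := h.exists_coord w
  have h1 := hσ x (a • e + b • n) (1 • e + 0 • n)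
  have h2 := hσ x (a • e + b • n) (0 • e + 1 • n)
  rw [hw] at h1 h2
  simp [Real.exp_ne_zero] at h1 h2
  simp only [h.ee, h.nn, mul_zero, zero_add, add_zero] at h1 h2
  exact h.smul_add_eq_zero.2 ⟨(mul_eq_zero.1 h2).resolve_right h.en.ne,
    (mul_eq_zero.1 h1).resolve_right h.ne.ne⟩

/-- For the reflecting direction, the image of a right-moving frame vector already spans the only
right-moving ray at the image point, and the derivative is injective. -/
theorem IsConformalMorphism.isRightNull_map_iff {M N : OrientedSpacetime.{u}} {f : M → N}
    (hf : IsConformalMorphism M N f) {x : M} {w : TangentSpace (𝓡 2) x} :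
    N.IsRightNull (mfderiv (𝓡 2) (𝓡 2) f x w) ↔ M.IsRightNull w := by
  refine ⟨fun h => ?_, fun h => hf.map_right h.1 h.2.1 h.2.2⟩
  obtain ⟨e, n, hen⟩ := M.exists_isNullFrame x
  have he := hen.isRightNull_left
  have he' : N.IsRightNull (mfderiv (𝓡 2) (𝓡 2) f x e) := hf.map_right he.1 he.2.1 he.2.2
  obtain ⟨c, hc, h1⟩ := he'.exists_smul h
  rw [← map_smul] at h1
  rw [hf.injective_mfderiv x h1]
  exact he.smul hc

end OrientedSpacetime

/-! ## First integrals of planar vector fields -/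

section Superposition

variable {K : Type*} [TopologicalSpace K] [CompactSpace K]
  {E F : Type u} [NormedAddCommGroup E] [NormedSpace ℝ E] [NormedAddCommGroup F] [NormedSpace ℝ F]

/-- Pointwise application of a continuous bilinear map to continuous functions. -/
noncomputable def ContinuousMap.bilinApply {G : Type*} [NormedAddCommGroup G] [NormedSpace ℝ G]
    (B : G →L[ℝ] E →L[ℝ] F) : C(K, G) →L[ℝ] C(K, E) →L[ℝ] C(K, F) :=
  LinearMap.mkContinuous₂
    (LinearMap.mk₂ ℝ (fun (A : C(K, G)) (h : C(K, E)) =>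
        (⟨fun r => B (A r) (h r), by fun_prop⟩ : C(K, F)))
      (fun A B h => by ext; simp) (fun c A h => by ext; simp)
      (fun A h k => by ext; simp) (fun c A h => by ext; simp)) ‖B‖ (fun A h => by
    rw [ContinuousMap.norm_le _ (by positivity)]
    intro r
    exact (B.le_opNorm₂ (A r) (h r)).trans (by
      have := A.norm_coe_le_norm r
      have := h.norm_coe_le_norm r
      gcongr))

/-- Pointwise application of a continuous family of continuous linear maps. -/
noncomputable abbrev ContinuousMap.clmApply : C(K, E →L[ℝ] F) →L[ℝ] C(K, E) →L[ℝ] C(K, F) :=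
  ContinuousMap.bilinApply (.id ℝ (E →L[ℝ] F))

-- The range of `z` is compact, so `f'` is uniformly continuous near it. One radius `δ` then serves
-- all parameters in the mean value inequality.
set_option synthInstance.maxHeartbeats 200000 in
theorem ContinuousMap.hasFDerivAt_postcomp {f : C(E, F)} {f' : C(E, E →L[ℝ] F)}
    (hf : ∀ x, HasFDerivAt f (f' x) x) (z : C(K, E)) :
    HasFDerivAt (fun z : C(K, E) => f.comp z) (ContinuousMap.clmApply (f'.comp z)) z := by
  rw [hasFDerivAt_iff_isLittleO_nhds_zero, Asymptotics.isLittleO_iff]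
  intro c hc
  have h1 := (isCompact_range z.continuous).uniformContinuousAt_of_continuousAt f'
    (fun a _ => f'.continuous.continuousAt) (Metric.dist_mem_uniformity hc)
  obtain ⟨δ, hδ, h2⟩ := Metric.mem_uniformity_dist.1 h1
  filter_upwards [Metric.ball_mem_nhds (0 : C(K, E)) hδ] with h hh
  rw [mem_ball_zero_iff] at hh
  rw [ContinuousMap.norm_le _ (by positivity)]
  intro r
  have hr : ‖h r‖ ≤ ‖h‖ := h.norm_coe_le_norm r
  have h3 := (convex_ball (z r) δ).norm_image_sub_le_of_norm_hasFDerivWithin_le' (𝕜 := ℝ)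
    (f := f) (f' := f') (φ := f' (z r)) (C := c) (x := z r) (y := z r + h r)
    (fun x _ => (hf x).hasFDerivWithinAt)
    (fun x hx => by
      have := h2 (a := z r) (b := x) (by rw [dist_comm]; exact hx) (mem_range_self r)
      rw [← dist_eq_norm, dist_comm]
      exact le_of_lt this)
    (Metric.mem_ball_self hδ) (by simpa using hr.trans_lt hh)
  rw [add_sub_cancel_left] at h3
  exact h3.trans (mul_le_mul_of_nonneg_left hr hc.le)

-- The derivative of superposition with `f` is superposition with `f'` followed by a continuous
-- linear map, which gives an induction on the order. The target varies in the induction, from `F`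
-- to `E →L[ℝ] F`; this is why `E` and `F` share a universe.
set_option synthInstance.maxHeartbeats 200000 in
theorem ContinuousMap.contDiff_postcomp_nat (n : ℕ) {F : Type u} [NormedAddCommGroup F]
    [NormedSpace ℝ F] {f : C(E, F)} (hf : ContDiff ℝ n f) :
    ContDiff ℝ n (fun z : C(K, E) => f.comp z) := by
  induction n generalizing F with
  | zero => exact contDiff_zero.2 (ContinuousMap.continuous_postcomp f)
  | succ n ih =>
    obtain ⟨f', hf', h⟩ := contDiff_succ_iff_hasFDerivAt.1 (by exact_mod_cast hf)
    have h1 := ih (f := ⟨f', hf'.continuous⟩) hf'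
    have h2 : ContDiff ℝ n (fun A => ContinuousMap.clmApply (K := K) (E := E) (F := F) A) :=
      ContinuousLinearMap.contDiff _
    push_cast
    exact contDiff_succ_iff_hasFDerivAt.2 ⟨fun z => ContinuousMap.clmApply (ContinuousMap.comp ⟨f', hf'.continuous⟩ z),
      h2.comp h1, fun z =>
      ContinuousMap.hasFDerivAt_postcomp (f' := ⟨f', hf'.continuous⟩) h z⟩

/-- Superposition with a smooth map is a smooth map between spaces of continuous functions. -/
theorem ContinuousMap.contDiff_postcomp {f : C(E, F)} (hf : ContDiff ℝ ∞ f) :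
    ContDiff ℝ ∞ (fun z : C(K, E) => f.comp z) :=
  contDiff_infty.2 fun n => ContinuousMap.contDiff_postcomp_nat n (contDiff_infty.1 hf n)

end Superposition

section FirstIntegral

open unitInterval

/-- The operator taking `h` to `s ↦ ∫ r in s..1, h r`. -/
noncomputable def integralToOne : C(I, ℝ) →L[ℝ] C(I, ℝ) :=
  LinearMap.mkContinuous
    { toFun := fun h => ⟨fun s => ∫ r in (s : ℝ)..1, IccExtend zero_le_one h r, by
        have h1 : Continuous (IccExtend (zero_le_one (α := ℝ)) h) := h.continuous.Icc_extend'
        simp_rw [intervalIntegral.integral_symm (1 : ℝ)]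
        exact ((intervalIntegral.continuous_primitive (fun a b => h1.intervalIntegrable a b)
          1).comp continuous_subtype_val).neg⟩
      map_add' := fun h k => by
        ext s
        have h1 : Continuous (IccExtend (zero_le_one (α := ℝ)) h) := h.continuous.Icc_extend'
        have h2 : Continuous (IccExtend (zero_le_one (α := ℝ)) k) := k.continuous.Icc_extend'
        exact intervalIntegral.integral_add (h1.intervalIntegrable _ _)
          (h2.intervalIntegrable _ _)
      map_smul' := fun c h => by
        ext s
        exact intervalIntegral.integral_const_mul _ _ } 1 (fun h => by
    rw [ContinuousMap.norm_le _ (by positivity)]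
    intro s
    refine (intervalIntegral.norm_integral_le_of_norm_le_const (C := ‖h‖) fun r _ =>
      h.norm_coe_le_norm _).trans ?_
    rw [abs_of_nonneg (by linarith [s.2.2]), one_mul]
    exact mul_le_of_le_one_right (norm_nonneg _) (by linarith [s.2.1]))

theorem integralToOne_apply (h : C(I, ℝ)) (s : I) :
    integralToOne h s = ∫ r in (s : ℝ)..1, IccExtend zero_le_one h r := rfl

theorem norm_integralToOne_le (h : C(I, ℝ)) : ‖integralToOne h‖ ≤ ‖h‖ := by
  have := (integralToOne).le_of_opNorm_le (LinearMap.mkContinuous_norm_le _ zero_le_one _) h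
  simpa using this

/-- The pairing `(x, z) ↦ (r ↦ (r * x, z r))`. -/
noncomputable def graphPairing : ℝ × C(I, ℝ) →L[ℝ] C(I, ℝ × ℝ) :=
  (ContinuousLinearMap.fst ℝ ℝ C(I, ℝ)).smulRight
      (⟨fun r => ((r : ℝ), (0 : ℝ)), by fun_prop⟩ : C(I, ℝ × ℝ)) +
    ((ContinuousLinearMap.inr ℝ ℝ ℝ).compLeftContinuous ℝ I).comp
      (ContinuousLinearMap.snd ℝ ℝ C(I, ℝ))

theorem graphPairing_apply (x : ℝ) (z : C(I, ℝ)) (r : I) :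
    graphPairing (x, z) r = (x * r, z r) := by
  simp [graphPairing]

variable (m : C(ℝ × ℝ, ℝ))

/-- The nonlinear part of the integral equation of `dy/dx = m (x, y)`. -/
noncomputable def slopeIntegral (p : ℝ × C(I, ℝ)) : C(I, ℝ) :=
  p.1 • integralToOne (m.comp (graphPairing p))

theorem slopeIntegral_apply (x : ℝ) (z : C(I, ℝ)) (s : I) :
    slopeIntegral m (x, z) s =
      x * ∫ r in (s : ℝ)..1, m (x * r, IccExtend zero_le_one z r) := by
  rw [slopeIntegral, ContinuousMap.smul_apply, integralToOne_apply, smul_eq_mul]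
  congr 1
  apply intervalIntegral.integral_congr
  intro r hr
  rw [uIcc_of_le s.2.2] at hr
  have hr' : r ∈ Icc (0 : ℝ) 1 := ⟨s.2.1.trans hr.1, hr.2⟩
  simp only [IccExtend_of_mem zero_le_one _ hr']
  rw [ContinuousMap.comp_apply, graphPairing_apply]

variable {m}

/-- Rescaling the interval between the axis and the starting abscissa to the unit interval puts the
solutions for all starting points into one Banach space. Smooth dependence on the starting point
thereby becomes a question about implicit functions. -/
theorem contDiff_slopeIntegral (hm : ContDiff ℝ ∞ m) : ContDiff ℝ ∞ (slopeIntegral m) := by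
  have h1 : ContDiff ℝ ∞ (fun p => m.comp (graphPairing p)) :=
    (ContinuousMap.contDiff_postcomp hm).comp graphPairing.contDiff
  exact contDiff_fst.smul (integralToOne.contDiff.comp h1)

theorem norm_slopeIntegral_sub_le {K : NNReal} (hK : LipschitzWith K m) (x : ℝ) (z w : C(I, ℝ)) :
    ‖slopeIntegral m (x, z) - slopeIntegral m (x, w)‖ ≤ |x| * K * ‖z - w‖ := by
  rw [slopeIntegral, slopeIntegral, ← smul_sub, ← map_sub, norm_smul, Real.norm_eq_abs, mul_assoc]
  refine mul_le_mul_of_nonneg_left ((norm_integralToOne_le _).trans ?_) (abs_nonneg x)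
  rw [ContinuousMap.norm_le _ (by positivity)]
  intro r
  have h1 := hK.dist_le_mul (x * r, z r) (x * r, w r)
  rw [ContinuousMap.sub_apply, ContinuousMap.comp_apply, ContinuousMap.comp_apply,
    graphPairing_apply, graphPairing_apply, ← dist_eq_norm]
  refine h1.trans (mul_le_mul_of_nonneg_left ?_ K.2)
  rw [Prod.dist_eq, dist_self, max_eq_right dist_nonneg, dist_eq_norm]
  exact (z - w).norm_coe_le_norm r

theorem lipschitzWith_slopeIntegral {K : NNReal} (hK : LipschitzWith K m) (x : ℝ) :
    LipschitzWith (‖x‖₊ * K) (fun z => slopeIntegral m (x, z)) :=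
  LipschitzWith.of_dist_le_mul fun z w => by
    rw [dist_eq_norm, dist_eq_norm]
    exact norm_slopeIntegral_sub_le hK x z w

/-- The right-hand side of the integral equation is a contraction in `z` with constant `|x| * K`, so
Banach's fixed point theorem applies near the axis without shrinking the range of `y`. -/
theorem existsUnique_slopeIntegral {K : NNReal} (hK : LipschitzWith K m) {x : ℝ}
    (hx : |x| * K < 1) (y : ℝ) :
    ∃! z : C(I, ℝ), z = ContinuousMap.const I y - slopeIntegral m (x, z) := by
  have hc : ContractingWith (‖x‖₊ * K)
      (fun z => ContinuousMap.const I y - slopeIntegral m (x, z)) := by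
    refine ⟨?_, ?_⟩
    · rw [← NNReal.coe_lt_coe]
      simpa using hx
    · apply LipschitzWith.of_dist_le_mul fun z w => ?_
      rw [dist_sub_left]
      exact (lipschitzWith_slopeIntegral hK x).dist_le_mul z w
  refine ⟨hc.fixedPoint, hc.fixedPoint_isFixedPt.symm, fun w hw => ?_⟩
  exact hc.fixedPoint_unique hw.symm

open Classical in
/-- The solution of `dy/dx = m (x, y)` through `(x, y)`, parametrised by the unit interval. -/
noncomputable def slopeSolution (m : C(ℝ × ℝ, ℝ)) (p : ℝ × ℝ) : C(I, ℝ) :=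
  if h : ∃ z : C(I, ℝ), z = ContinuousMap.const I p.2 - slopeIntegral m (p.1, z) then h.choose
  else 0

theorem slopeSolution_spec {K : NNReal} (hK : LipschitzWith K m) {p : ℝ × ℝ}
    (hx : |p.1| * K < 1) : slopeSolution m p =
      ContinuousMap.const I p.2 - slopeIntegral m (p.1, slopeSolution m p) := by
  have h := (existsUnique_slopeIntegral hK hx p.2).exists
  rw [slopeSolution, dif_pos h]
  exact h.choose_spec

theorem eq_slopeSolution {K : NNReal} (hK : LipschitzWith K m) {p : ℝ × ℝ}
    (hx : |p.1| * K < 1) {z : C(I, ℝ)}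
    (hz : z = ContinuousMap.const I p.2 - slopeIntegral m (p.1, z)) : z = slopeSolution m p :=
  (existsUnique_slopeIntegral hK hx p.2).unique hz (slopeSolution_spec hK hx)

/-- The implicit function theorem is applied to the integral equation. The smooth implicit solution
is the chosen one because solutions are unique. -/
theorem contDiffAt_slopeSolution {K : NNReal} (hK : LipschitzWith K m) (hm : ContDiff ℝ ∞ m)
    {p : ℝ × ℝ} (hx : |p.1| * K < 1) : ContDiffAt ℝ ∞ (slopeSolution m) p := by
  set S : (ℝ × ℝ) × C(I, ℝ) → C(I, ℝ) := fun q => slopeIntegral m (q.1.1, q.2) with hS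
  have hSd : ContDiff ℝ ∞ S := (contDiff_slopeIntegral hm).comp
    ((contDiff_fst.comp contDiff_fst).prodMk contDiff_snd)
  set F : (ℝ × ℝ) × C(I, ℝ) → C(I, ℝ) := fun q => q.2 - (q.1.2 • (1 : C(I, ℝ)) - S q) with hF
  have hFd : ContDiff ℝ ∞ F :=
    contDiff_snd.sub (((contDiff_snd.comp contDiff_fst).smul contDiff_const).sub hSd)
  have hF0 : ∀ q, F q = 0 ↔ q.2 = ContinuousMap.const I q.1.2 - slopeIntegral m (q.1.1, q.2) := by
    intro q
    rw [hF, sub_eq_zero]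
    have : q.1.2 • (1 : C(I, ℝ)) = ContinuousMap.const I q.1.2 := by ext; simp
    simp only [this, hS]
  set u₀ : (ℝ × ℝ) × C(I, ℝ) := (p, slopeSolution m p) with hu
  have hFu : F u₀ = 0 := (hF0 u₀).2 (slopeSolution_spec hK hx)
  -- The partial derivative in `z` is `id + D`, and the Lipschitz bound gives `‖D‖ ≤ |p.1| * K < 1`;
  -- a Neumann series inverts it.
  have hinv : (fderiv ℝ F u₀ ∘L .inr ℝ (ℝ × ℝ) C(I, ℝ)).IsInvertible := by
    set D := fderiv ℝ (fun z => slopeIntegral m (p.1, z)) (slopeSolution m p) with hD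
    have hDn : ‖-D‖ < 1 := by
      refine (norm_neg D).trans_lt ((norm_fderiv_le_of_lipschitz ℝ (lipschitzWith_slopeIntegral hK p.1)).trans_lt ?_)
      simpa using hx
    have hd : DifferentiableAt ℝ (fun z => slopeIntegral m (p.1, z)) (slopeSolution m p) :=
      ((contDiff_slopeIntegral hm).comp
        (contDiff_const.prodMk contDiff_id)).differentiable (by simp) _
    have h1 : HasFDerivAt (fun z => F (p, z)) (.id ℝ C(I, ℝ) + D) (slopeSolution m p) := by
      have h2 := (hasFDerivAt_id (𝕜 := ℝ) (slopeSolution m p)).fun_sub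
        ((hasFDerivAt_const (p.2 • (1 : C(I, ℝ))) (slopeSolution m p)).fun_sub hd.hasFDerivAt)
      rw [zero_sub, sub_neg_eq_add] at h2
      exact h2
    have h3 : HasFDerivAt (fun z => F (p, z)) (fderiv ℝ F u₀ ∘L .inr ℝ (ℝ × ℝ) C(I, ℝ))
        (slopeSolution m p) :=
      HasFDerivAt.comp (slopeSolution m p) (hFd.differentiable (by simp) u₀).hasFDerivAt
        (hasFDerivAt_prodMk_right p (slopeSolution m p))
    rw [h3.unique h1]
    have h4 := isUnit_one_sub_of_norm_lt_one (R := C(I, ℝ) →L[ℝ] C(I, ℝ)) (x := -D) hDn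
    rw [sub_neg_eq_add] at h4
    obtain ⟨U, hU⟩ := h4
    exact ⟨ContinuousLinearEquiv.unitsEquiv ℝ C(I, ℝ) U, by
      ext1 z
      exact congrArg (fun (A : C(I, ℝ) →L[ℝ] C(I, ℝ)) => A z) hU⟩
  have hcd : ContDiffAt ℝ ∞ F u₀ := hFd.contDiffAt
  refine (hcd.contDiffAt_implicitFunction (by simp) hinv).congr_of_eventuallyEq ?_
  have hopen : ∀ᶠ q : ℝ × ℝ in 𝓝 p, |q.1| * K < 1 :=
    (isOpen_lt (by fun_prop) continuous_const).mem_nhds hx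
  filter_upwards [hopen, hcd.eventually_apply_implicitFunction (by simp) hinv] with q hq h
  symm
  apply eq_slopeSolution hK hq
  rw [hFu] at h
  exact (hF0 _).1 h

theorem slopeSolution_apply {K : NNReal} (hK : LipschitzWith K m) {p : ℝ × ℝ}
    (hx : |p.1| * K < 1) (s : I) : slopeSolution m p s =
      p.2 - p.1 * ∫ r in (s : ℝ)..1, m (p.1 * r, IccExtend zero_le_one (slopeSolution m p) r) := by
  conv_lhs => rw [slopeSolution_spec hK hx]
  rw [ContinuousMap.sub_apply, slopeIntegral_apply, ContinuousMap.const_apply]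

/-- The rescaled curve `r ↦ z (s * r)` solves the equation for the starting point `(s * p.1, z s)`,
so by uniqueness it is the solution through that point. Parameter `0` lies on the axis in both
parametrisations. -/
theorem slopeSolution_restrict {K : NNReal} (hK : LipschitzWith K m) {p : ℝ × ℝ}
    (hx : |p.1| * K < 1) (s : I) :
    slopeSolution m (s * p.1, slopeSolution m p s) 0 = slopeSolution m p 0 := by
  set z := slopeSolution m p with hz
  have hx' : |(s : ℝ) * p.1| * K < 1 := by
    rw [abs_mul, abs_of_nonneg s.2.1, mul_assoc]
    exact (mul_le_of_le_one_left (by positivity) s.2.2).trans_lt hx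
  have hzc : Continuous (IccExtend (zero_le_one (α := ℝ)) z) := z.continuous.Icc_extend'
  set w : C(I, ℝ) := ⟨fun r => z (s * r), by fun_prop⟩ with hw
  have key : w = slopeSolution m (s * p.1, z s) := by
    apply eq_slopeSolution hK hx'
    ext r
    rw [ContinuousMap.sub_apply, slopeIntegral_apply, ContinuousMap.const_apply]
    have h1 : (s : ℝ) * ∫ ρ in (r : ℝ)..1, m (p.1 * (s * ρ), IccExtend zero_le_one z (s * ρ)) =
        ∫ τ in (s : ℝ) * r..s * 1, m (p.1 * τ, IccExtend zero_le_one z τ) :=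
      intervalIntegral.mul_integral_comp_mul_left (s : ℝ)
        (f := fun τ => m (p.1 * τ, IccExtend zero_le_one z τ))
    have h2 : ∫ ρ in (r : ℝ)..1, m (s * p.1 * ρ, IccExtend zero_le_one w ρ) =
        ∫ ρ in (r : ℝ)..1, m (p.1 * (s * ρ), IccExtend zero_le_one z (s * ρ)) := by
      apply intervalIntegral.integral_congr
      intro ρ hρ
      rw [uIcc_of_le r.2.2] at hρ
      have hρ' : ρ ∈ Icc (0 : ℝ) 1 := ⟨r.2.1.trans hρ.1, hρ.2⟩
      have hsρ : s * ρ ∈ Icc (0 : ℝ) 1 :=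
        ⟨mul_nonneg s.2.1 hρ'.1, mul_le_one₀ s.2.2 hρ'.1 hρ'.2⟩
      simp only [IccExtend_of_mem zero_le_one _ hρ', IccExtend_of_mem zero_le_one _ hsρ, hw]
      rw [show (s : ℝ) * p.1 * ρ = p.1 * (s * ρ) by ring]
      rfl
    rw [h2, mul_comm (s : ℝ) p.1, mul_assoc, h1, mul_one]
    have hi : ∀ a b : ℝ, IntervalIntegrable (fun τ => m (p.1 * τ, IccExtend zero_le_one z τ))
        MeasureTheory.volume a b := fun a b => by
      apply Continuous.intervalIntegrable
      fun_prop
    have e1 := slopeSolution_apply hK hx s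
    have e2 := slopeSolution_apply hK hx (s * r)
    have e3 := intervalIntegral.integral_add_adjacent_intervals (hi ((s * r : I) : ℝ) s) (hi s 1)
    change z (s * r) = _
    rw [← hz] at e1 e2
    rw [e2, e1, ← e3]
    push_cast
    ring
  refine (congrArg (fun q : C(I, ℝ) => q 0) key).symm.trans ?_
  simp [hw]

/-- The first integral assigns to `p` the height at which the solution curve through `p` meets the
second axis. It is constant along that curve by `slopeSolution_restrict`; differentiating where the
curve passes through `p` gives the equation, up to a factor `p.1`. -/
theorem exists_first_integral_of_lipschitz {K : NNReal} (hK : LipschitzWith K m)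
    (hm : ContDiff ℝ ∞ m) : ∃ (U : Set (ℝ × ℝ)) (v : ℝ × ℝ → ℝ), IsOpen U ∧ 0 ∈ U ∧
      ContDiffOn ℝ ∞ v U ∧ (∀ y, v (0, y) = y) ∧ ∀ p ∈ U, fderiv ℝ v p (1, m p) = 0 := by
  set U : Set (ℝ × ℝ) := {p | |p.1| * K < 1} with hU
  have hUo : IsOpen U := isOpen_lt (by fun_prop) continuous_const
  set v : ℝ × ℝ → ℝ := fun p => slopeSolution m p 0 with hv
  have hvd : ∀ p ∈ U, ContDiffAt ℝ ∞ v p := fun p hp =>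
    (ContinuousMap.evalCLM ℝ (M := ℝ) (0 : I)).contDiff.contDiffAt.comp p
      (contDiffAt_slopeSolution hK hm hp)
  have hne : ∀ p ∈ U, p.1 ≠ 0 → fderiv ℝ v p (1, m p) = 0 := by
    intro p hp hp0
    set z := slopeSolution m p with hz
    have hzc : Continuous (IccExtend (zero_le_one (α := ℝ)) z) := z.continuous.Icc_extend'
    set z' : ℝ → ℝ := fun s =>
      p.2 - p.1 * ∫ r in s..1, m (p.1 * r, IccExtend zero_le_one z r) with hz'
    have hzz : ∀ s : I, z s = z' s := fun s => slopeSolution_apply hK hp s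
    have hz1 : z 1 = p.2 := by rw [hzz]; simp [hz']
    have hd : HasDerivAt z' (p.1 * m p) 1 := by
      have hc : Continuous fun r => m (p.1 * r, IccExtend zero_le_one z r) := by fun_prop
      have h1 := intervalIntegral.integral_hasDerivAt_left (hc.intervalIntegrable 1 1)
        hc.stronglyMeasurable.stronglyMeasurableAtFilter hc.continuousAt
      have h2 := (h1.const_mul p.1).const_sub p.2
      convert! h2 using 1
      rw [IccExtend_of_mem zero_le_one _ (by simp : (1 : ℝ) ∈ Icc (0 : ℝ) 1)]
      have h3 : z ⟨1, by simp⟩ = p.2 := hz1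
      rw [h3]
      simp
    have hd2 : HasDerivAt (fun s : ℝ => (s * p.1, z' s)) (p.1, p.1 * m p) 1 := by
      have h1 := (hasDerivAt_id (1 : ℝ)).mul_const p.1
      rw [one_mul] at h1
      exact h1.prodMk hd
    have hpt : ((1 : ℝ) * p.1, z' 1) = p := by
      rw [one_mul, ← show ((1 : I) : ℝ) = 1 from rfl, ← hzz, hz1]
    have hvp : HasFDerivAt v (fderiv ℝ v p) ((1 : ℝ) * p.1, z' 1) := by
      rw [hpt]
      exact ((hvd p hp).differentiableAt (by simp)).hasFDerivAt
    -- Constancy is known only for `s ∈ Icc 0 1`, so the derivatives at the endpoint `1` are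
    -- compared within this interval.
    have h4 := (hvp.comp_hasDerivAt (1 : ℝ) hd2).hasDerivWithinAt (s := Icc 0 1)
    have h5 : HasDerivWithinAt (v ∘ fun s : ℝ => (s * p.1, z' s)) 0 (Icc 0 1) 1 := by
      refine (hasDerivWithinAt_const (1 : ℝ) (Icc 0 1) (z 0)).congr_of_mem (fun s hs => ?_)
        (by simp)
      have h6 := slopeSolution_restrict hK hp ⟨s, hs⟩
      rw [← hz, hzz] at h6
      exact h6
    have h7 := (uniqueDiffOn_Icc zero_lt_one 1 (by simp : (1 : ℝ) ∈ Icc (0 : ℝ) 1)).eq_deriv _ h4 h5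
    have h8 : ((p.1 : ℝ), p.1 * m p) = p.1 • ((1 : ℝ), m p) := by simp
    rw [h8, map_smul, smul_eq_mul] at h7
    exact (mul_eq_zero.1 h7).resolve_left hp0
  refine ⟨U, v, hUo, by simp [hU], fun p hp => (hvd p hp).contDiffWithinAt, fun y => ?_,
    fun p hp => ?_⟩
  · have := slopeSolution_apply hK (p := (0, y)) (by simp) 0
    simpa using this
  -- On the axis the factor `p.1` cannot be cancelled; there the equation follows by continuity from
  -- nearby points off the axis.
  by_cases hp0 : p.1 = 0
  · have hc : ContinuousAt (fun q => fderiv ℝ v q (1, m q)) p :=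
      ((hvd p hp).continuousAt_fderiv (by simp)).clm_apply (by fun_prop)
    have hc2 : Tendsto (fun x : ℝ => (x, p.2)) (𝓝[≠] 0) (𝓝 p) := by
      have : Tendsto (fun x : ℝ => (x, p.2)) (𝓝 0) (𝓝 (0, p.2)) :=
        Continuous.tendsto' (by fun_prop) _ _ rfl
      rw [show p = (0, p.2) from Prod.ext hp0 rfl]
      exact this.mono_left nhdsWithin_le_nhds
    have h1 := hc.tendsto.comp hc2
    refine tendsto_nhds_unique h1 (tendsto_const_nhds.congr' ?_)
    filter_upwards [hc2 (hUo.mem_nhds hp), self_mem_nhdsWithin] with x hx hx0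
    exact (hne _ hx hx0).symm
  · exact hne p hp hp0

/-- A planar vector field of the form `∂₁ + m ∂₂` has a smooth first integral near the origin which
restricts to the second coordinate on the second axis. -/
theorem exists_first_integral {m : ℝ × ℝ → ℝ} {V : Set (ℝ × ℝ)} (hV : V ∈ 𝓝 0)
    (hm : ContDiffOn ℝ ∞ m V) : ∃ (U : Set (ℝ × ℝ)) (v : ℝ × ℝ → ℝ), IsOpen U ∧ 0 ∈ U ∧
      ContDiffOn ℝ ∞ v U ∧ (∀ y, v (0, y) = y) ∧ ∀ p ∈ U, fderiv ℝ v p (1, m p) = 0 := by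
  obtain ⟨r, hr, hrV⟩ := Metric.mem_nhds_iff.1 hV
  -- Cutting off by a bump function makes the slope globally smooth and, having compact support,
  -- Lipschitz. The conclusion is retained only on the ball where the bump equals `1`.
  let χ : ContDiffBump (0 : ℝ × ℝ) := ⟨r / 3, r / 2, by positivity, by linarith⟩
  have hsup : tsupport χ ⊆ Metric.ball 0 r := by
    rw [χ.tsupport_eq]
    exact Metric.closedBall_subset_ball (by change r / 2 < r; linarith)
  have hs : ContDiff ℝ ∞ (fun p => χ p * m p) := by
    rw [contDiff_iff_contDiffAt]
    intro p
    by_cases hp : p ∈ tsupport χ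
    · have := (hm.mono hrV).contDiffAt (Metric.isOpen_ball.mem_nhds (hsup hp))
      exact χ.contDiffAt.mul this
    · have h1 : χ =ᶠ[𝓝 p] 0 := notMem_tsupport_iff_eventuallyEq.1 hp
      refine (contDiffAt_const (c := (0 : ℝ))).congr_of_eventuallyEq ?_
      filter_upwards [h1] with q hq
      rw [hq]
      simp
  obtain ⟨K, hK⟩ := hs.lipschitzWith_of_hasCompactSupport
    (χ.hasCompactSupport.mul_right) (by simp)
  obtain ⟨U, v, hU, h0, h1, h2, h3⟩ := exists_first_integral_of_lipschitz
    (m := ⟨fun p => χ p * m p, hs.continuous⟩) hK hs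
  refine ⟨U ∩ Metric.ball 0 (r / 3), v, hU.inter Metric.isOpen_ball,
    ⟨h0, Metric.mem_ball_self (by positivity)⟩, h1.mono inter_subset_left, h2, fun p hp => ?_⟩
  have h4 := h3 p hp.1
  have h5 : χ p = 1 := χ.one_of_mem_closedBall (Metric.ball_subset_closedBall hp.2)
  simpa [h5] using h4

end FirstIntegral

/-! ## Smooth maps between surfaces -/

section Surfaces

variable {M : Type*} [TopologicalSpace M] [ChartedSpace Plane M] [IsManifold (𝓡 2) ∞ M]
  {N : Type*} [TopologicalSpace N] [ChartedSpace Plane N]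

/-- Stated for vector fields along a map `b`, at a single point, because it is applied along chart
inverses and null boxes. -/
theorem IsSmoothBilinField.contMDiffAt_apply
    {B : ∀ x : M, TangentSpace (𝓡 2) x →L[ℝ] TangentSpace (𝓡 2) x →L[ℝ] ℝ}
    (hB : IsSmoothBilinField B) {b : N → M} {s t : ∀ y, TangentSpace (𝓡 2) (b y)} {y : N}
    (hs : ContMDiffAt (𝓡 2) (𝓡 2).tangent ∞ (fun y => (⟨b y, s y⟩ : TangentBundle (𝓡 2) M)) y)
    (ht : ContMDiffAt (𝓡 2) (𝓡 2).tangent ∞ (fun y => (⟨b y, t y⟩ : TangentBundle (𝓡 2) M)) y) :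
    ContMDiffAt (𝓡 2) 𝓘(ℝ, ℝ) ∞ (fun y => B (b y) (s y) (t y)) y := by
  have hb : ContMDiffAt (𝓡 2) (𝓡 2) ∞ b y := by
    simp only [contMDiffAt_totalSpace] at hs
    exact hs.1
  have : ContMDiffAt (𝓡 2) ((𝓡 2).prod 𝓘(ℝ)) ∞
      (fun m ↦ TotalSpace.mk' ℝ (E := Bundle.Trivial M ℝ) (b m) (B (b m) (s m) (t m))) y := by
    apply ContMDiffAt.clm_bundle_apply₂ (F₁ := Plane) (F₂ := Plane)
    · exact ContMDiffAt.comp y hB.contMDiffAt hb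
    · exact hs
    · exact ht
  simp only [contMDiffAt_totalSpace] at this
  exact this.2

theorem contMDiffAt_mfderiv_apply {f : Plane → M} {x : Plane}
    (hf : ContMDiffAt (𝓡 2) (𝓡 2) ∞ f x) (w : Plane) :
    ContMDiffAt (𝓡 2) (𝓡 2).tangent ∞
      (fun y => (⟨f y, mfderiv (𝓡 2) (𝓡 2) f y w⟩ : TangentBundle (𝓡 2) M)) x := by
  have h1 := hf.mfderiv_const (m := ∞) (by simp)
  have hw : ContMDiffAt (𝓡 2) (𝓡 2).tangent ∞
      (fun y : Plane => (⟨y, w⟩ : TangentBundle (𝓡 2) Plane)) x :=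
    contMDiffAt_vectorSpace_iff_contDiffAt.2 contDiffAt_const
  exact ContMDiffAt.clm_apply_of_inCoordinates h1 hw hf

/-- The inverse function theorem for an injective immersion between surfaces. -/
theorem exists_local_right_inverse {f : M → N} (hf : ContMDiff (𝓡 2) (𝓡 2) ∞ f)
    (hinj : ∀ x, Function.Injective (mfderiv (𝓡 2) (𝓡 2) f x)) (x : M) :
    ∃ g : N → M, g (f x) = x ∧ ContMDiffAt (𝓡 2) (𝓡 2) ∞ g (f x) ∧
      ∀ᶠ y in 𝓝 (f x), f (g y) = y := by
  set φ := extChartAt (𝓡 2) x with hφ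
  set ψ := extChartAt (𝓡 2) (f x) with hψ
  set F : Plane → Plane := ψ ∘ f ∘ φ.symm with hF
  have hFx : F (φ x) = ψ (f x) := by simp [hF, hφ]
  have hFc : ContDiffAt ℝ ∞ F (φ x) := by
    have := (contMDiffAt_iff.1 (hf x)).2
    simpa only [modelWithCornersSelf_coe, range_id, contDiffWithinAt_univ] using this
  have hd : DifferentiableAt ℝ F (φ x) := hFc.differentiableAt (by simp)
  have hm : mfderiv (𝓡 2) (𝓡 2) f x = fderiv ℝ F (φ x) := by
    have h1 := (hf.mdifferentiableAt (x := x) (by simp)).mfderiv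
    have h2 : fderivWithin ℝ (writtenInExtChartAt (𝓡 2) (𝓡 2) x f) (range (𝓡 2))
        (extChartAt (𝓡 2) x x) = fderiv ℝ F (φ x) := by
      simp only [modelWithCornersSelf_coe, range_id, fderivWithin_univ]
      rfl
    exact h1.trans h2
  have hFi : Function.Injective (fderiv ℝ F (φ x)) := by
    have := hinj x
    rw [hm] at this
    exact this
  let L : Plane ≃L[ℝ] Plane :=
    (LinearEquiv.ofInjectiveEndo (fderiv ℝ F (φ x)).toLinearMap hFi).toContinuousLinearEquiv
  have hL : HasFDerivAt F (L : Plane →L[ℝ] Plane) (φ x) := by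
    convert! hd.hasFDerivAt
  set G := hFc.localInverse hL (by simp) with hG
  have hG1 : G (ψ (f x)) = φ x := by
    rw [← hFx]
    exact hFc.localInverse_apply_image hL (by simp)
  have hG2 : ContDiffAt ℝ ∞ G (ψ (f x)) := by
    rw [← hFx]
    exact hFc.to_localInverse hL (by simp)
  have hG3 : ∀ᶠ z in 𝓝 (ψ (f x)), F (G z) = z := by
    rw [← hFx]
    exact (hFc.hasStrictFDerivAt' hL (by simp)).eventually_right_inverse
  have hψc : ContMDiffAt (𝓡 2) (𝓡 2) ∞ ψ (f x) := contMDiffAt_extChartAt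
  have hφc : ContMDiffAt (𝓡 2) (𝓡 2) ∞ φ.symm (φ x) := by
    have := contMDiffOn_extChartAt_symm (I := 𝓡 2) (n := ∞) x
    exact this.contMDiffAt (extChartAt_target_mem_nhds x)
  have hgc : ContMDiffAt (𝓡 2) (𝓡 2) ∞ (φ.symm ∘ G ∘ ψ) (f x) := by
    refine ContMDiffAt.comp (f x) (by rw [Function.comp_apply, hG1]; exact hφc) ?_
    exact ContMDiffAt.comp (f x) hG2.contMDiffAt hψc
  have hgx : (φ.symm ∘ G ∘ ψ) (f x) = x := by simp [hG1, hφ]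
  refine ⟨φ.symm ∘ G ∘ ψ, hgx, hgc, ?_⟩
  have hfg : ContinuousAt (fun y => f ((φ.symm ∘ G ∘ ψ) y)) (f x) :=
    ContinuousAt.comp (g := f) hf.continuous.continuousAt hgc.continuousAt
  -- The inverse was found in charts; equality of chart values gives equality of points only when
  -- both lie in the source of `ψ`.
  have e1 : ∀ᶠ y in 𝓝 (f x), f ((φ.symm ∘ G ∘ ψ) y) ∈ ψ.source := by
    apply hfg
    change ψ.source ∈ 𝓝 (f ((φ.symm ∘ G ∘ ψ) (f x)))
    rw [hgx]
    exact extChartAt_source_mem_nhds (f x)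
  filter_upwards [e1, extChartAt_source_mem_nhds (I := 𝓡 2) (f x),
    hψc.continuousAt.eventually hG3] with y hy1 hy2 hy3
  exact ψ.injOn hy1 hy2 hy3

/-- An injective immersion between surfaces is an open embedding with smooth inverse. -/
theorem exists_smooth_inverse [IsManifold (𝓡 2) ∞ N] {f : M → N}
    (hf : ContMDiff (𝓡 2) (𝓡 2) ∞ f)
    (hinj : ∀ x, Function.Injective (mfderiv (𝓡 2) (𝓡 2) f x)) (hf' : Function.Injective f) :
    IsOpenEmbedding f ∧ (Nonempty M → ∃ g : N → M, (∀ x, g (f x) = x) ∧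
      ∀ x, ContMDiffAt (𝓡 2) (𝓡 2) ∞ g (f x)) := by
  constructor
  · refine IsOpenEmbedding.of_continuous_injective_isOpenMap hf.continuous hf' ?_
    rw [isOpenMap_iff_nhds_le]
    intro x s hs
    obtain ⟨g, h1, h2, h3⟩ := exists_local_right_inverse hf hinj x
    have h4 : ∀ᶠ y in 𝓝 (f x), g y ∈ f ⁻¹' s := by
      apply h2.continuousAt
      rw [h1]
      exact hs
    filter_upwards [h3, h4] with y hy1 hy2
    rw [← hy1]
    exact hy2
  · intro hM
    refine ⟨Function.invFun f, Function.leftInverse_invFun hf', fun x => ?_⟩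
    obtain ⟨g, h1, h2, h3⟩ := exists_local_right_inverse hf hinj x
    refine h2.congr_of_eventuallyEq ?_
    filter_upwards [h3] with y hy
    nth_rewrite 1 [← hy]
    exact Function.leftInverse_invFun hf' _

end Surfaces

/-! ### Lifting right-moving curves through injective conformal maps -/

namespace OrientedSpacetime

variable {M N : OrientedSpacetime.{u}}

/-- Velocities of two curves that agree near `t` live over points that are equal but not
syntactically the same. All tangent spaces have the model plane as underlying space, so the vector
itself can be kept. -/
theorem isRightNull_congr_point {x y : M} (h : x = y) (w : Plane) :
    M.IsRightNull (x := x) w ↔ M.IsRightNull (x := y) w := by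
  subst h; rfl

theorem isRightNull_velocity_congr {γ δ : ℝ → M} {t : ℝ} (h : γ =ᶠ[𝓝 t] δ) :
    M.IsRightNull (M.velocity γ t) ↔ M.IsRightNull (M.velocity δ t) := by
  have h1 : (M.velocity γ t : Plane) = M.velocity δ t :=
    congrArg (fun L : ℝ →L[ℝ] Plane => L 1) h.mfderiv_eq
  exact (isRightNull_congr_point h.eq_of_nhds _).trans (by rw [h1])

/-- A right-moving curve in the image of an injective conformal morphism lifts. -/
theorem IsConformalMorphism.exists_lift {f : M → N} (hf : IsConformalMorphism M N f)
    (hf' : Function.Injective f) {γ : ℝ → N} {I : Set ℝ} (hI : I.Nonempty)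
    (hγ : N.IsRightMoving γ I) (hr : ∀ t ∈ I, γ t ∈ range f) :
    ∃ δ : ℝ → M, M.IsRightMoving δ I ∧ ∀ t ∈ I, f (δ t) = γ t := by
  obtain ⟨t₀, ht₀⟩ := hI
  obtain ⟨x₀, -⟩ := hr t₀ ht₀
  obtain ⟨g, hg1, hg2⟩ := (exists_smooth_inverse hf.smooth hf.injective_mfderiv hf').2 ⟨x₀⟩
  have hfg : ∀ t ∈ I, f (g (γ t)) = γ t := by
    intro t ht
    obtain ⟨x, hx⟩ := hr t ht
    rw [← hx, hg1]
  have hg3 : ∀ t ∈ I, ContMDiffAt (𝓡 2) (𝓡 2) ∞ g (γ t) := by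
    intro t ht
    obtain ⟨x, hx⟩ := hr t ht
    rw [← hx]
    exact hg2 x
  have hs : ContMDiffOn 𝓘(ℝ, ℝ) (𝓡 2) ∞ (g ∘ γ) I := fun t ht =>
    ContMDiffAt.comp_contMDiffWithinAt t (hg3 t ht) (hγ.1 t ht)
  refine ⟨g ∘ γ, ⟨hs, fun t ht => ?_⟩, hfg⟩
  have hd : MDifferentiableAt 𝓘(ℝ, ℝ) (𝓡 2) (g ∘ γ) t :=
    (hs.contMDiffAt (mem_interior_iff_mem_nhds.1 ht)).mdifferentiableAt (by simp)
  have key : N.velocity (f ∘ (g ∘ γ)) t =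
      mfderiv (𝓡 2) (𝓡 2) f ((g ∘ γ) t) (M.velocity (g ∘ γ) t) :=
    mfderiv_comp_apply t (hf.smooth.mdifferentiableAt (by simp)) hd _
  have heq : f ∘ (g ∘ γ) =ᶠ[𝓝 t] γ := by
    filter_upwards [mem_interior_iff_mem_nhds.1 ht] with s hs
    exact hfg s hs
  have hv : N.IsRightNull (N.velocity (f ∘ (g ∘ γ)) t) :=
    (isRightNull_velocity_congr heq).2 (hγ.2 t ht)
  rw [key] at hv
  exact hf.isRightNull_map_iff.1 hv

end OrientedSpacetime

/-! ## Minkowski space -/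

section SingleChart

variable {M : Type*} [TopologicalSpace M] [ChartedSpace Plane M] [IsManifold (𝓡 2) ∞ M]

/-- The trivialization acts on a fibre by the coordinate change between the two preferred charts,
which is the identity when they coincide. -/
theorem trivializationAt_tangentSpace_of_chartAt_eq {x y : M}
    (h : chartAt Plane x = chartAt Plane y) (w : Plane) :
    (trivializationAt Plane (TangentSpace (𝓡 2)) x).continuousLinearMapAt ℝ y w = w ∧
    (trivializationAt Plane (TangentSpace (𝓡 2)) x).symmL ℝ y w = w := by
  have hy : y ∈ (chartAt Plane x).source := by rw [h]; exact mem_chart_source _ _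
  have ha : achart Plane x = achart Plane y := Subtype.ext h
  rw [TangentBundle.continuousLinearMapAt_trivializationAt_eq_core hy,
    TangentBundle.symmL_trivializationAt_eq_core hy, ha]
  have := (tangentBundleCore (𝓡 2) M).coordChange_self (achart Plane y) y (by simp) w
  exact ⟨this, this⟩

/-- On a surface with a single chart, constant vector fields are smooth. -/
theorem contMDiff_const_tangent (h : ∀ x y : M, chartAt Plane x = chartAt Plane y)
    {s : ∀ x : M, TangentSpace (𝓡 2) x} {w : Plane} (hs : ∀ x, s x = w) :
    ContMDiff (𝓡 2) (𝓡 2).tangent ∞ (fun x => (⟨x, s x⟩ : TangentBundle (𝓡 2) M)) := by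
  intro x₀
  refine (Bundle.contMDiffAt_section (E := TangentSpace (𝓡 2)) (s := s) x₀).2 ?_
  refine (contMDiffAt_const (c := w)).congr_of_eventuallyEq (Eventually.of_forall fun x => ?_)
  have := (trivializationAt_tangentSpace_of_chartAt_eq (h x₀ x) (s x)).1
  rw [Trivialization.continuousLinearMapAt_apply_of_mem] at this
  · exact this.trans (hs x)
  · simp [h x₀ x]

/-- On a surface with a single chart, constant bilinear fields are smooth. -/
theorem isSmoothBilinField_const (h : ∀ x y : M, chartAt Plane x = chartAt Plane y)
    {B' : ∀ x : M, TangentSpace (𝓡 2) x →L[ℝ] TangentSpace (𝓡 2) x →L[ℝ] ℝ}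
    {B : Plane →L[ℝ] Plane →L[ℝ] ℝ} (hB : ∀ x, B' x = B) : IsSmoothBilinField B' := by
  intro x₀
  refine (contMDiffAt_hom_bundle _).2 ⟨contMDiffAt_id, ?_⟩
  refine (contMDiffAt_const (c := B)).congr_of_eventuallyEq (Eventually.of_forall fun x => ?_)
  have hx : x ∈ (chartAt Plane x₀).source := by rw [h x₀ x]; exact mem_chart_source _ _
  have h1 := fun w => (trivializationAt_tangentSpace_of_chartAt_eq (h x₀ x) w).2
  rw [← hB x]
  ext v w
  simp only [ContinuousLinearMap.inCoordinates, ContinuousLinearMap.comp_apply]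
  rw [h1]
  rw [Trivialization.continuousLinearMapAt_apply_of_mem]
  swap
  · simp [hx]
  rw [hom_trivializationAt_apply]
  simp [ContinuousLinearMap.inCoordinates]
  rw [h1]
  rfl

end SingleChart

/-- The carrier of two-dimensional Minkowski space. -/
def MinkCarrier : Type u := ULift.{u} Plane

namespace MinkCarrier

noncomputable instance : TopologicalSpace MinkCarrier.{u} :=
  inferInstanceAs (TopologicalSpace (ULift.{u} Plane))

instance : T2Space MinkCarrier.{u} := inferInstanceAs (T2Space (ULift.{u} Plane))

/-- The points of Minkowski space are those of the plane. -/
noncomputable def homeo : MinkCarrier.{u} ≃ₜ Plane := Homeomorph.ulift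

instance : ParacompactSpace MinkCarrier.{u} := homeo.isClosedEmbedding.paracompactSpace

noncomputable instance : ChartedSpace Plane MinkCarrier.{u} :=
  homeo.toOpenPartialHomeomorph.singletonChartedSpace rfl

instance : IsManifold (𝓡 2) ∞ MinkCarrier.{u} :=
  homeo.toOpenPartialHomeomorph.isManifold_singleton rfl

theorem contMDiff_homeo : ContMDiff (𝓡 2) (𝓡 2) ∞ homeo.{u} := by
  intro x
  exact (contMDiffAt_extChartAt (I := 𝓡 2) (x := x) (n := ∞)).congr_of_eventuallyEq
    (Eventually.of_forall fun y => rfl)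

theorem contMDiff_homeo_symm : ContMDiff (𝓡 2) (𝓡 2) ∞ homeo.{u}.symm := by
  have h := contMDiffOn_extChartAt_symm (I := 𝓡 2) (n := ∞) (homeo.{u}.symm 0)
  intro x
  refine (h.contMDiffAt (x := x) ?_).congr_of_eventuallyEq (Eventually.of_forall fun y => rfl)
  simp

theorem mfderiv_homeo (x : MinkCarrier.{u}) (w : Plane) :
    mfderiv (𝓡 2) (𝓡 2) homeo.{u} x w = w := by
  have h1 := (contMDiff_homeo.{u}.mdifferentiableAt (x := x) (by simp)).mfderiv
  have h2 : fderivWithin ℝ (writtenInExtChartAt (𝓡 2) (𝓡 2) x homeo.{u}) (range (𝓡 2))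
      (extChartAt (𝓡 2) x x) = .id ℝ Plane := by
    simp only [modelWithCornersSelf_coe, range_id, fderivWithin_univ]
    have : writtenInExtChartAt (𝓡 2) (𝓡 2) x homeo.{u} = id := by
      ext1 y
      simp only [writtenInExtChartAt, extChartAt_model_space_eq_id]
      rfl
    rw [this, fderiv_id]
  exact congrArg (fun L : Plane →L[ℝ] Plane => L w) (h1.trans h2)

end MinkCarrier

/-- The bilinear form on the plane with null diagonal and given off-diagonal entries. -/
noncomputable def offDiagForm (a b : ℝ) : Plane →L[ℝ] Plane →L[ℝ] ℝ :=
  (a • (EuclideanSpace.proj 0 : Plane →L[ℝ] ℝ)).smulRight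
      (EuclideanSpace.proj 1 : Plane →L[ℝ] ℝ) +
    (b • (EuclideanSpace.proj 1 : Plane →L[ℝ] ℝ)).smulRight
      (EuclideanSpace.proj 0 : Plane →L[ℝ] ℝ)

theorem offDiagForm_apply (a b : ℝ) (v w : Plane) :
    offDiagForm a b v w = a * (v 0 * w 1) + b * (v 1 * w 0) := by
  simp [offDiagForm]
  ring

/-- The Minkowski metric, in null coordinates. -/
noncomputable def minkMetric : Plane →L[ℝ] Plane →L[ℝ] ℝ := offDiagForm (-1 / 2) (-1 / 2)

/-- The area form of Minkowski space, in null coordinates. -/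
noncomputable def minkArea : Plane →L[ℝ] Plane →L[ℝ] ℝ := offDiagForm 1 (-1)

theorem minkMetric_apply (v w : Plane) : minkMetric v w = -((v 0 * w 1 + v 1 * w 0) / 2) := by
  rw [minkMetric, offDiagForm_apply]
  ring

theorem minkArea_apply (v w : Plane) : minkArea v w = v 0 * w 1 - v 1 * w 0 := by
  rw [minkArea, offDiagForm_apply]
  ring

/-- The direction of left-moving null curves in null coordinates. -/
noncomputable abbrev dirLeft : Plane := !₂[1, 0]

/-- The direction of right-moving null curves in null coordinates. -/
noncomputable abbrev dirRight : Plane := !₂[0, 1]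

theorem eq_smul_dirRight_add (w : Plane) : w = w 1 • dirRight + w 0 • dirLeft := by
  ext i
  fin_cases i <;> simp

namespace OrientedSpacetime

/-- Two-dimensional Minkowski space. -/
noncomputable def mink : OrientedSpacetime.{u} where
  carrier := MinkCarrier.{u}
  metric _ := minkMetric
  isLorentzMetric :=
    { smooth := isSmoothBilinField_const (fun _ _ => rfl) (fun _ => rfl)
      symm := fun _ v w => by
        refine (minkMetric_apply v w).trans (Eq.trans ?_ (minkMetric_apply w v).symm)
        ring
      signature := fun _ => ⟨(!₂[1, 1] : Plane), (!₂[1, -1] : Plane),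
        (minkMetric_apply _ _).trans (by norm_num), (minkMetric_apply _ _).trans (by norm_num),
        (minkMetric_apply _ _).trans (by norm_num)⟩ }
  timeOrientation := {T' | IsTimelikeField (fun _ => minkMetric) T' ∧
    ∀ x, minkMetric (!₂[1, 1] : Plane) (T' x) < 0}
  isTimeOrientation := ⟨fun _ => (!₂[1, 1] : Plane),
    ⟨contMDiff_const_tangent (fun _ _ => rfl) (fun _ => rfl),
      fun _ => (minkMetric_apply _ _).trans_lt (by norm_num)⟩, rfl⟩
  orientation := {Ω' | IsVolumeForm Ω' ∧ ∀ x, ∃ c : ℝ, 0 < c ∧ Ω' x = c • minkArea}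
  isOrientation := ⟨fun _ => minkArea,
    { smooth := isSmoothBilinField_const (fun _ _ => rfl) (fun _ => rfl)
      alternating := fun _ v => (minkArea_apply v v).trans (by ring)
      ne_zero := fun _ h => by
        have h1 := minkArea_apply !₂[1, 0] !₂[0, 1]
        rw [show minkArea = 0 from h] at h1
        norm_num at h1 }, rfl⟩

/-- Fixes the convention for all later computations: coordinate `1` grows along right-moving lines
and coordinate `0` along left-moving ones. -/
theorem mink_frame (x : mink.{u}) :
    mink.{u}.IsNullFrame x dirRight dirLeft := by
  have hT : (fun _ => (!₂[1, 1] : Plane)) ∈ mink.{u}.timeOrientation :=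
    ⟨⟨contMDiff_const_tangent (fun _ _ => rfl) (fun _ => rfl),
      fun _ => (minkMetric_apply _ _).trans_lt (by norm_num)⟩,
      fun _ => (minkMetric_apply _ _).trans_lt (by norm_num)⟩
  obtain ⟨Ω, hΩ⟩ := mink.{u}.orientation_nonempty
  obtain ⟨hΩ1, hΩ2⟩ := hΩ
  obtain ⟨c, hc, hΩx⟩ := hΩ2 x
  have hΩ' : ∀ w w' : Plane, Ω x w w' = c * (w 0 * w' 1 - w 1 * w' 0) := by
    intro w w'
    rw [← minkArea_apply]
    exact congrArg (fun L : Plane →L[ℝ] Plane →L[ℝ] ℝ => L w w') hΩx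
  refine IsRightNull.isNullFrame (isRightNull_of_isNull hT ⟨hΩ1, hΩ2⟩ ?_ ?_ ?_)
    (isLeftNull_of_isNull hT ⟨hΩ1, hΩ2⟩ ?_ ?_ ?_)
  · exact (minkMetric_apply _ _).trans (by norm_num)
  · exact (minkMetric_apply _ _).trans_lt (by norm_num)
  · exact (show 0 < c * ((1 : ℝ) * 1 - 1 * 0) by simpa using hc).trans_eq (by
      refine Eq.trans ?_ (hΩ' _ _).symm
      simp)
  · exact (minkMetric_apply _ _).trans (by norm_num)
  · exact (minkMetric_apply _ _).trans_lt (by norm_num)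
  · refine (hΩ' _ _).trans_lt ?_
    simpa using hc

theorem mink_isRightNull_iff {x : mink.{u}} {w : Plane} :
    mink.{u}.IsRightNull (x := x) w ↔ 0 < w 1 ∧ w 0 = 0 := by
  rw [← (mink_frame x).isRightNull_iff]
  exact Eq.to_iff (congrArg _ (eq_smul_dirRight_add w))

theorem mink_isFutureDirected_iff {x : mink.{u}} {w : Plane} :
    mink.{u}.IsFutureDirected (x := x) w ↔ 0 ≤ w 1 ∧ 0 ≤ w 0 ∧ 0 < w 1 + w 0 := by
  rw [← (mink_frame x).isFutureDirected_iff]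
  exact Eq.to_iff (congrArg _ (eq_smul_dirRight_add w))

/-- The null coordinates of a point of Minkowski space. -/
noncomputable def coord : mink.{u} ≃ₜ Plane := MinkCarrier.homeo

theorem hasDerivAt_coord {γ : ℝ → mink.{u}} {t : ℝ} (h : MDifferentiableAt 𝓘(ℝ, ℝ) (𝓡 2) γ t)
    (i : Fin 2) :
    HasDerivAt (fun s => coord (γ s) i) ((show Plane from mink.{u}.velocity γ t) i) t := by
  have h1 : MDifferentiableAt (𝓡 2) (𝓡 2) (coord.{u}) (γ t) :=
    MinkCarrier.contMDiff_homeo.{u}.mdifferentiableAt (by simp)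
  have h2 : (mfderiv 𝓘(ℝ, ℝ) (𝓡 2) (coord ∘ γ) t : ℝ →L[ℝ] Plane) 1 = mink.{u}.velocity γ t :=
    (mfderiv_comp_apply t h1 h _).trans (MinkCarrier.mfderiv_homeo _ _)
  have h3 : DifferentiableAt ℝ (coord ∘ γ) t := (h1.comp t h).differentiableAt
  have h4 : HasDerivAt (coord ∘ γ) (show Plane from mink.{u}.velocity γ t) t := by
    rw [← h2, mfderiv_eq_fderiv]
    exact h3.hasDerivAt
  exact (EuclideanSpace.proj (𝕜 := ℝ) i).hasFDerivAt.comp_hasDerivAt t h4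

end OrientedSpacetime

/-! ### Curves and causal structure of Minkowski space -/

namespace OrientedSpacetime

section MinkCurves

variable {γ : ℝ → mink.{u}} {I : Set ℝ}

theorem continuousOn_coord (hs : ContMDiffOn 𝓘(ℝ, ℝ) (𝓡 2) ∞ γ I) (i : Fin 2) :
    ContinuousOn (fun t => coord (γ t) i) I :=
  ((EuclideanSpace.proj (𝕜 := ℝ) i).continuous.comp coord.continuous).comp_continuousOn
    hs.continuousOn

theorem hasDerivAt_coord_of_mem_interior (hs : ContMDiffOn 𝓘(ℝ, ℝ) (𝓡 2) ∞ γ I) {t : ℝ}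
    (ht : t ∈ interior I) (i : Fin 2) :
    HasDerivAt (fun s => coord (γ s) i) ((show Plane from mink.{u}.velocity γ t) i) t :=
  hasDerivAt_coord
    ((hs.contMDiffAt (mem_interior_iff_mem_nhds.1 ht)).mdifferentiableAt (by simp)) i

/-- Right-moving velocity has zero component `0` and positive component `1`; continuity carries the
conclusions from the interior to the ends of `I`. The factor `ε`, used with values `1` and `-1`,
treats right-moving curves and their reversals together. -/
theorem coord_of_isRightNull (hI : I.OrdConnected) (hs : ContMDiffOn 𝓘(ℝ, ℝ) (𝓡 2) ∞ γ I) {ε : ℝ}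
    (hε : ε ≠ 0) (h : ∀ t ∈ interior I, mink.IsRightNull (ε • mink.velocity γ t)) :
    StrictMonoOn (fun t => ε * coord (γ t) 1) I ∧
      ∀ s ∈ I, ∀ t ∈ I, coord (γ s) 0 = coord (γ t) 0 := by
  have hd := fun t (ht : t ∈ interior I) (i : Fin 2) => hasDerivAt_coord_of_mem_interior hs ht i
  have h' : ∀ t ∈ interior I, 0 < ε * (show Plane from mink.{u}.velocity γ t) 1 ∧
      (show Plane from mink.{u}.velocity γ t) 0 = 0 := by
    intro t ht
    have := mink_isRightNull_iff.1 (h t ht)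
    refine ⟨this.1, ?_⟩
    have h2 : ε * (show Plane from mink.{u}.velocity γ t) 0 = 0 := this.2
    exact (mul_eq_zero.1 h2).resolve_left hε
  have hc := hI.convex (𝕜 := ℝ)
  constructor
  · refine strictMonoOn_of_deriv_pos hc (continuousOn_const.mul (continuousOn_coord hs 1)) ?_
    intro t ht
    rw [((hd t ht 1).const_mul ε).deriv]
    exact (h' t ht).1
  · have h0 : ∀ t ∈ interior I, deriv (fun s => coord (γ s) 0) t = 0 := fun t ht => by
      rw [(hd t ht 0).deriv, (h' t ht).2]
    have hd0 : DifferentiableOn ℝ (fun s => coord (γ s) 0) (interior I) := fun t ht =>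
      (hd t ht 0).differentiableAt.differentiableWithinAt
    have h1 := monotoneOn_of_deriv_nonneg hc (continuousOn_coord hs 0) hd0
      (fun t ht => (h0 t ht).ge)
    have h2 := antitoneOn_of_deriv_nonpos hc (continuousOn_coord hs 0) hd0
      (fun t ht => (h0 t ht).le)
    intro s hs t ht
    rcases le_total s t with hst | hst
    · exact le_antisymm (h1 hs ht hst) (h2 hs ht hst)
    · exact le_antisymm (h2 ht hs hst) (h1 ht hs hst)

theorem coord_of_isFutureDirected {a b : ℝ} (hab : a < b)
    (hs : ContMDiffOn 𝓘(ℝ, ℝ) (𝓡 2) ∞ γ (Icc a b))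
    (h : ∀ t ∈ Ioo a b, mink.IsFutureDirected (mink.velocity γ t)) :
    (∀ i, coord (γ a) i ≤ coord (γ b) i) ∧
      coord (γ a) 1 + coord (γ a) 0 < coord (γ b) 1 + coord (γ b) 0 := by
  have hd : ∀ t ∈ Ioo a b, ∀ i : Fin 2, HasDerivAt (fun s => coord (γ s) i)
      ((show Plane from mink.{u}.velocity γ t) i) t := fun t ht i =>
    hasDerivAt_coord_of_mem_interior hs (by rwa [interior_Icc]) i
  have h' := fun t ht => mink_isFutureDirected_iff.1 (h t ht)
  have ha : a ∈ Icc a b := left_mem_Icc.2 hab.le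
  have hb : b ∈ Icc a b := right_mem_Icc.2 hab.le
  constructor
  · intro i
    refine monotoneOn_of_deriv_nonneg (convex_Icc a b) (continuousOn_coord hs i) ?_ ?_ ha hb hab.le
    · rw [interior_Icc]
      exact fun t ht => (hd t ht i).differentiableAt.differentiableWithinAt
    · rw [interior_Icc]
      intro t ht
      rw [(hd t ht i).deriv]
      have := h' t ht
      fin_cases i
      · exact this.2.1
      · exact this.1
  · refine strictMonoOn_of_deriv_pos (convex_Icc a b)
      ((continuousOn_coord hs 1).add (continuousOn_coord hs 0)) ?_ ha hb hab
    rw [interior_Icc]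
    intro t ht
    rw [((hd t ht 1).add (hd t ht 0)).deriv]
    exact (h' t ht).2.2

/-- The pieces are combined along the subdivision. Strict growth of the sum rules out closed causal
curves, while monotonicity of each coordinate determines the diamonds. -/
theorem coord_of_isFutureCausalCurve (h : mink.IsFutureCausalCurve γ) :
    (∀ i, coord (γ 0) i ≤ coord (γ 1) i) ∧
      coord (γ 0) 1 + coord (γ 0) 0 < coord (γ 1) 1 + coord (γ 1) 0 := by
  obtain ⟨-, n, s, hs, h0, h1, h2⟩ := h
  have hp := fun i : Fin n => coord_of_isFutureDirected (hs i.castSucc_lt_succ) (h2 i).1 (h2 i).2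
  have hm : ∀ i : Fin 2, Monotone fun k => coord (γ (s k)) i := fun i =>
    Fin.monotone_iff_le_succ.2 fun k => (hp k).1 i
  have hm' : StrictMono fun k => coord (γ (s k)) 1 + coord (γ (s k)) 0 :=
    Fin.strictMono_iff_lt_succ.2 fun k => (hp k).2
  -- There is at least one piece, since the subdivision runs from `0` to `1`.
  have hlt : (0 : Fin (n + 1)) < Fin.last n := by
    rw [← hs.lt_iff_lt, h0, h1]
    exact one_pos
  have e1 := fun i => hm i hlt.le
  have e2 := hm' hlt
  simp only [h0, h1] at e1 e2
  exact ⟨e1, e2⟩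

/-- Straight segments in Minkowski space. -/
noncomputable def minkSegment (p q : mink.{u}) (t : ℝ) : mink.{u} :=
  coord.symm (coord p + t • (coord q - coord p))

theorem contMDiff_minkSegment (p q : mink.{u}) :
    ContMDiff 𝓘(ℝ, ℝ) (𝓡 2) ∞ (minkSegment p q) := by
  refine MinkCarrier.contMDiff_homeo_symm.{u}.comp (ContDiff.contMDiff ?_)
  fun_prop

theorem velocity_minkSegment (p q : mink.{u}) (t : ℝ) (i : Fin 2) :
    (show Plane from mink.velocity (minkSegment p q) t) i = coord q i - coord p i := by
  have h1 := hasDerivAt_coord ((contMDiff_minkSegment p q).mdifferentiableAt (by simp) (x := t)) i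
  refine h1.unique ?_
  have : (fun s => coord (minkSegment p q s) i) =
      fun s => coord p i + s * (coord q i - coord p i) := by
    ext s
    simp [minkSegment]
  rw [this]
  exact ((hasDerivAt_mul_const _).const_add _)

theorem minkSegment_zero (p q : mink.{u}) : minkSegment p q 0 = p := by simp [minkSegment]

theorem minkSegment_one (p q : mink.{u}) : minkSegment p q 1 = q := by simp [minkSegment]

end MinkCurves

theorem coord_ext {p q : mink.{u}} (h0 : coord p 0 = coord q 0) (h1 : coord p 1 = coord q 1) :
    p = q := by
  apply coord.injective
  ext i
  fin_cases i
  · exact h0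
  · exact h1

theorem mink_chi_iff {p q : mink.{u}} :
    mink.chi p q ↔ coord p 0 = coord q 0 ∧ coord p 1 ≤ coord q 1 := by
  constructor
  · rintro (rfl | ⟨γ, hγ, rfl, rfl⟩)
    · exact ⟨rfl, le_rfl⟩
    · have := coord_of_isRightNull ordConnected_Icc hγ.1 one_ne_zero
        (fun t ht => by rw [one_smul]; exact hγ.2 t ht)
      have h0 : (0 : ℝ) ∈ Icc (0 : ℝ) 1 := by simp
      have h1 : (1 : ℝ) ∈ Icc (0 : ℝ) 1 := by simp
      refine ⟨this.2 _ h0 _ h1, ?_⟩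
      have := this.1 h0 h1 one_pos
      simpa using this.le
  · rintro ⟨h0, h1⟩
    rcases h1.eq_or_lt with h1 | h1
    · exact Or.inl (coord_ext h0 h1)
    · refine Or.inr ⟨minkSegment p q, ⟨(contMDiff_minkSegment p q).contMDiffOn, fun t _ => ?_⟩,
        minkSegment_zero p q, minkSegment_one p q⟩
      refine mink_isRightNull_iff.2 ⟨?_, ?_⟩
      · exact (sub_pos.2 h1).trans_eq (velocity_minkSegment p q t 1).symm
      · exact (velocity_minkSegment p q t 0).trans (sub_eq_zero.2 h0.symm)

theorem continuous_coord_apply (i : Fin 2) : Continuous fun p : mink.{u} => coord p i :=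
  (EuclideanSpace.proj (𝕜 := ℝ) i).continuous.comp coord.continuous

theorem mink_isChiSimple : mink.{u}.IsChiSimple := by
  simp only [IsChiSimple, mink_chi_iff]
  refine ⟨fun p q h h' => coord_ext h.1 (le_antisymm h.2 h'.2), ?_⟩
  exact (isClosed_eq ((continuous_coord_apply 0).comp continuous_fst)
      ((continuous_coord_apply 0).comp continuous_snd)).inter
    (isClosed_le ((continuous_coord_apply 1).comp continuous_fst)
      ((continuous_coord_apply 1).comp continuous_snd))

theorem mink_causalRel_iff {p q : mink.{u}} :
    mink.causalRel p q ↔ ∀ i, coord p i ≤ coord q i := by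
  constructor
  · rintro (rfl | ⟨γ, hγ, rfl, rfl⟩)
    · exact fun i => le_rfl
    · exact (coord_of_isFutureCausalCurve hγ).1
  · intro h
    by_cases hpq : p = q
    · exact Or.inl hpq
    · have hlt : coord p 1 + coord p 0 < coord q 1 + coord q 0 := by
        by_contra hcon
        exact hpq (coord_ext (by linarith [h 0, h 1]) (by linarith [h 0, h 1]))
      refine Or.inr ⟨minkSegment p q, ⟨(contMDiff_minkSegment p q).continuous.continuousOn, 1,
        ![0, 1], ?_, rfl, rfl, fun i => ⟨(contMDiff_minkSegment p q).contMDiffOn, fun t _ => ?_⟩⟩,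
        minkSegment_zero p q, minkSegment_one p q⟩
      · rw [Fin.strictMono_iff_lt_succ]
        intro i
        fin_cases i
        simp
      · have e0 := velocity_minkSegment p q t 0
        have e1 := velocity_minkSegment p q t 1
        refine mink_isFutureDirected_iff.2 ⟨?_, ?_, ?_⟩
        · exact (sub_nonneg.2 (h 1)).trans_eq e1.symm
        · exact (sub_nonneg.2 (h 0)).trans_eq e0.symm
        · refine lt_of_lt_of_eq ?_ (congrArg₂ (· + ·) e1 e0).symm
          linarith

/-- In null coordinates the diamonds are closed rectangles, by `mink_causalRel_iff`. -/
theorem mink_isGloballyHyperbolic : mink.{u}.IsGloballyHyperbolic := by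
  constructor
  · rintro ⟨γ, hγ, h⟩
    have := (coord_of_isFutureCausalCurve hγ).2
    rw [h] at this
    exact lt_irrefl _ this
  · intro p q
    simp only [mink_causalRel_iff]
    let e : mink.{u} ≃ₜ (Fin 2 → ℝ) :=
      coord.trans (EuclideanSpace.equiv (Fin 2) ℝ).toHomeomorph
    have : {r : mink.{u} | (∀ i, coord p i ≤ coord r i) ∧ ∀ i, coord r i ≤ coord q i} =
        e ⁻¹' Icc (e p) (e q) := by
      ext r
      exact Iff.rfl
    rw [this, e.isCompact_preimage]
    exact isCompact_Icc

/-- A monotone curve on an interval of a coordinate line which has no limits at either end crosses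
the origin. -/
theorem existsUnique_zero_of_strictMonoOn {I : Set ℝ} (hne : I.Nonempty) (hI : I.OrdConnected)
    {h : ℝ → ℝ} (hc : ContinuousOn h I) (hm : StrictMonoOn h I)
    (hbot : ¬ ∃ l, Tendsto (fun t : I => h t) atBot (𝓝 l))
    (htop : ¬ ∃ l, Tendsto (fun t : I => h t) atTop (𝓝 l)) : ∃! t, t ∈ I ∧ h t = 0 := by
  have : Nonempty I := hne.to_subtype
  have hm' : Monotone fun t : I => h t := fun s t hst => hm.monotoneOn s.2 t.2 hst
  have h1 : ∃ t : I, h t < 0 := by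
    -- A monotone function without negative values would converge to its infimum at the lower end.
    by_contra! hcon
    exact hbot ⟨_, tendsto_atBot_ciInf hm' ⟨0, by rintro _ ⟨t, rfl⟩; exact hcon t⟩⟩
  have h2 : ∃ t : I, 0 < h t := by
    by_contra! hcon
    exact htop ⟨_, tendsto_atTop_ciSup hm' ⟨0, by rintro _ ⟨t, rfl⟩; exact hcon t⟩⟩
  obtain ⟨s, hs⟩ := h1
  obtain ⟨t, ht⟩ := h2
  obtain ⟨r, hr, hr'⟩ := hI.isPreconnected.intermediate_value s.2 t.2 hc ⟨hs.le, ht.le⟩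
  exact ⟨r, ⟨hr, hr'⟩, fun r' h' => hm.injOn h'.1 hr (h'.2.trans hr'.symm)⟩

/-- The Cauchy surface is the line where coordinate `1` vanishes. Along a right-chiral curve
coordinate `0` is constant, so a limit of coordinate `1` would be a limit of the curve;
inextendability thus forces the strictly monotone coordinate `1` to change sign. -/
theorem mink_isChiInitial : mink.{u}.IsChiInitial := by
  refine ⟨{x | coord x 1 = 0}, fun p hp => ?_, fun I γ hne hI hγ hinext => ?_⟩
  · exact ⟨_, IsManifold.chart_mem_maximalAtlas p, mem_chart_source _ p, fun x _ => Iff.rfl⟩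
  · obtain ⟨hs, hγ⟩ := hγ
    obtain ⟨ε, hε, h⟩ : ∃ ε : ℝ, ε ≠ 0 ∧
        ∀ t ∈ interior I, mink.IsRightNull (ε • mink.velocity γ t) := by
      rcases hγ with h | h
      · exact ⟨1, one_ne_zero, fun t ht => by rw [one_smul]; exact h t ht⟩
      · exact ⟨-1, by norm_num, fun t ht => by
          rw [neg_smul, one_smul]; exact isRightNull_neg.2 (h t ht)⟩
    obtain ⟨h1, h2⟩ := coord_of_isRightNull hI hs hε h
    have hlim : ∀ l : Filter I, (∃ x, Tendsto (fun t : I => ε * coord (γ t) 1) l (𝓝 x)) →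
        ∃ p : mink.{u}, Tendsto (fun t : I => γ t) l (𝓝 p) := by
      rintro l ⟨x, hx⟩
      obtain ⟨t₀, ht₀⟩ := hne
      have e1 : Tendsto (fun t : I => coord.symm !₂[coord (γ t₀) 0, ε⁻¹ * (ε * coord (γ t) 1)]) l
          (𝓝 (coord.{u}.symm !₂[coord (γ t₀) 0, ε⁻¹ * x])) := by
        refine (coord.symm.continuous.tendsto _).comp
          ((PiLp.continuous_toLp 2 (fun _ : Fin 2 => ℝ)).tendsto _ |>.comp ?_)
        rw [tendsto_pi_nhds]
        intro i
        fin_cases i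
        · exact tendsto_const_nhds
        · exact hx.const_mul _
      refine ⟨_, e1.congr fun t => ?_⟩
      rw [inv_mul_cancel_left₀ hε]
      exact coord_ext (by simp [h2 t t.2 t₀ ht₀]) (by simp)
    obtain ⟨t, ⟨ht1, ht2⟩, ht3⟩ := existsUnique_zero_of_strictMonoOn hne hI
      (continuousOn_const.mul (continuousOn_coord hs 1)) h1
      (fun hl => hinext.1 (hlim _ hl)) (fun hl => hinext.2 (hlim _ hl))
    refine ⟨t, ⟨ht1, (mul_eq_zero.1 ht2).resolve_left hε⟩, fun s hs => ht3 s ⟨hs.1, ?_⟩⟩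
    have : coord (γ s) 1 = 0 := hs.2
    simp [this]

end OrientedSpacetime

/-! ## Null coordinates -/

theorem eq_fst_smul_add_snd_smul (L : ℝ × ℝ →L[ℝ] ℝ) (a b : ℝ) :
    L (a, b) = a * L (1, 0) + b * L (0, 1) := by
  have : ((a, b) : ℝ × ℝ) = a • ((1, 0) : ℝ × ℝ) + b • ((0, 1) : ℝ × ℝ) := by ext <;> simp
  rw [this, map_add, map_smul, map_smul, smul_eq_mul, smul_eq_mul]

/-- Squashing the plane to a small square. -/
noncomputable def squash (ε : ℝ) (z : ℝ × ℝ) : ℝ × ℝ :=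
  (ε * Real.arctan z.1, ε * Real.arctan z.2)

theorem contDiff_squash (ε : ℝ) : ContDiff ℝ ∞ (squash ε) := by
  unfold squash
  exact (contDiff_const.mul (Real.contDiff_arctan.comp contDiff_fst)).prodMk
    (contDiff_const.mul (Real.contDiff_arctan.comp contDiff_snd))

theorem fderiv_squash (ε : ℝ) (z w : ℝ × ℝ) :
    fderiv ℝ (squash ε) z w =
      (ε * (1 / (1 + z.1 ^ 2)) * w.1, ε * (1 / (1 + z.2 ^ 2)) * w.2) := by
  have h1 := ((Real.hasDerivAt_arctan z.1).const_mul ε).hasFDerivAt.comp z hasFDerivAt_fst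
  have h2 := ((Real.hasDerivAt_arctan z.2).const_mul ε).hasFDerivAt.comp z hasFDerivAt_snd
  have h : HasFDerivAt (squash ε) _ z := h1.prodMk h2
  rw [h.fderiv]
  simp [mul_comm]

theorem squash_injective {ε : ℝ} (hε : 0 < ε) : Function.Injective (squash ε) := by
  intro z w h
  simp only [squash, Prod.mk.injEq, mul_eq_mul_left_iff, hε.ne', or_false,
    Real.arctan_injective.eq_iff] at h
  exact Prod.ext h.1 h.2

theorem squash_mem_ball {ε : ℝ} (hε : 0 < ε) (z : ℝ × ℝ) :
    squash ε z ∈ Metric.ball (0 : ℝ × ℝ) (2 * ε) := by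
  have h : ∀ x : ℝ, |ε * Real.arctan x| < 2 * ε := by
    intro x
    rw [abs_mul, abs_of_pos hε, mul_comm]
    apply mul_lt_mul_of_pos_right _ hε
    have h1 := Real.arctan_lt_pi_div_two x
    have h2 := Real.neg_pi_div_two_lt_arctan x
    have h3 := Real.pi_lt_four
    rw [abs_lt]
    constructor <;> linarith
  rw [mem_ball_zero_iff, Prod.norm_def, max_lt_iff]
  exact ⟨h _, h _⟩

/-- Two transverse families of curves in the plane are the coordinate lines of a coordinate
system. -/
theorem exists_transverse_coordinates {l m : ℝ × ℝ → ℝ} {V W : Set (ℝ × ℝ)} (hV : V ∈ 𝓝 0)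
    (hW : W ∈ 𝓝 0) (hl : ContDiffOn ℝ ∞ l V) (hm : ContDiffOn ℝ ∞ m V) (hl0 : l 0 = 0)
    (hm0 : m 0 = 0) :
    ∃ K : ℝ × ℝ → ℝ × ℝ, ContDiff ℝ ∞ K ∧ Function.Injective K ∧ K 0 = 0 ∧ (∀ z, K z ∈ W) ∧
      ∀ z, (∃ α : ℝ, 0 < α ∧ fderiv ℝ K z (1, 0) = α • (1, l (K z))) ∧
        ∃ β : ℝ, 0 < β ∧ fderiv ℝ K z (0, 1) = β • (m (K z), 1) := by
  obtain ⟨U₁, v, hU₁, h0₁, hv, hv0, hvl⟩ := exists_first_integral hV hl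
  have hswap : Tendsto (Prod.swap : ℝ × ℝ → ℝ × ℝ) (𝓝 0) (𝓝 0) :=
    continuous_swap.tendsto' _ _ rfl
  obtain ⟨U₂, u, hU₂, h0₂, hu, hu0, hum⟩ := exists_first_integral (m := m ∘ Prod.swap)
    (hswap hV) (hm.comp (contDiff_snd.prodMk contDiff_fst).contDiffOn fun _ h => h)
  set U := U₁ ∩ Prod.swap ⁻¹' U₂ with hUdef
  have hU : IsOpen U := hU₁.inter (hU₂.preimage continuous_swap)
  have h0U : (0 : ℝ × ℝ) ∈ U := ⟨h0₁, h0₂⟩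
  have hvc : ∀ p ∈ U, ContDiffAt ℝ ∞ v p := fun p hp => hv.contDiffAt (hU₁.mem_nhds hp.1)
  have huc : ∀ p ∈ U, ContDiffAt ℝ ∞ (u ∘ Prod.swap) p := fun p hp =>
    (hu.contDiffAt (hU₂.mem_nhds hp.2)).comp p (contDiff_snd.prodMk contDiff_fst).contDiffAt
  have hvd : ∀ p ∈ U, DifferentiableAt ℝ v p := fun p hp => (hvc p hp).differentiableAt (by simp)
  have hud : ∀ p ∈ U, DifferentiableAt ℝ (u ∘ Prod.swap) p := fun p hp =>
    (huc p hp).differentiableAt (by simp)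
  have hum' : ∀ p ∈ U, fderiv ℝ (u ∘ Prod.swap) p (m p, 1) = 0 := by
    intro p hp
    have h1 : DifferentiableAt ℝ u p.swap :=
      (hu.contDiffAt (hU₂.mem_nhds hp.2)).differentiableAt (by simp)
    have h2 := h1.hasFDerivAt.comp p
      (ContinuousLinearEquiv.prodComm ℝ ℝ ℝ).toContinuousLinearMap.hasFDerivAt
    have h3 : HasFDerivAt (u ∘ Prod.swap) _ p := h2
    rw [h3.fderiv]
    have h4 := hum p.swap hp.2
    simpa using h4
  -- derivatives at the origin
  have hv01 : fderiv ℝ v 0 (0, 1) = 1 := by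
    have h1 : HasDerivAt (fun y : ℝ => v (0, y)) (fderiv ℝ v 0 (0, 1)) 0 :=
      (hvd 0 h0U).hasFDerivAt.comp_hasDerivAt (0 : ℝ)
        ((hasDerivAt_const (0 : ℝ) (0 : ℝ)).prodMk (hasDerivAt_id 0))
    simp only [hv0] at h1
    exact h1.unique (hasDerivAt_id _)
  have hu10 : fderiv ℝ (u ∘ Prod.swap) 0 (1, 0) = 1 := by
    have h1 : HasDerivAt (fun y : ℝ => (u ∘ Prod.swap) (y, 0))
        (fderiv ℝ (u ∘ Prod.swap) 0 (1, 0)) 0 :=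
      HasFDerivAt.comp_hasDerivAt (f := fun y : ℝ => (y, (0 : ℝ))) (0 : ℝ) (hud 0 h0U).hasFDerivAt
        ((hasDerivAt_id' (0 : ℝ)).prodMk (hasDerivAt_const (0 : ℝ) (0 : ℝ)))
    simp only [Function.comp_apply, Prod.swap_prod_mk, hu0] at h1
    exact h1.unique (hasDerivAt_id _)
  have hv10 : fderiv ℝ v 0 (1, 0) = 0 := by
    have := hvl 0 h0₁
    rwa [hl0] at this
  have hu01 : fderiv ℝ (u ∘ Prod.swap) 0 (0, 1) = 0 := by
    have := hum' 0 h0U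
    rwa [hm0] at this
  -- the coordinate change
  set Φ : ℝ × ℝ → ℝ × ℝ := fun p => ((u ∘ Prod.swap) p, v p) with hΦ
  have hΦc : ∀ p ∈ U, ContDiffAt ℝ ∞ Φ p := fun p hp => (huc p hp).prodMk (hvc p hp)
  have hΦd : ∀ p ∈ U, HasFDerivAt Φ ((fderiv ℝ (u ∘ Prod.swap) p).prod (fderiv ℝ v p)) p :=
    fun p hp => (hud p hp).hasFDerivAt.prodMk (hvd p hp).hasFDerivAt
  have hΦ0 : HasFDerivAt Φ ((ContinuousLinearEquiv.refl ℝ (ℝ × ℝ) : ℝ × ℝ →L[ℝ] ℝ × ℝ)) 0 := by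
    convert! hΦd 0 h0U using 1
    refine ContinuousLinearMap.ext fun ⟨a, b⟩ => ?_
    have h1 := eq_fst_smul_add_snd_smul (fderiv ℝ (u ∘ Prod.swap) 0) a b
    have h2 := eq_fst_smul_add_snd_smul (fderiv ℝ v 0) a b
    rw [hu10, hu01] at h1
    rw [hv10, hv01] at h2
    simp only [mul_one, mul_zero, add_zero, zero_add] at h1 h2
    exact (Prod.ext h1 h2).symm
  have hΦ00 : Φ 0 = 0 := by
    refine Prod.ext ?_ ?_
    · exact hu0 0
    · exact hv0 0
  set e := (hΦc 0 h0U).toOpenPartialHomeomorph Φ hΦ0 (by simp) with he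
  have he0 : (0 : ℝ × ℝ) ∈ e.source := (hΦc 0 h0U).mem_toOpenPartialHomeomorph_source hΦ0 (by simp)
  have hecoe : ∀ z, e z = Φ z := fun z => rfl
  set Θ := e.symm with hΘ
  have hΘ0 : Θ 0 = 0 := by
    have := e.left_inv he0
    rwa [hecoe, hΦ00] at this
  have h0t : (0 : ℝ × ℝ) ∈ e.target := by
    have := e.map_source he0
    rwa [hecoe, hΦ00] at this
  have hΘt : ContinuousAt Θ 0 := e.symm.continuousAt h0t
  -- the good points
  have hinv : ∀ᶠ p in 𝓝 (0 : ℝ × ℝ), ∃ L : (ℝ × ℝ) ≃L[ℝ] (ℝ × ℝ),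
      (L : ℝ × ℝ →L[ℝ] ℝ × ℝ) = fderiv ℝ Φ p := by
    have h1 : ContinuousAt (fderiv ℝ Φ) 0 := by
      have := (hΦc 0 h0U).fderiv_right (m := 0) (by simp)
      exact this.continuousAt
    have h2 := ContinuousLinearEquiv.nhds (ContinuousLinearEquiv.refl ℝ (ℝ × ℝ))
    rw [← hΦ0.fderiv] at h2
    exact h1 h2
  have hΘd : ∀ z ∈ e.target, Θ z ∈ U → (∃ L : (ℝ × ℝ) ≃L[ℝ] (ℝ × ℝ),
      (L : ℝ × ℝ →L[ℝ] ℝ × ℝ) = fderiv ℝ Φ (Θ z)) → ContDiffAt ℝ ∞ Θ z := by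
    rintro z hz hzU ⟨L, hL⟩
    refine e.contDiffAt_symm hz (f₀' := L) ?_ (hΦc _ hzU)
    rw [hL]
    exact (hΦd _ hzU).differentiableAt.hasFDerivAt
  have hΘ0d : ContDiffAt ℝ ∞ Θ 0 := by
    refine hΘd 0 h0t (by rwa [hΘ0]) ⟨.refl ℝ _, ?_⟩
    rw [hΘ0, hΦ0.fderiv]
  have hΘf : fderiv ℝ Θ 0 = .id ℝ _ := by
    have h1 : HasFDerivAt Θ (((ContinuousLinearEquiv.refl ℝ (ℝ × ℝ)).symm :
        ℝ × ℝ →L[ℝ] ℝ × ℝ)) 0 := by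
      refine e.hasFDerivAt_symm h0t ?_
      rw [← hΘ, hΘ0]
      exact hΦ0
    rw [h1.fderiv]
    rfl
  have hΘfc : ContinuousAt (fderiv ℝ Θ) 0 := by
    have := hΘ0d.fderiv_right (m := 0) (by simp)
    exact this.continuousAt
  have hα : ∀ᶠ z in 𝓝 (0 : ℝ × ℝ), 0 < (fderiv ℝ Θ z (1, 0)).1 := by
    have h1 : ContinuousAt (fun z => (fderiv ℝ Θ z (1, 0)).1) 0 :=
      (hΘfc.clm_apply continuousAt_const).fst
    refine h1.eventually (lt_mem_nhds ?_)
    simp [hΘf]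
  have hβ : ∀ᶠ z in 𝓝 (0 : ℝ × ℝ), 0 < (fderiv ℝ Θ z (0, 1)).2 := by
    have h1 : ContinuousAt (fun z => (fderiv ℝ Θ z (0, 1)).2) 0 :=
      (hΘfc.clm_apply continuousAt_const).snd
    refine h1.eventually (lt_mem_nhds ?_)
    simp [hΘf]
  have hvs : ∀ᶠ p in 𝓝 (0 : ℝ × ℝ), fderiv ℝ v p (0, 1) ≠ 0 := by
    have h1 : ContinuousAt (fun p => fderiv ℝ v p (0, 1)) 0 :=
      ((hvc 0 h0U).fderiv_right (m := 0) (by simp)).continuousAt.clm_apply continuousAt_const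
    refine h1.eventually (isOpen_ne.mem_nhds ?_)
    simp [hv01]
  have hus : ∀ᶠ p in 𝓝 (0 : ℝ × ℝ), fderiv ℝ (u ∘ Prod.swap) p (1, 0) ≠ 0 := by
    have h1 : ContinuousAt (fun p => fderiv ℝ (u ∘ Prod.swap) p (1, 0)) 0 :=
      ((huc 0 h0U).fderiv_right (m := 0) (by simp)).continuousAt.clm_apply continuousAt_const
    refine h1.eventually (isOpen_ne.mem_nhds ?_)
    simp [hu10]
  have hΘtend : Tendsto Θ (𝓝 0) (𝓝 0) := by
    have := hΘt.tendsto
    rwa [hΘ0] at this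
  have htgt : ∀ᶠ z in 𝓝 (0 : ℝ × ℝ), z ∈ e.target := e.open_target.mem_nhds h0t
  have hgood := ((((((htgt.and
    (hΘtend.eventually (hU.mem_nhds h0U))).and (hΘtend.eventually hW)).and 
    (hΘtend.eventually hinv)).and hα).and hβ).and
    (hΘtend.eventually hvs)).and (hΘtend.eventually hus)
  obtain ⟨δ, hδ, hball⟩ := Metric.eventually_nhds_iff_ball.1 hgood
  -- Everything needed holds on the ball of radius `δ`. Since `|arctan| < 2`, squashing with factor
  -- `δ / 2` sends the whole plane into it, so that composing with `Θ` gives a globally defined map.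
  have hsq : ∀ z, squash (δ / 2) z ∈ Metric.ball (0 : ℝ × ℝ) δ := fun z => by
    have := squash_mem_ball (half_pos hδ) z
    rwa [mul_div_cancel₀ δ two_ne_zero] at this
  have hd : ∀ z w, fderiv ℝ (Θ ∘ squash (δ / 2)) z w =
      fderiv ℝ Θ (squash (δ / 2) z) (fderiv ℝ (squash (δ / 2)) z w) := by
    intro z w
    obtain ⟨⟨⟨⟨⟨⟨⟨h1, h2⟩, h3⟩, h4⟩, h5⟩, h6⟩, h7⟩, h8⟩ := hball _ (hsq z)
    rw [fderiv_comp z ((hΘd _ h1 h2 h4).differentiableAt (by simp))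
      ((contDiff_squash _).differentiable (by simp) z)]
    rfl
  -- This is the derivative of `Φ ∘ Θ = id`, read off in its two components.
  have key : ∀ z ∈ e.target, Θ z ∈ U → DifferentiableAt ℝ Θ z → ∀ w,
      fderiv ℝ (u ∘ Prod.swap) (Θ z) (fderiv ℝ Θ z w) = w.1 ∧
        fderiv ℝ v (Θ z) (fderiv ℝ Θ z w) = w.2 := by
    intro z hz hzU hzd w
    have h1 := (hΦd _ hzU).comp z hzd.hasFDerivAt
    have h2 : Φ ∘ Θ =ᶠ[𝓝 z] id := by
      filter_upwards [e.open_target.mem_nhds hz] with y hy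
      exact e.right_inv hy
    have h3 := (h1.congr_of_eventuallyEq h2.symm).unique (hasFDerivAt_id z)
    have h4 := congrArg (fun L : ℝ × ℝ →L[ℝ] ℝ × ℝ => L w) h3
    exact ⟨congrArg Prod.fst h4, congrArg Prod.snd h4⟩
  refine ⟨Θ ∘ squash (δ / 2), ?_, ?_, ?_, ?_, ?_⟩
  · rw [contDiff_iff_contDiffAt]
    intro z
    obtain ⟨⟨⟨⟨⟨⟨⟨h1, h2⟩, h3⟩, h4⟩, h5⟩, h6⟩, h7⟩, h8⟩ := hball _ (hsq z)
    exact (hΘd _ h1 h2 h4).comp z (contDiff_squash _).contDiffAt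
  · intro z w hzw
    apply squash_injective (half_pos hδ)
    exact e.symm.injOn (hball _ (hsq z)).1.1.1.1.1.1.1 (hball _ (hsq w)).1.1.1.1.1.1.1 hzw
  · have : squash (δ / 2) 0 = 0 := by simp [squash]
    rw [Function.comp_apply, this, hΘ0]
  · intro z
    exact (hball _ (hsq z)).1.1.1.1.1.2
  · intro z
    obtain ⟨⟨⟨⟨⟨⟨⟨h1, h2⟩, h3⟩, h4⟩, h5⟩, h6⟩, h7⟩, h8⟩ := hball _ (hsq z)
    have hk := key _ h1 h2 ((hΘd _ h1 h2 h4).differentiableAt (by simp))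
    have hpos : ∀ x : ℝ, 0 < δ / 2 * (1 / (1 + x ^ 2)) := fun x => by positivity
    constructor
    · refine ⟨δ / 2 * (1 / (1 + z.1 ^ 2)) * (fderiv ℝ Θ (squash (δ / 2) z) (1, 0)).1,
        mul_pos (hpos _) h5, ?_⟩
      have hs : fderiv ℝ (squash (δ / 2)) z (1, 0) =
          (δ / 2 * (1 / (1 + z.1 ^ 2))) • ((1, 0) : ℝ × ℝ) := by
        rw [fderiv_squash]
        simp
      rw [hd, hs, map_smul]
      refine Eq.trans (congrArg _ ?_) (mul_smul _ _ _).symm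
      -- Both `fderiv ℝ Θ _ (1, 0)` and `(1, l)` are annihilated by the derivative of `v`. As this
      -- derivative does not vanish on `(0, 1)`, its kernel is a line, and the two vectors are
      -- proportional.
      have h9 := (hk (1, 0)).2
      rw [← Prod.mk.eta (p := fderiv ℝ Θ (squash (δ / 2) z) (1, 0)), eq_fst_smul_add_snd_smul] at h9
      have h10 := hvl _ h2.1
      rw [eq_fst_smul_add_snd_smul] at h10
      apply Prod.ext
      · exact (mul_one _).symm
      apply mul_right_cancel₀ h7
      simp only [Prod.smul_mk, smul_eq_mul, Function.comp_apply]
      linear_combination h9 - (fderiv ℝ Θ (squash (δ / 2) z) (1, 0)).1 * h10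
    · refine ⟨δ / 2 * (1 / (1 + z.2 ^ 2)) * (fderiv ℝ Θ (squash (δ / 2) z) (0, 1)).2,
        mul_pos (hpos _) h6, ?_⟩
      have hs : fderiv ℝ (squash (δ / 2)) z (0, 1) =
          (δ / 2 * (1 / (1 + z.2 ^ 2))) • ((0, 1) : ℝ × ℝ) := by
        rw [fderiv_squash]
        simp
      rw [hd, hs, map_smul]
      refine Eq.trans (congrArg _ ?_) (mul_smul _ _ _).symm
      have h9 := (hk (0, 1)).1
      rw [← Prod.mk.eta (p := fderiv ℝ Θ (squash (δ / 2) z) (0, 1)), eq_fst_smul_add_snd_smul] at h9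
      have h10 := hum' _ h2
      rw [eq_fst_smul_add_snd_smul] at h10
      apply Prod.ext
      swap
      · exact (mul_one _).symm
      apply mul_right_cancel₀ h8
      simp only [Prod.smul_mk, smul_eq_mul, Function.comp_apply]
      linear_combination h9 - (fderiv ℝ Θ (squash (δ / 2) z) (0, 1)).2 * h10

/-! ## Null boxes -/

/-- The slope of the null direction close to the first of two vectors with Gram matrix
`!![E, F; F, H]`. -/
noncomputable def nullSlope (E F H : ℝ) : ℝ := E / (-F + √(F ^ 2 - E * H))

/-- The slope is a root of `E + 2 * k * F + k ^ 2 * H = 0`. The quadratic formula is used in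
rationalised form, whose denominator is positive when `F < 0`; it therefore stays smooth where `E`
and `H` vanish, which happens at the centre of the construction. -/
theorem metric_add_nullSlope_smul (g : Plane →L[ℝ] Plane →L[ℝ] ℝ)
    (hsymm : ∀ v w, g v w = g w v) (A B : Plane) (hF : g A B < 0)
    (hD : 0 < g A B ^ 2 - g A A * g B B) :
    g (A + nullSlope (g A A) (g A B) (g B B) • B)
      (A + nullSlope (g A A) (g A B) (g B B) • B) = 0 := by
  have hR : 0 < √(g A B ^ 2 - g A A * g B B) := Real.sqrt_pos.2 hD
  have hR2 := Real.sq_sqrt hD.le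
  simp only [map_add, map_smul, _root_.add_apply, _root_.smul_apply, smul_eq_mul, hsymm B A,
    nullSlope]
  generalize √(g A B ^ 2 - g A A * g B B) = R at hR hR2 ⊢
  have hk : -g A B + R ≠ 0 := by linarith
  generalize g A A = E at *
  generalize g A B = F at *
  generalize g B B = H at *
  field_simp
  linear_combination E * hR2

theorem contDiffAt_nullSlope {E F H : Plane → ℝ} {y : Plane} (hE : ContDiffAt ℝ ∞ E y)
    (hF : ContDiffAt ℝ ∞ F y) (hH : ContDiffAt ℝ ∞ H y) (hF0 : F y < 0)
    (hD : 0 < F y ^ 2 - E y * H y) :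
    ContDiffAt ℝ ∞ (fun y => nullSlope (E y) (F y) (H y)) y := by
  have hR : 0 < √(F y ^ 2 - E y * H y) := Real.sqrt_pos.2 hD
  unfold nullSlope
  refine hE.div (hF.neg.add (ContDiffAt.sqrt ((hF.pow 2).sub (hE.mul hH)) hD.ne')) ?_
  linarith

namespace OrientedSpacetime

variable {M : OrientedSpacetime.{u}}

theorem IsLeftNull.smul {x : M} {w : TangentSpace (𝓡 2) x} (hw : M.IsLeftNull w) {c : ℝ}
    (hc : 0 < c) : M.IsLeftNull (c • w) := by
  obtain ⟨e, n, h⟩ := M.exists_isNullFrame x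
  obtain ⟨a, b, rfl⟩ := h.exists_coord w
  rw [h.isLeftNull_iff] at hw
  rw [smul_add, smul_smul, smul_smul, h.isLeftNull_iff, hw.2]
  exact ⟨mul_pos hc hw.1, mul_zero _⟩

/-- Smooth parametrizations of pieces of a spacetime by null coordinates. -/
structure IsNullBox (M : OrientedSpacetime.{u}) (ψ : Plane → M) : Prop where
  smooth : ContMDiff (𝓡 2) (𝓡 2) ∞ ψ
  injective : Function.Injective ψ
  right : ∀ w, M.IsRightNull (mfderiv (𝓡 2) (𝓡 2) ψ w dirRight)
  left : ∀ w, M.IsLeftNull (mfderiv (𝓡 2) (𝓡 2) ψ w dirLeft)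

-- In a chart at `p`, take coordinate vectors `a` and `b` that map to a null frame at `p`. At nearby
-- points the null directions are tilted to `a + l • b` and `b + m • a`, with slopes vanishing at
-- the centre. The sign conditions making them right-moving and left-moving are open and hold at the
-- centre.
set_option maxHeartbeats 800000 in
theorem exists_null_directions {p : M} {U : Set M} (hU : U ∈ 𝓝 p) :
    ∃ (ι : Plane → M) (c a b : Plane) (l m : Plane → ℝ) (G : Set Plane), G ∈ 𝓝 c ∧ ι c = p ∧
      InjOn ι G ∧ (∀ s t : ℝ, s • a + t • b = 0 → s = 0 ∧ t = 0) ∧ l c = 0 ∧ m c = 0 ∧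
      ∀ y ∈ G, ContMDiffAt (𝓡 2) (𝓡 2) ∞ ι y ∧ ι y ∈ U ∧ ContDiffAt ℝ ∞ l y ∧
        ContDiffAt ℝ ∞ m y ∧ M.IsRightNull (mfderiv (𝓡 2) (𝓡 2) ι y (a + l y • b)) ∧
        M.IsLeftNull (mfderiv (𝓡 2) (𝓡 2) ι y (b + m y • a)) := by
  obtain ⟨T, hT, hMT⟩ := M.isTimeOrientation
  obtain ⟨Ω, hΩ, hMΩ⟩ := M.isOrientation
  have hTmem : T ∈ M.timeOrientation := by rw [hMT]; exact ⟨hT, hT.2⟩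
  have hΩmem : Ω ∈ M.orientation := by rw [hMΩ]; exact ⟨hΩ, fun x => ⟨1, one_pos, by simp⟩⟩
  set φ := extChartAt (𝓡 2) p with hφ
  set c := φ p with hc
  set ι : Plane → M := fun y => φ.symm y with hι
  have hιc : ι c = p := by simp [hι, hc, hφ]
  have htgt : φ.target ∈ 𝓝 c := extChartAt_target_mem_nhds p
  have hopen : IsOpen φ.target := isOpen_extChartAt_target p
  have hsm : ∀ y ∈ φ.target, ContMDiffAt (𝓡 2) (𝓡 2) ∞ ι y := fun y hy =>
    (contMDiffOn_extChartAt_symm (I := 𝓡 2) (n := ∞) p).contMDiffAt (hopen.mem_nhds hy)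
  obtain ⟨e, n, hen⟩ := M.exists_isNullFrame (ι c)
  -- The derivative of the inverse chart is onto because composing it with the derivative of the
  -- chart gives the identity.
  have hsurj : ∀ w : TangentSpace (𝓡 2) (ι c), ∃ a : Plane, mfderiv (𝓡 2) (𝓡 2) ι c a = w := by
    intro w
    have hcont : ContMDiffAt (𝓡 2) (𝓡 2) ∞ φ (ι c) := by
      rw [hιc]
      exact contMDiffAt_extChartAt
    have h1 : ∀ᶠ y in 𝓝 (ι c), (ι ∘ φ) y = y := by
      rw [hιc]
      filter_upwards [extChartAt_source_mem_nhds (I := 𝓡 2) p] with y hy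
      exact φ.left_inv hy
    have hφc : φ (ι c) = c := by rw [hιc]
    have h3 : MDifferentiableAt (𝓡 2) (𝓡 2) ι (φ (ι c)) := by
      rw [hφc]
      exact (hsm c (mem_of_mem_nhds htgt)).mdifferentiableAt (by simp)
    have h2 := mfderiv_comp_apply (ι c) h3 (hcont.mdifferentiableAt (by simp)) w
    have h4 : mfderiv (𝓡 2) (𝓡 2) (ι ∘ φ) (ι c) w = w := by
      have : mfderiv (𝓡 2) (𝓡 2) (ι ∘ φ) (ι c) = mfderiv (𝓡 2) (𝓡 2) id (ι c) :=
        Filter.EventuallyEq.mfderiv_eq h1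
      exact (congrArg (fun L : Plane →L[ℝ] Plane => L w) this).trans (by rw [mfderiv_id]; rfl)
    refine ⟨mfderiv (𝓡 2) (𝓡 2) φ (ι c) w, ?_⟩
    have h5 : ∀ y, y = c → ∀ v : Plane, (mfderiv (𝓡 2) (𝓡 2) ι c v : Plane) =
        mfderiv (𝓡 2) (𝓡 2) ι y v := by rintro y rfl v; rfl
    exact (h5 _ hφc _).trans (h2.symm.trans h4)
  obtain ⟨a, ha⟩ := hsurj e
  obtain ⟨b, hb⟩ := hsurj n
  set A : ∀ y : Plane, TangentSpace (𝓡 2) (ι y) := fun y => mfderiv (𝓡 2) (𝓡 2) ι y a with hA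
  set B : ∀ y : Plane, TangentSpace (𝓡 2) (ι y) := fun y => mfderiv (𝓡 2) (𝓡 2) ι y b with hB
  have hAs : ∀ y ∈ φ.target, ContMDiffAt (𝓡 2) (𝓡 2).tangent ∞
      (fun y => (⟨ι y, A y⟩ : TangentBundle (𝓡 2) M)) y := fun y hy =>
    contMDiffAt_mfderiv_apply (hsm y hy) a
  have hBs : ∀ y ∈ φ.target, ContMDiffAt (𝓡 2) (𝓡 2).tangent ∞
      (fun y => (⟨ι y, B y⟩ : TangentBundle (𝓡 2) M)) y := fun y hy =>
    contMDiffAt_mfderiv_apply (hsm y hy) b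
  have hTs : ∀ y ∈ φ.target, ContMDiffAt (𝓡 2) (𝓡 2).tangent ∞
      (fun y => (⟨ι y, T (ι y)⟩ : TangentBundle (𝓡 2) M)) y := fun y hy =>
    ContMDiffAt.comp y (hT.1 (ι y)) (hsm y hy)
  have hg := M.isLorentzMetric.smooth
  set E : Plane → ℝ := fun y => M.metric (ι y) (A y) (A y) with hE
  set F : Plane → ℝ := fun y => M.metric (ι y) (A y) (B y) with hF
  set H : Plane → ℝ := fun y => M.metric (ι y) (B y) (B y) with hH
  have hEs : ∀ y ∈ φ.target, ContDiffAt ℝ ∞ E y := fun y hy =>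
    (hg.contMDiffAt_apply (hAs y hy) (hAs y hy)).contDiffAt
  have hFs : ∀ y ∈ φ.target, ContDiffAt ℝ ∞ F y := fun y hy =>
    (hg.contMDiffAt_apply (hAs y hy) (hBs y hy)).contDiffAt
  have hHs : ∀ y ∈ φ.target, ContDiffAt ℝ ∞ H y := fun y hy =>
    (hg.contMDiffAt_apply (hBs y hy) (hBs y hy)).contDiffAt
  have hTA : ∀ y ∈ φ.target, ContDiffAt ℝ ∞ (fun y => M.metric (ι y) (T (ι y)) (A y)) y :=
    fun y hy => (hg.contMDiffAt_apply (hTs y hy) (hAs y hy)).contDiffAt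
  have hTB : ∀ y ∈ φ.target, ContDiffAt ℝ ∞ (fun y => M.metric (ι y) (T (ι y)) (B y)) y :=
    fun y hy => (hg.contMDiffAt_apply (hTs y hy) (hBs y hy)).contDiffAt
  have hOA : ∀ y ∈ φ.target, ContDiffAt ℝ ∞ (fun y => Ω (ι y) (T (ι y)) (A y)) y :=
    fun y hy => (hΩ.smooth.contMDiffAt_apply (hTs y hy) (hAs y hy)).contDiffAt
  have hOB : ∀ y ∈ φ.target, ContDiffAt ℝ ∞ (fun y => Ω (ι y) (T (ι y)) (B y)) y :=
    fun y hy => (hΩ.smooth.contMDiffAt_apply (hTs y hy) (hBs y hy)).contDiffAt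
  have hcm : c ∈ φ.target := mem_of_mem_nhds htgt
  have hAc : A c = e := ha
  have hBc : B c = n := hb
  have hEc : E c = 0 := by simp only [hE, hAc, hen.ee]
  have hHc : H c = 0 := by simp only [hH, hBc, hen.nn]
  have hFc : F c < 0 := by simp only [hF, hAc, hBc, hen.en]
  obtain ⟨s, t, hs, ht, hTc⟩ := hen.time T hTmem
  set l : Plane → ℝ := fun y => nullSlope (E y) (F y) (H y) with hl
  set m : Plane → ℝ := fun y => nullSlope (H y) (F y) (E y) with hm
  have hlc : l c = 0 := by simp only [hl, hEc, nullSlope, zero_div]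
  have hmc : m c = 0 := by simp only [hm, hHc, nullSlope, zero_div]
  have hls : ∀ y ∈ φ.target, F y < 0 → 0 < F y ^ 2 - E y * H y → ContDiffAt ℝ ∞ l y :=
    fun y hy h1 h2 => contDiffAt_nullSlope (hEs y hy) (hFs y hy) (hHs y hy) h1 h2
  have hms : ∀ y ∈ φ.target, F y < 0 → 0 < F y ^ 2 - E y * H y → ContDiffAt ℝ ∞ m y :=
    fun y hy h1 h2 => contDiffAt_nullSlope (hHs y hy) (hFs y hy) (hEs y hy) h1
      (by rwa [mul_comm])
  have hDc : 0 < F c ^ 2 - E c * H c := by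
    rw [hEc]
    nlinarith
  have hlcont := (hls c hcm hFc hDc).continuousAt
  have hmcont := (hms c hcm hFc hDc).continuousAt
  have g1 : ∀ᶠ y in 𝓝 c, F y < 0 := (hFs c hcm).continuousAt.eventually (gt_mem_nhds hFc)
  have g2 : ∀ᶠ y in 𝓝 c, 0 < F y ^ 2 - E y * H y :=
    (((hFs c hcm).continuousAt.pow 2).sub
      ((hEs c hcm).continuousAt.mul (hHs c hcm).continuousAt)).eventually (lt_mem_nhds hDc)
  have g3 : ∀ᶠ y in 𝓝 c, M.metric (ι y) (T (ι y)) (A y) +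
      l y * M.metric (ι y) (T (ι y)) (B y) < 0 := by
    refine ((hTA c hcm).continuousAt.add
      (hlcont.mul (hTB c hcm).continuousAt)).eventually (gt_mem_nhds ?_)
    simp only [Pi.add_apply, Pi.mul_apply, hlc, zero_mul, add_zero, hAc]
    exact hen.isRightNull_left.metric_neg hTmem
  have hΩn := hen.orient Ω hΩmem
  have g4 : ∀ᶠ y in 𝓝 c, 0 < Ω (ι y) (T (ι y)) (A y) + l y * Ω (ι y) (T (ι y)) (B y) := by
    refine ((hOA c hcm).continuousAt.add
      (hlcont.mul (hOB c hcm).continuousAt)).eventually (lt_mem_nhds ?_)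
    simp only [Pi.add_apply, Pi.mul_apply, hlc, zero_mul, add_zero, hAc, hTc]
    have := hen.orientation_apply hΩmem s t 1 0
    simp only [one_smul, zero_smul, add_zero] at this
    rw [this]
    nlinarith [mul_pos ht hΩn]
  have g5 : ∀ᶠ y in 𝓝 c, M.metric (ι y) (T (ι y)) (B y) +
      m y * M.metric (ι y) (T (ι y)) (A y) < 0 := by
    refine ((hTB c hcm).continuousAt.add
      (hmcont.mul (hTA c hcm).continuousAt)).eventually (gt_mem_nhds ?_)
    simp only [Pi.add_apply, Pi.mul_apply, hmc, zero_mul, add_zero, hBc, hTc]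
    have := hen.metric_apply s t 0 1
    simp only [one_smul, zero_smul, zero_add] at this
    rw [this]
    nlinarith [mul_neg_of_pos_of_neg hs hen.en]
  have g6 : ∀ᶠ y in 𝓝 c, Ω (ι y) (T (ι y)) (B y) + m y * Ω (ι y) (T (ι y)) (A y) < 0 := by
    refine ((hOB c hcm).continuousAt.add
      (hmcont.mul (hOA c hcm).continuousAt)).eventually (gt_mem_nhds ?_)
    simp only [Pi.add_apply, Pi.mul_apply, hmc, zero_mul, add_zero, hBc, hTc]
    have := hen.orientation_apply hΩmem s t 0 1
    simp only [one_smul, zero_smul, zero_add] at this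
    rw [this]
    nlinarith [mul_pos hs hΩn]
  have g7 : ∀ᶠ y in 𝓝 c, ι y ∈ U := by
    have := (hsm c hcm).continuousAt
    apply this
    rwa [hιc]
  obtain ⟨G, hG, hGy⟩ := (((((g1.and g2).and (g3.and g4)).and (g5.and g6)).and g7).exists_mem)
  refine ⟨ι, c, a, b, l, m, φ.target ∩ G, inter_mem htgt hG, hιc, ?_, ?_, hlc, hmc, ?_⟩
  · intro y hy z hz hyz
    exact φ.symm.injOn hy.1 hz.1 hyz
  · intro x y hxy
    have h1 : x • A c + y • B c = 0 := by
      have h2 : mfderiv (𝓡 2) (𝓡 2) ι c (x • a + y • b) = x • A c + y • B c := by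
        exact ((mfderiv (𝓡 2) (𝓡 2) ι c).map_add _ _).trans (congrArg₂ (· + ·)
          ((mfderiv (𝓡 2) (𝓡 2) ι c).map_smul _ _) ((mfderiv (𝓡 2) (𝓡 2) ι c).map_smul _ _))
      rw [← h2, hxy]
      exact (mfderiv (𝓡 2) (𝓡 2) ι c).map_zero
    rw [hAc, hBc] at h1
    exact hen.smul_add_eq_zero.1 h1
  · rintro y ⟨h1, hy⟩
    obtain ⟨⟨⟨⟨h2, h3⟩, h4, h5⟩, h6, h7⟩, h8⟩ := hGy y hy
    refine ⟨hsm y h1, h8, hls y h1 h2 h3, hms y h1 h2 h3, ?_, ?_⟩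
    · have e1 : mfderiv (𝓡 2) (𝓡 2) ι y (a + l y • b) = A y + l y • B y :=
        ((mfderiv (𝓡 2) (𝓡 2) ι y).map_add _ _).trans (congrArg (A y + ·)
          ((mfderiv (𝓡 2) (𝓡 2) ι y).map_smul _ _))
      refine isRightNull_of_isNull hTmem hΩmem ?_ ?_ ?_
      · rw [e1]
        exact metric_add_nullSlope_smul (M.metric (ι y)) (M.isLorentzMetric.symm _) (A y) (B y)
          h2 h3
      · rw [e1, map_add, map_smul]
        exact h4
      · rw [e1, map_add, map_smul]
        exact h5
    · have e1 : mfderiv (𝓡 2) (𝓡 2) ι y (b + m y • a) = B y + m y • A y :=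
        ((mfderiv (𝓡 2) (𝓡 2) ι y).map_add _ _).trans (congrArg (B y + ·)
          ((mfderiv (𝓡 2) (𝓡 2) ι y).map_smul _ _))
      have hsy : F y = M.metric (ι y) (B y) (A y) := M.isLorentzMetric.symm _ _ _
      refine isLeftNull_of_isNull hTmem hΩmem ?_ ?_ ?_
      · rw [e1]
        simp only [hm, hsy]
        refine metric_add_nullSlope_smul (M.metric (ι y)) (M.isLorentzMetric.symm _) (B y) (A y)
          ?_ ?_
        · exact hsy.symm.trans_lt h2
        · rw [hsy, mul_comm] at h3
          exact h3
      · rw [e1, map_add, map_smul]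
        exact h6
      · rw [e1, map_add, map_smul]
        exact h7

/-- Every point has arbitrarily small null boxes around it. -/
theorem exists_isNullBox {p : M} {U : Set M} (hU : U ∈ 𝓝 p) :
    ∃ ψ : Plane → M, M.IsNullBox ψ ∧ ψ 0 = p ∧ range ψ ⊆ U := by
  obtain ⟨ι, c, a, b, l, m, G, hG, hιc, hinj, hab, hl0, hm0, h⟩ := exists_null_directions hU
  -- Affine coordinates along `a` and `b`, centred at `c`: the null directions become graphs over
  -- the two axes and coincide with them at the origin.
  set j : ℝ × ℝ → Plane := fun z => c + (z.1 • a + z.2 • b) with hj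
  have hjs : ContDiff ℝ ∞ j := by fun_prop
  have hj0 : j 0 = c := by simp [hj]
  have hG' : j ⁻¹' G ∈ 𝓝 0 := hjs.continuous.continuousAt (by rwa [hj0])
  obtain ⟨K, hK, hKinj, hK0, hKG, hKd⟩ := exists_transverse_coordinates (l := l ∘ j) (m := m ∘ j)
    hG' hG'
    (fun z hz => ((h _ hz).2.2.1.comp z hjs.contDiffAt).contDiffWithinAt)
    (fun z hz => ((h _ hz).2.2.2.1.comp z hjs.contDiffAt).contDiffWithinAt)
    (by simp [hj0, hl0]) (by simp [hj0, hm0])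
  -- The coordinates are exchanged: the first argument of `K` runs along right-moving lines, whereas
  -- in `Plane` this is the coordinate with index `1`.
  set k : Plane →L[ℝ] ℝ × ℝ := (EuclideanSpace.proj 1 : Plane →L[ℝ] ℝ).prod
    (EuclideanSpace.proj 0 : Plane →L[ℝ] ℝ) with hk
  set J : Plane → Plane := j ∘ K ∘ k with hJ
  have hJs : ContDiff ℝ ∞ J := hjs.comp (hK.comp k.contDiff)
  have hJG : ∀ w, J w ∈ G := fun w => hKG _
  have hJd : ∀ w v, fderiv ℝ J w v = (fderiv ℝ K (k w) (k v)).1 • a +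
      (fderiv ℝ K (k w) (k v)).2 • b := by
    intro w v
    have h1 := (hK.differentiable (by simp) (k w)).hasFDerivAt.comp w k.hasFDerivAt
    have h2 := ((h1.fst.smul_const a).add (h1.snd.smul_const b)).const_add c
    have h3 : HasFDerivAt J _ w := h2
    rw [h3.fderiv]
    rfl
  have hd : ∀ w v, mfderiv (𝓡 2) (𝓡 2) (ι ∘ J) w v =
      mfderiv (𝓡 2) (𝓡 2) ι (J w) (fderiv ℝ J w v) := by
    intro w v
    rw [mfderiv_comp_apply w ((h _ (hJG w)).1.mdifferentiableAt (by simp))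
      (hJs.contMDiff.mdifferentiableAt (by simp)), mfderiv_eq_fderiv]
    rfl
  refine ⟨ι ∘ J, ⟨?_, ?_, ?_, ?_⟩, ?_, ?_⟩
  · intro w
    exact ContMDiffAt.comp w (h _ (hJG w)).1 hJs.contMDiff.contMDiffAt
  · intro w w' hww
    have h1 := hinj (hJG w) (hJG w') hww
    have h2 : K (k w) = K (k w') := by
      have h3 := hab ((K (k w)).1 - (K (k w')).1) ((K (k w)).2 - (K (k w')).2) (by
        have h4 : (K (k w)).1 • a + (K (k w)).2 • b = (K (k w')).1 • a + (K (k w')).2 • b :=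
          add_left_cancel h1
        linear_combination (norm := module) h4)
      exact Prod.ext (sub_eq_zero.1 h3.1) (sub_eq_zero.1 h3.2)
    have h3 := hKinj h2
    ext i
    fin_cases i
    · exact congrArg Prod.snd h3
    · exact congrArg Prod.fst h3
  · intro w
    obtain ⟨α, hα, h1⟩ := (hKd (k w)).1
    have h2 : fderiv ℝ J w dirRight = α • (a + l (J w) • b) := by
      rw [hJd, show k dirRight = (1, 0) by simp [hk], h1]
      simp [hJ, smul_smul]
    have h3 := (h _ (hJG w)).2.2.2.2.1
    have h4 : (mfderiv (𝓡 2) (𝓡 2) ι (J w) (α • (a + l (J w) • b)) : Plane) =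
        α • mfderiv (𝓡 2) (𝓡 2) ι (J w) (a + l (J w) • b) :=
      (mfderiv (𝓡 2) (𝓡 2) ι (J w)).map_smul _ _
    refine (congrArg (fun v : Plane => M.IsRightNull (x := ι (J w)) v) (hd w dirRight)).mpr ?_
    rw [h2]
    exact (congrArg (fun v : Plane => M.IsRightNull (x := ι (J w)) v) h4).mpr (IsRightNull.smul h3 hα)
  · intro w
    obtain ⟨β, hβ, h1⟩ := (hKd (k w)).2
    have h2 : fderiv ℝ J w dirLeft = β • (b + m (J w) • a) := by
      rw [hJd, show k dirLeft = (0, 1) by simp [hk], h1]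
      simp [hJ, smul_smul, add_comm]
    have h3 := (h _ (hJG w)).2.2.2.2.2
    have h4 : (mfderiv (𝓡 2) (𝓡 2) ι (J w) (β • (b + m (J w) • a)) : Plane) =
        β • mfderiv (𝓡 2) (𝓡 2) ι (J w) (b + m (J w) • a) :=
      (mfderiv (𝓡 2) (𝓡 2) ι (J w)).map_smul _ _
    refine (congrArg (fun v : Plane => M.IsLeftNull (x := ι (J w)) v) (hd w dirLeft)).mpr ?_
    rw [h2]
    exact (congrArg (fun v : Plane => M.IsLeftNull (x := ι (J w)) v) h4).mpr (IsLeftNull.smul h3 hβ)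
  · simp [hJ, hK0, hj0, hιc]
  · rintro _ ⟨w, rfl⟩
    exact (h _ (hJG w)).2.1

/-- Null boxes are conformal. -/
theorem IsNullBox.isConformalMorphism {ψ : Plane → M} (h : M.IsNullBox ψ) :
    IsConformalMorphism mink.{u} M (ψ ∘ coord) := by
  have hcs : ContMDiff (𝓡 2) (𝓡 2) ∞ coord.{u} := MinkCarrier.contMDiff_homeo
  have hd : ∀ (x : mink.{u}) (w : Plane), mfderiv (𝓡 2) (𝓡 2) (ψ ∘ coord) x w =
      mfderiv (𝓡 2) (𝓡 2) ψ (coord x) w := fun x w =>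
    (mfderiv_comp_apply x (h.smooth.mdifferentiableAt (by simp))
      (hcs.mdifferentiableAt (by simp)) w).trans
      (congrArg (fun v : Plane => mfderiv (𝓡 2) (𝓡 2) ψ (coord x) v)
        (MinkCarrier.mfderiv_homeo x w))
  set R : ∀ y, TangentSpace (𝓡 2) (ψ y) := fun y => mfderiv (𝓡 2) (𝓡 2) ψ y dirRight with hR
  set L : ∀ y, TangentSpace (𝓡 2) (ψ y) := fun y => mfderiv (𝓡 2) (𝓡 2) ψ y dirLeft with hL
  have hf : ∀ y, M.IsNullFrame (ψ y) (R y) (L y) := fun y => (h.right y).isNullFrame (h.left y)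
  have hd' : ∀ (x : mink.{u}) (w : Plane), mfderiv (𝓡 2) (𝓡 2) (ψ ∘ coord) x w =
      w 1 • R (coord x) + w 0 • L (coord x) := by
    intro x w
    refine (hd x w).trans ?_
    exact (congrArg (fun v : Plane => mfderiv (𝓡 2) (𝓡 2) ψ (coord x) v)
      (eq_smul_dirRight_add w)).trans
      (((mfderiv (𝓡 2) (𝓡 2) ψ (coord x)).map_add _ _).trans (congrArg₂ (· + ·)
          ((mfderiv (𝓡 2) (𝓡 2) ψ (coord x)).map_smul _ _)
          ((mfderiv (𝓡 2) (𝓡 2) ψ (coord x)).map_smul _ _)))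
  -- The conformal factor. The Minkowski product of `dirRight` and `dirLeft` is `-1 / 2`, hence the
  -- factor `-2`.
  set q : Plane → ℝ := fun y => -2 * M.metric (ψ y) (R y) (L y) with hq
  have hqpos : ∀ y, 0 < q y := fun y => by
    have := (hf y).en
    simp only [hq]
    linarith
  have hqs : ContMDiff (𝓡 2) 𝓘(ℝ, ℝ) ∞ q := fun y =>
    contMDiffAt_const.mul (M.isLorentzMetric.smooth.contMDiffAt_apply
      (contMDiffAt_mfderiv_apply (h.smooth y) _) (contMDiffAt_mfderiv_apply (h.smooth y) _))
  refine ⟨h.smooth.comp hcs, ⟨fun x => Real.log (q (coord x)), ?_, ?_⟩, ?_, ?_⟩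
  · have h1 : ContMDiff (𝓡 2) 𝓘(ℝ, ℝ) ∞ (fun y => Real.log (q y)) :=
      (hqs.contDiff.log fun y => (hqpos y).ne').contMDiff
    exact h1.comp hcs
  · intro x w w'
    rw [Real.exp_log (hqpos _)]
    refine (congrArg₂ (fun v v' => M.metric (ψ (coord x)) v v') (hd' x w) (hd' x w')).trans ?_
    refine ((hf (coord x)).metric_apply _ _ _ _).trans ?_
    refine Eq.trans ?_ (congrArg (q (coord x) * ·) (minkMetric_apply w w').symm)
    simp only [hq]
    ring
  · intro x w w' hw
    have e1 := eq_smul_dirRight_add w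
    have e2 := eq_smul_dirRight_add w'
    have h1 : mink.IsPositivelyOriented (x := x)
        (show Plane from (show Plane from w) 1 • dirRight + (show Plane from w) 0 • dirLeft)
        (show Plane from (show Plane from w') 1 • dirRight + (show Plane from w') 0 • dirLeft) := by
      rw [← e1, ← e2]
      exact hw
    have h2 := (mink_frame x).isPositivelyOriented_iff.1 h1
    have h3 := (hf (coord x)).isPositivelyOriented_iff.2 h2
    have h4 : M.IsPositivelyOriented (mfderiv (𝓡 2) (𝓡 2) (ψ ∘ coord) x w)
        (mfderiv (𝓡 2) (𝓡 2) (ψ ∘ coord) x w') := by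
      rw [hd' x w, hd' x w']
      exact h3
    exact h4
  · intro x w hw
    have h1 := mink_isFutureDirected_iff.1 hw
    have h3 := (hf (coord x)).isFutureDirected_iff.2 h1
    rw [hd' x w]
    exact h3

end OrientedSpacetime

/-! ## The right-moving flow -/

/-- Injectivity gives a left inverse on the whole line, and near each value of `H` it agrees with
the local inverse function. Surjectivity is not available, so smoothness is claimed only at values
of `H`. -/
theorem exists_inverse_of_deriv_pos {H : ℝ → ℝ} (hH : ContDiff ℝ ∞ H)
    (hpos : ∀ u, 0 < deriv H u) :
    ∃ K : ℝ → ℝ, (∀ u, K (H u) = u) ∧ ∀ u, ContDiffAt ℝ ∞ K (H u) := by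
  have hm : StrictMono H := strictMono_of_deriv_pos hpos
  refine ⟨Function.invFun H, Function.leftInverse_invFun hm.injective, fun u => ?_⟩
  have hd : HasDerivAt H (deriv H u) u := (hH.differentiable (by simp) u).hasDerivAt
  have hL : HasFDerivAt H ((ContinuousLinearEquiv.unitsEquivAut ℝ (Units.mk0 _ (hpos u).ne') :
      ℝ ≃L[ℝ] ℝ) : ℝ →L[ℝ] ℝ) u := by
    convert! hd.hasFDerivAt using 1
  have h1 := (hH.contDiffAt (x := u)).to_localInverse hL (by simp)
  have h2 := ((hH.contDiffAt (x := u)).hasStrictFDerivAt' hL (by simp)).eventually_right_inverse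
  refine h1.congr_of_eventuallyEq ?_
  filter_upwards [h2] with y hy
  nth_rewrite 1 [← hy]
  exact Function.leftInverse_invFun hm.injective _

namespace OrientedSpacetime

variable (M : OrientedSpacetime.{u})

/-- A vector field representing the time-orientation. -/
noncomputable def timeField : ∀ x : M, TangentSpace (𝓡 2) x := M.timeOrientation_nonempty.some

theorem timeField_mem : M.timeField ∈ M.timeOrientation := M.timeOrientation_nonempty.some_mem

theorem contMDiff_timeField :
    ContMDiff (𝓡 2) (𝓡 2).tangent ∞ (fun x => (⟨x, M.timeField x⟩ : TangentBundle (𝓡 2) M)) := by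
  have h := M.timeField_mem
  obtain ⟨T, -, hT⟩ := M.isTimeOrientation
  rw [hT] at h
  exact h.1.1

/-- The product with a time-orienting field is negative on the whole right-moving ray, so the value
`-1` picks out one vector of it. -/
theorem exists_rightField (x : M) :
    ∃ w : TangentSpace (𝓡 2) x, M.IsRightNull w ∧ M.metric x (M.timeField x) w = -1 := by
  obtain ⟨e, n, h⟩ := M.exists_isNullFrame x
  have he := h.isRightNull_left
  have hneg := he.metric_neg M.timeField_mem
  refine ⟨(-(M.metric x (M.timeField x) e))⁻¹ • e, he.smul (by simpa using hneg), ?_⟩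
  rw [map_smul, smul_eq_mul, inv_neg, neg_mul, inv_mul_cancel₀ hneg.ne]

/-- The right-moving null vector field of unit speed. -/
noncomputable def rightField (x : M) : TangentSpace (𝓡 2) x := (M.exists_rightField x).choose

theorem isRightNull_rightField (x : M) : M.IsRightNull (M.rightField x) :=
  (M.exists_rightField x).choose_spec.1

variable {M}

/-- Expresses the chosen vector through any right-moving vector at hand; this is how the smoothness
of boxes passes to the field. -/
theorem IsRightNull.rightField_eq {x : M} {w : TangentSpace (𝓡 2) x} (hw : M.IsRightNull w) :
    M.rightField x = (-(M.metric x (M.timeField x) w))⁻¹ • w := by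
  obtain ⟨c, hc, h⟩ := hw.exists_smul (M.isRightNull_rightField x)
  have h1 := (M.exists_rightField x).choose_spec.2
  have h2 : M.metric x (M.timeField x) (M.rightField x) = -1 := h1
  rw [h, map_smul, smul_eq_mul] at h2
  have hneg := hw.metric_neg M.timeField_mem
  rw [h]
  congr 1
  exact eq_inv_of_mul_eq_one_left (by linarith)

namespace IsNullBox

variable {ψ : Plane → M}

/-- The rate at which the flow time increases along the right-moving lines of a box. -/
noncomputable def speed (_ : M.IsNullBox ψ) (w : Plane) : ℝ :=
  -(M.metric (ψ w) (M.timeField (ψ w)) (mfderiv (𝓡 2) (𝓡 2) ψ w dirRight))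

theorem speed_pos (h : M.IsNullBox ψ) (w : Plane) : 0 < h.speed w :=
  neg_pos.2 ((h.right w).metric_neg M.timeField_mem)

theorem contDiff_speed (h : M.IsNullBox ψ) : ContDiff ℝ ∞ h.speed := by
  refine ContMDiff.contDiff (fun w => ?_)
  have h1 : ContMDiffAt (𝓡 2) 𝓘(ℝ, ℝ) ∞ (fun w =>
      M.metric (ψ w) (M.timeField (ψ w)) (mfderiv (𝓡 2) (𝓡 2) ψ w dirRight)) w :=
    M.isLorentzMetric.smooth.contMDiffAt_apply
      (ContMDiffAt.comp w (M.contMDiff_timeField (ψ w)) (h.smooth w))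
      (contMDiffAt_mfderiv_apply (h.smooth w) _)
  exact h1.neg

theorem rightField_eq (h : M.IsNullBox ψ) (w : Plane) :
    M.rightField (ψ w) = (h.speed w)⁻¹ • mfderiv (𝓡 2) (𝓡 2) ψ w dirRight :=
  (h.right w).rightField_eq

theorem injective_mfderiv (h : M.IsNullBox ψ) (w : Plane) :
    Function.Injective (mfderiv (𝓡 2) (𝓡 2) ψ w) := by
  have hf := (h.right w).isNullFrame (h.left w)
  intro v v' hv
  have key : ∀ z : Plane, mfderiv (𝓡 2) (𝓡 2) ψ w z = 0 → z = 0 := by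
    intro z hz
    have h1 : mfderiv (𝓡 2) (𝓡 2) ψ w z = z 1 • mfderiv (𝓡 2) (𝓡 2) ψ w dirRight +
        z 0 • mfderiv (𝓡 2) (𝓡 2) ψ w dirLeft :=
      (congrArg (fun v : Plane => mfderiv (𝓡 2) (𝓡 2) ψ w v) (eq_smul_dirRight_add z)).trans
        (((mfderiv (𝓡 2) (𝓡 2) ψ w).map_add _ _).trans (congrArg₂ (· + ·)
          ((mfderiv (𝓡 2) (𝓡 2) ψ w).map_smul _ _) ((mfderiv (𝓡 2) (𝓡 2) ψ w).map_smul _ _)))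
    rw [hz] at h1
    have h2 := hf.smul_add_eq_zero.1 h1.symm
    ext i
    fin_cases i
    · exact h2.2
    · exact h2.1
  have h3 := key ((show Plane from v) - (show Plane from v'))
    (((mfderiv (𝓡 2) (𝓡 2) ψ w).map_sub v v').trans (sub_eq_zero.2 hv))
  exact sub_eq_zero.1 h3

theorem isOpenEmbedding (h : M.IsNullBox ψ) : IsOpenEmbedding ψ :=
  (exists_smooth_inverse h.smooth h.injective_mfderiv h.injective).1

end IsNullBox

-- In a box the field is the push-forward of `(speed)⁻¹ • dirRight`, a smooth field on the plane,
-- and the box has an inverse that is smooth on its image.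
variable (M) in
theorem contMDiff_rightField :
    ContMDiff (𝓡 2) (𝓡 2).tangent ∞
      (fun x => (⟨x, M.rightField x⟩ : TangentBundle (𝓡 2) M)) := by
  intro p
  obtain ⟨ψ, h, rfl, -⟩ := M.exists_isNullBox (p := p) univ_mem
  obtain ⟨k, hk, hks⟩ := (exists_smooth_inverse h.smooth h.injective_mfderiv h.injective).2 ⟨0⟩
  have h1 : ContMDiffAt (𝓡 2) (𝓡 2).tangent ∞ (fun w : Plane =>
      (⟨ψ w, mfderiv (𝓡 2) (𝓡 2) ψ w ((h.speed w)⁻¹ • dirRight)⟩ : TangentBundle (𝓡 2) M)) 0 := by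
    have e1 := (h.smooth 0).mfderiv_const (m := ∞) (by simp)
    have e2 : ContMDiffAt (𝓡 2) (𝓡 2).tangent ∞
        (fun y : Plane => (⟨y, (h.speed y)⁻¹ • dirRight⟩ : TangentBundle (𝓡 2) Plane)) 0 := by
      refine contMDiffAt_vectorSpace_iff_contDiffAt.2 ?_
      exact ((h.contDiff_speed.contDiffAt (x := (0 : Plane))).inv (h.speed_pos 0).ne').smul
        contDiffAt_const
    exact ContMDiffAt.clm_apply_of_inCoordinates e1 e2 (h.smooth 0)
  have h2 : ContMDiffAt (𝓡 2) (𝓡 2).tangent ∞ ((fun w : Plane =>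
      (⟨ψ w, mfderiv (𝓡 2) (𝓡 2) ψ w ((h.speed w)⁻¹ • dirRight)⟩ : TangentBundle (𝓡 2) M)) ∘ k)
      (ψ 0) :=
    ContMDiffAt.comp (ψ 0) (by rw [hk]; exact h1) (hks 0)
  refine h2.congr_of_eventuallyEq ?_
  filter_upwards [h.isOpenEmbedding.isOpen_range.mem_nhds (mem_range_self 0)] with x hx
  obtain ⟨w, rfl⟩ := hx
  rw [Function.comp_apply, hk, h.rightField_eq]
  exact congrArg (fun v : Plane => (⟨ψ w, v⟩ : TangentBundle (𝓡 2) M))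
    ((mfderiv (𝓡 2) (𝓡 2) ψ w).map_smul _ _).symm

variable (M) in
/-- The flow of the right-moving vector field as a relation: `M.Flow p t q` means that following
the vector field from `p` for time `t` leads to `q`. -/
def Flow (p : M) (t : ℝ) (q : M) : Prop :=
  ∃ (γ : ℝ → M) (a b : ℝ), IsMIntegralCurveOn γ M.rightField (Ioo a b) ∧ 0 ∈ Ioo a b ∧
    t ∈ Ioo a b ∧ γ 0 = p ∧ γ t = q

theorem flow_of_isMIntegralCurveOn {γ : ℝ → M} {a b s s' : ℝ}
    (h : IsMIntegralCurveOn γ M.rightField (Ioo a b)) (hs : s ∈ Ioo a b) (hs' : s' ∈ Ioo a b) :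
    M.Flow (γ s) (s' - s) (γ s') := by
  refine ⟨γ ∘ (· + s), a - s, b - s, ?_, ?_, ?_, by simp, by simp⟩
  · have := h.comp_add s
    refine this.mono fun t ht => ?_
    simp only [mem_ofPred_eq, mem_Ioo] at ht ⊢
    constructor <;> linarith [ht.1, ht.2]
  · constructor <;> linarith [hs.1, hs.2]
  · constructor <;> linarith [hs'.1, hs'.2]

theorem Flow.symm {p q : M} {t : ℝ} (h : M.Flow p t q) : M.Flow q (-t) p := by
  obtain ⟨γ, a, b, hγ, h0, ht, rfl, rfl⟩ := h
  simpa using flow_of_isMIntegralCurveOn hγ ht h0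

theorem contMDiff_rightField_one :
    ContMDiff (𝓡 2) (𝓡 2).tangent 1
      (fun x => (⟨x, M.rightField x⟩ : TangentBundle (𝓡 2) M)) :=
  M.contMDiff_rightField.of_le (by norm_cast)

theorem Flow.unique {p q q' : M} {t : ℝ} (h : M.Flow p t q) (h' : M.Flow p t q') : q = q' := by
  obtain ⟨γ, a, b, hγ, h0, ht, rfl, rfl⟩ := h
  obtain ⟨δ, a', b', hδ, h0', ht', h1, rfl⟩ := h'
  have key := isMIntegralCurveOn_Ioo_eqOn_of_contMDiff_boundaryless (t₀ := 0) (a := max a a')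
    (b := min b b') ⟨max_lt h0.1 h0'.1, lt_min h0.2 h0'.2⟩ contMDiff_rightField_one
    (hγ.mono (Ioo_subset_Ioo (le_max_left _ _) (min_le_left _ _)))
    (hδ.mono (Ioo_subset_Ioo (le_max_right _ _) (min_le_right _ _))) h1.symm
  exact key ⟨max_lt ht.1 ht'.1, lt_min ht.2 ht'.2⟩

/-- The second integral curve, delayed by `s`, passes through `q` at the same time as the first. The
two are glued, and the union of their overlapping intervals is again an interval; the times may have
either sign. -/
theorem Flow.trans {p q r : M} {s t : ℝ} (h : M.Flow p s q) (h' : M.Flow q t r) :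
    M.Flow p (s + t) r := by
  obtain ⟨γ, a, b, hγ, h0, hs, rfl, rfl⟩ := h
  obtain ⟨δ, a', b', hδ, h0', ht', h1, rfl⟩ := h'
  have hδ' : IsMIntegralCurveOn (δ ∘ (· + -s)) M.rightField (Ioo (a' + s) (b' + s)) := by
    refine (hδ.comp_add (-s)).mono fun t ht => ?_
    simp only [mem_ofPred_eq, mem_Ioo] at ht ⊢
    constructor <;> linarith [ht.1, ht.2]
  have hs' : s ∈ Ioo (a' + s) (b' + s) := ⟨by linarith [h0'.1], by linarith [h0'.2]⟩
  have hst : s + t ∈ Ioo (a' + s) (b' + s) := ⟨by linarith [ht'.1], by linarith [ht'.2]⟩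
  have hδs : (δ ∘ (· + -s)) s = γ s := by simp [h1]
  have key := isMIntegralCurveOn_piecewise contMDiff_rightField_one hδ' hγ ⟨hs', hs⟩ hδs
  have hu : Ioo (a' + s) (b' + s) ∪ Ioo a b = Ioo (min (a' + s) a) (max (b' + s) b) :=
    Ioo_union_Ioo' (hs.1.trans hs'.2) (hs'.1.trans hs.2)
  rw [hu] at key
  have m0 : (0 : ℝ) ∈ Ioo (min (a' + s) a) (max (b' + s) b) := by rw [← hu]; exact Or.inr h0
  have mst : s + t ∈ Ioo (min (a' + s) a) (max (b' + s) b) := by rw [← hu]; exact Or.inl hst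
  have hfl := flow_of_isMIntegralCurveOn key m0 mst
  have heq := eqOn_piecewise_of_isMIntegralCurveOn_Ioo contMDiff_rightField_one hδ' hγ ⟨hs', hs⟩ hδs
  rw [sub_zero, heq h0, piecewise_eq_of_mem _ _ _ hst] at hfl
  simpa using hfl

variable (M) in
theorem flow_zero (p : M) : M.Flow p 0 p := by
  obtain ⟨γ, h0, hγ⟩ := exists_isMIntegralCurveAt_of_contMDiffAt_boundaryless 0
    (contMDiff_rightField_one (M := M) p)
  obtain ⟨ε, hε, h⟩ := isMIntegralCurveAt_iff'.1 hγ
  rw [Real.ball_eq_Ioo] at h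
  have h1 : (0 : ℝ) ∈ Ioo (0 - ε) (0 + ε) := ⟨by linarith, by linarith⟩
  exact ⟨γ, _, _, h, h1, h1, h0, h0⟩

/-- Following the flow passes through all intermediate times. -/
theorem Flow.exists_mid {p q : M} {t s : ℝ} (h : M.Flow p t q) (hs : s ∈ uIcc 0 t) :
    ∃ r, M.Flow p s r := by
  obtain ⟨γ, a, b, hγ, h0, ht, rfl, rfl⟩ := h
  exact ⟨γ s, γ, a, b, hγ, h0, (ordConnected_Ioo.uIcc_subset h0 ht) hs, rfl, rfl⟩

theorem Flow.of_sub {p q r : M} {s t : ℝ} (h : M.Flow p s q) (h' : M.Flow p t r) :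
    M.Flow q (t - s) r := by
  have := h.symm.trans h'
  rwa [neg_add_eq_sub] at this

end OrientedSpacetime

/-! ## The flow in a box, and the right-chiral relation -/

/-- A transitive relation that holds locally on an interval holds between its endpoints. -/
theorem rel_endpoints_of_locally {R : ℝ → ℝ → Prop} (hrefl : ∀ x, R x x)
    (htrans : ∀ x y z, R x y → R y z → R x z) {a b : ℝ} (hab : a ≤ b)
    (hloc : ∀ s ∈ Icc a b, ∃ J ∈ 𝓝 s, ∀ x ∈ J ∩ Icc a b, ∀ y ∈ J ∩ Icc a b, x ≤ y → R x y) :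
    R a b := by
  choose! J hJ h using hloc
  obtain ⟨t, ht0, htm, ⟨m, htb⟩, htc⟩ := exists_monotone_Icc_subset_open_cover_Icc hab
    (c := fun s : Icc a b => Subtype.val ⁻¹' interior (J s))
    (fun s => isOpen_interior.preimage continuous_subtype_val)
    (fun s _ => mem_iUnion.2 ⟨s, mem_interior_iff_mem_nhds.2 (hJ s s.2)⟩)
  have key : ∀ n, R a (t n) := by
    intro n
    induction n with
    | zero => rw [ht0]; exact hrefl a
    | succ n ih =>
      refine htrans _ _ _ ih ?_
      obtain ⟨s, hs⟩ := htc n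
      have hle : t n ≤ t (n + 1) := htm n.le_succ
      exact h s s.2 _ ⟨interior_subset (hs (left_mem_Icc.2 hle)), (t n).2⟩ _
        ⟨interior_subset (hs (right_mem_Icc.2 hle)), (t (n + 1)).2⟩ hle
  have := key m
  rwa [htb m le_rfl] at this

theorem toLp_eq_smul_add (v u : ℝ) : (!₂[v, u] : Plane) = v • dirLeft + u • dirRight := by
  ext i
  fin_cases i <;> simp

theorem continuous_toLp_pair : Continuous fun z : ℝ × ℝ => (!₂[z.1, z.2] : Plane) := by
  have : (fun z : ℝ × ℝ => (!₂[z.1, z.2] : Plane)) = fun z => z.1 • dirLeft + z.2 • dirRight :=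
    funext fun z => toLp_eq_smul_add _ _
  rw [this]
  fun_prop

theorem contDiff_toLp_pair (v : ℝ) : ContDiff ℝ ∞ fun u : ℝ => (!₂[v, u] : Plane) := by
  have : (fun u : ℝ => (!₂[v, u] : Plane)) = fun u => v • dirLeft + u • dirRight :=
    funext fun u => toLp_eq_smul_add _ _
  rw [this]
  fun_prop

namespace OrientedSpacetime

variable {M : OrientedSpacetime.{u}}

theorem velocity_eq_of_hasMFDerivAt {γ : ℝ → M} {t : ℝ} {w : TangentSpace (𝓡 2) (γ t)}
    (h : HasMFDerivAt 𝓘(ℝ, ℝ) (𝓡 2) γ t ((1 : ℝ →L[ℝ] ℝ).smulRight w)) :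
    M.velocity γ t = w := by
  rw [velocity, h.mfderiv]
  change (1 : ℝ) • (show Plane from w) = w
  exact one_smul ℝ _

namespace IsNullBox

variable {ψ : Plane → M} (h : M.IsNullBox ψ)

/-- The flow time along the right-moving lines of a box. -/
noncomputable def time (v u : ℝ) : ℝ := ∫ s in (0 : ℝ)..u, h.speed !₂[v, s]

theorem time_zero (v : ℝ) : h.time v 0 = 0 := intervalIntegral.integral_same

theorem continuous_time : Continuous fun z : ℝ × ℝ => h.time z.1 z.2 := by
  refine intervalIntegral.continuous_parametric_intervalIntegral_of_continuous
    (f := fun (z : ℝ × ℝ) s => h.speed !₂[z.1, s]) ?_ continuous_snd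
  exact h.contDiff_speed.continuous.comp (continuous_toLp_pair.comp
    ((continuous_fst.comp continuous_fst).prodMk continuous_snd))

theorem hasDerivAt_time (v u : ℝ) : HasDerivAt (h.time v) (h.speed !₂[v, u]) u := by
  have hc : Continuous fun s => h.speed !₂[v, s] :=
    h.contDiff_speed.continuous.comp (contDiff_toLp_pair v).continuous
  exact (hc.integral_hasStrictDerivAt 0 u).hasDerivAt

theorem contDiff_time (v : ℝ) : ContDiff ℝ ∞ (h.time v) := by
  rw [contDiff_infty_iff_deriv]
  refine ⟨fun u => (h.hasDerivAt_time v u).differentiableAt, ?_⟩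
  have : deriv (h.time v) = fun u => h.speed !₂[v, u] :=
    funext fun u => (h.hasDerivAt_time v u).deriv
  rw [this]
  exact h.contDiff_speed.comp (contDiff_toLp_pair v)

theorem strictMono_time (v : ℝ) : StrictMono (h.time v) :=
  strictMono_of_deriv_pos fun u => by
    rw [(h.hasDerivAt_time v u).deriv]
    exact h.speed_pos _

/-- The right-moving lines of a box, parametrized by flow time. -/
theorem exists_integral_curve (v : ℝ) :
    ∃ β : ℝ → M, (∀ u, β (h.time v u) = ψ !₂[v, u]) ∧
      (∀ u, ContMDiffAt 𝓘(ℝ, ℝ) (𝓡 2) ∞ β (h.time v u)) ∧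
      ∀ u u', IsMIntegralCurveOn β M.rightField (Ioo (h.time v u) (h.time v u')) := by
  -- Running the line through the inverse of the flow time divides its velocity by the speed, which
  -- turns it into `rightField`.
  obtain ⟨K, hK, hKs⟩ := exists_inverse_of_deriv_pos (h.contDiff_time v) fun u => by
    rw [(h.hasDerivAt_time v u).deriv]
    exact h.speed_pos _
  set k : ℝ → Plane := fun t => v • dirLeft + K t • dirRight with hk
  have hkt : ∀ u, k (h.time v u) = !₂[v, u] := fun u => by
    simp only [hk, hK]
    exact (toLp_eq_smul_add v u).symm
  have hks : ∀ u, ContDiffAt ℝ ∞ k (h.time v u) := fun u =>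
    contDiffAt_const.add ((hKs u).smul contDiffAt_const)
  have hKd : ∀ u, HasDerivAt K (h.speed !₂[v, u])⁻¹ (h.time v u) := by
    intro u
    have h1 := ((hKs u).differentiableAt (by simp)).hasDerivAt
    have h2 := h1.comp u (h.hasDerivAt_time v u)
    have h3 : K ∘ h.time v = id := funext hK
    rw [h3] at h2
    have h4 := h2.unique (hasDerivAt_id u)
    rwa [eq_inv_of_mul_eq_one_left h4] at h1
  refine ⟨ψ ∘ k, fun u => by rw [Function.comp_apply, hkt], fun u => ?_, fun u₀ u₁ t ht => ?_⟩
  · exact ContMDiffAt.comp _ (h.smooth _) (hks u).contMDiffAt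
  · obtain ⟨u, rfl⟩ : ∃ u, h.time v u = t := by
      have hlt := (h.strictMono_time v).lt_iff_lt.1 (ht.1.trans ht.2)
      obtain ⟨u, -, hu⟩ := intermediate_value_Icc hlt.le
        (h.contDiff_time v).continuous.continuousOn (Ioo_subset_Icc_self ht)
      exact ⟨u, hu⟩
    have h1 : HasDerivAt k ((h.speed !₂[v, u])⁻¹ • dirRight) (h.time v u) :=
      ((hKd u).smul_const dirRight).const_add _
    have h2 := (h.smooth.mdifferentiableAt (x := k (h.time v u)) (by simp)).hasMFDerivAt
    have h3 := HasMFDerivAt.comp _ h2 h1.hasFDerivAt.hasMFDerivAt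
    refine HasMFDerivAt.hasMFDerivWithinAt ?_
    refine h3.congr_mfderiv (ContinuousLinearMap.ext fun x => Eq.symm ?_)
    have h4 := (h.rightField_eq (k (h.time v u)))
    have h5 : h.speed (k (h.time v u)) = h.speed !₂[v, u] := by rw [hkt]
    rw [h5] at h4
    have h6 := (mfderiv (𝓡 2) (𝓡 2) ψ (k (h.time v u))).map_smul (h.speed !₂[v, u])⁻¹ dirRight
    have h7 := (mfderiv (𝓡 2) (𝓡 2) ψ (k (h.time v u))).map_smul x
      ((h.speed !₂[v, u])⁻¹ • dirRight)
    exact (congrArg (fun w : Plane => (show ℝ from x) • w) (h4.trans h6.symm)).trans h7.symm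

theorem flow (v u u' : ℝ) :
    M.Flow (ψ !₂[v, u]) (h.time v u' - h.time v u) (ψ !₂[v, u']) := by
  obtain ⟨β, hβ, -, hβi⟩ := h.exists_integral_curve v
  have hm := h.strictMono_time v
  rw [← hβ, ← hβ]
  refine flow_of_isMIntegralCurveOn (hβi (min u u' - 1) (max u u' + 1)) ⟨hm ?_, hm ?_⟩
    ⟨hm ?_, hm ?_⟩
  · linarith [min_le_left u u']
  · linarith [le_max_left u u']
  · linarith [min_le_right u u']
  · linarith [le_max_right u u']

end IsNullBox

/-- Near any of its points, an integral curve of the right-moving vector field is a right-moving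
line of a box, parametrized by flow time. -/
theorem eventuallyEq_of_isMIntegralCurveAt {γ : ℝ → M} {t : ℝ}
    (hγ : IsMIntegralCurveAt γ M.rightField t) {ψ : Plane → M} (h : M.IsNullBox ψ)
    (h0 : ψ 0 = γ t) :
    ContMDiffAt 𝓘(ℝ, ℝ) (𝓡 2) ∞ γ t ∧
      ∀ᶠ s in 𝓝 t, ∃ u, γ s = ψ !₂[0, u] ∧ h.time 0 u = s - t := by
  obtain ⟨β, hβ, hβs, hβi⟩ := h.exists_integral_curve 0
  have hm := h.strictMono_time 0
  have e1 : (!₂[(0 : ℝ), 0] : Plane) = 0 := by ext i; fin_cases i <;> rfl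
  have hβ0 : β 0 = γ t := by
    have := hβ 0
    rwa [h.time_zero, e1, h0] at this
  have hm1 : h.time 0 (-1) < 0 := (hm (by norm_num)).trans_eq (h.time_zero 0)
  have hp1 : 0 < h.time 0 1 := (h.time_zero 0).symm.trans_lt (hm one_pos)
  have hβ' : IsMIntegralCurveAt (β ∘ (· + -t)) M.rightField t := by
    have h1 : IsMIntegralCurveAt β M.rightField 0 :=
      (hβi (-1) 1).isMIntegralCurveAt (Ioo_mem_nhds hm1 hp1)
    have := h1.comp_add (-t)
    simpa using this
  have heq : γ =ᶠ[𝓝 t] β ∘ (· + -t) :=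
    isMIntegralCurveAt_eventuallyEq_of_contMDiffAt_boundaryless
      (contMDiff_rightField_one (M := M) (γ t)) hγ hβ' (by simp [hβ0])
  constructor
  · refine ContMDiffAt.congr_of_eventuallyEq ?_ heq
    refine ContMDiffAt.comp t ?_ ((contDiff_id.add contDiff_const).contMDiff.contMDiffAt)
    have := hβs 0
    rw [h.time_zero] at this
    simpa using this
  · have h2 : ∀ᶠ s in 𝓝 t, s ∈ Ioo (t + h.time 0 (-1)) (t + h.time 0 1) :=
      Ioo_mem_nhds (by linarith) (by linarith)
    filter_upwards [heq, h2] with s hs hs'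
    obtain ⟨u, -, hu⟩ := intermediate_value_Icc (by norm_num : (-1 : ℝ) ≤ 1)
      (h.contDiff_time 0).continuous.continuousOn (show s - t ∈ Icc _ _ from
        ⟨by linarith [hs'.1], by linarith [hs'.2]⟩)
    refine ⟨u, ?_, hu⟩
    rw [hs, ← hβ, hu, Function.comp_apply, sub_eq_add_neg]

/-- The flow for positive times runs along right-moving curves. -/
theorem Flow.exists_isRightMoving {p q : M} {t : ℝ} (h : M.Flow p t q) (ht : 0 < t) :
    ∃ γ : ℝ → M, M.IsRightMoving γ (Icc 0 1) ∧ γ 0 = p ∧ γ 1 = q := by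
  obtain ⟨γ, a, b, hγ, h0, ht', rfl, rfl⟩ := h
  have hmem : ∀ s ∈ Icc (0 : ℝ) 1, s * t ∈ Ioo a b := fun s hs =>
    ⟨h0.1.trans_le (mul_nonneg hs.1 ht.le),
      (mul_le_of_le_one_left ht.le hs.2).trans_lt ht'.2⟩
  refine ⟨fun s => γ (s * t), ⟨fun s hs => ?_, fun s hs => ?_⟩, by simp, by simp⟩
  · obtain ⟨ψ, hψ, hψ0, -⟩ := M.exists_isNullBox (p := γ (s * t)) univ_mem
    have h1 := (eventuallyEq_of_isMIntegralCurveAt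
      (hγ.isMIntegralCurveAt (Ioo_mem_nhds (hmem s hs).1 (hmem s hs).2)) hψ hψ0).1
    exact (ContMDiffAt.comp s h1
      ((contDiff_id.mul contDiff_const).contMDiff.contMDiffAt)).contMDiffWithinAt
  · have hs' : s ∈ {s | s * t ∈ Ioo a b} := hmem s (interior_subset hs)
    have hop : IsOpen {s | s * t ∈ Ioo a b} := isOpen_Ioo.preimage (continuous_mul_const t)
    have h1 := ((hγ.comp_mul t) s hs').hasMFDerivAt (hop.mem_nhds hs')
    have h2 : M.velocity (fun s => γ (s * t)) s = t • M.rightField (γ (s * t)) :=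
      velocity_eq_of_hasMFDerivAt h1
    have h3 : M.IsRightNull (M.velocity (fun s => γ (s * t)) s) := by
      rw [h2]
      exact (M.isRightNull_rightField _).smul ht
    exact h3

theorem IsRightMoving.mono {γ : ℝ → M} {I J : Set ℝ} (h : M.IsRightMoving γ I) (hJ : J ⊆ I) :
    M.IsRightMoving γ J :=
  ⟨h.1.mono hJ, fun t ht => h.2 t (interior_mono hJ ht)⟩

/-- Pulled back to Minkowski space, the curve keeps coordinate `0` and increases coordinate `1`. It
therefore runs forwards along one line of the box, where the flow is known. -/
theorem IsRightMoving.exists_flow_of_subset_box {γ : ℝ → M} {a b : ℝ} (hab : a ≤ b)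
    (hγ : M.IsRightMoving γ (Icc a b)) {ψ : Plane → M} (h : M.IsNullBox ψ)
    (hr : ∀ t ∈ Icc a b, γ t ∈ range ψ) : ∃ t, 0 ≤ t ∧ M.Flow (γ a) t (γ b) := by
  have ha : a ∈ Icc a b := left_mem_Icc.2 hab
  have hb : b ∈ Icc a b := right_mem_Icc.2 hab
  obtain ⟨δ, hδ, hδγ⟩ := h.isConformalMorphism.exists_lift
    (h.injective.comp coord.injective) ⟨a, ha⟩ hγ
    (fun t ht => by rw [coord.surjective.range_comp]; exact hr t ht)
  obtain ⟨h1, h2⟩ := coord_of_isRightNull ordConnected_Icc hδ.1 one_ne_zero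
    (fun t ht => by rw [one_smul]; exact hδ.2 t ht)
  have e : ∀ t ∈ Icc a b, γ t = ψ !₂[coord (δ a) 0, coord (δ t) 1] := by
    intro t ht
    rw [← hδγ t ht, Function.comp_apply]
    congr 1
    ext i
    fin_cases i
    · simp [h2 t ht a ha]
    · simp
  refine ⟨_, ?_, by
    rw [e a ha, e b hb]
    exact h.flow _ _ _⟩
  rw [sub_nonneg, (h.strictMono_time _).le_iff_le]
  have := h1.monotoneOn ha hb hab
  simpa using this

/-- Short stretches of the curve lie in boxes, and flow times add up along the curve. -/
theorem IsRightMoving.exists_flow {γ : ℝ → M} {a b : ℝ} (hab : a ≤ b)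
    (hγ : M.IsRightMoving γ (Icc a b)) : ∃ t, 0 ≤ t ∧ M.Flow (γ a) t (γ b) := by
  refine rel_endpoints_of_locally (R := fun s s' => ∃ t, 0 ≤ t ∧ M.Flow (γ s) t (γ s'))
    (fun s => ⟨0, le_rfl, M.flow_zero _⟩) ?_ hab ?_
  · rintro x y z ⟨s, hs, h⟩ ⟨t, ht, h'⟩
    exact ⟨s + t, add_nonneg hs ht, h.trans h'⟩
  · intro s hs
    obtain ⟨ψ, hψ, hψ0, -⟩ := M.exists_isNullBox (p := γ s) univ_mem
    have h1 : ∀ᶠ x in 𝓝[Icc a b] s, γ x ∈ range ψ :=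
      (hγ.1.continuousOn s hs).eventually
        (hψ.isOpenEmbedding.isOpen_range.mem_nhds ⟨0, hψ0⟩)
    obtain ⟨ε, hε, h2⟩ := Metric.mem_nhdsWithin_iff.1 h1
    refine ⟨_, Metric.ball_mem_nhds s hε, fun x hx y hy hxy => ?_⟩
    refine (hγ.mono (Icc_subset_Icc hx.2.1 hy.2.2)).exists_flow_of_subset_box hxy hψ
      fun t ht => h2 ⟨?_, hx.2.1.trans ht.1, ht.2.trans hy.2.2⟩
    rw [Real.ball_eq_Ioo] at hx hy ⊢
    exact ordConnected_Ioo.out hx.1 hy.1 ht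

/-- Passing to the flow forgets parametrisations: flow steps are unique, reversible and composable,
which is what the order-theoretic properties of `chi` rest on. -/
theorem chi_iff_flow {p q : M} : M.chi p q ↔ ∃ t, 0 ≤ t ∧ M.Flow p t q := by
  constructor
  · rintro (rfl | ⟨γ, hγ, rfl, rfl⟩)
    · exact ⟨0, le_rfl, M.flow_zero _⟩
    · exact hγ.exists_flow zero_le_one
  · rintro ⟨t, ht, h⟩
    rcases ht.eq_or_lt with rfl | ht
    · exact Or.inl ((M.flow_zero p).unique h)
    · exact Or.inr (h.exists_isRightMoving ht)

theorem IsRightMoving.chi {γ : ℝ → M} {I : Set ℝ} (hI : I.OrdConnected)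
    (hγ : M.IsRightMoving γ I) {s t : ℝ} (hs : s ∈ I) (ht : t ∈ I) (hst : s ≤ t) :
    M.chi (γ s) (γ t) :=
  chi_iff_flow.2 ((hγ.mono (hI.out hs ht)).exists_flow hst)

theorem chi_refl (p : M) : M.chi p p := Or.inl rfl

/-- The argument goes through the flow because two smooth right-moving curves put end to end need
not form a smooth curve. -/
theorem chi_trans {p q r : M} (h : M.chi p q) (h' : M.chi q r) : M.chi p r := by
  rw [chi_iff_flow] at *
  obtain ⟨s, hs, h⟩ := h
  obtain ⟨t, ht, h'⟩ := h'
  exact ⟨s + t, add_nonneg hs ht, h.trans h'⟩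

/-- The points reached from a given one are comparable. -/
theorem chi_or_chi {p q r : M} (h : M.chi p q) (h' : M.chi p r) : M.chi q r ∨ M.chi r q := by
  rw [chi_iff_flow] at *
  obtain ⟨s, hs, h⟩ := h
  obtain ⟨t, ht, h'⟩ := h'
  rw [chi_iff_flow]
  rcases le_total s t with hst | hst
  · exact Or.inl ⟨t - s, sub_nonneg.2 hst, h.of_sub h'⟩
  · exact Or.inr ⟨s - t, sub_nonneg.2 hst, h'.of_sub h⟩

theorem IsNullBox.chi {ψ : Plane → M} (h : M.IsNullBox ψ) (v : ℝ) {u u' : ℝ} (huu : u ≤ u') :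
    M.chi (ψ !₂[v, u]) (ψ !₂[v, u']) :=
  chi_iff_flow.2 ⟨_, sub_nonneg.2 ((h.strictMono_time v).monotone huu), h.flow v u u'⟩

/-- The flow is continuous at a given point and time. -/
def FlowContAt (p : M) (t : ℝ) (q : M) : Prop :=
  ∀ W ∈ 𝓝 q, ∀ᶠ z : M × ℝ in 𝓝 (p, t), ∃ q' ∈ W, M.Flow z.1 z.2 q'

theorem FlowContAt.trans {p q r : M} {s t : ℝ} (h : FlowContAt p s q) (h' : FlowContAt q t r) :
    FlowContAt p (s + t) r := by
  intro W hW
  have h1 := h' W hW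
  rw [nhds_prod_eq, eventually_prod_iff] at h1
  obtain ⟨P, hP, Q, hQ, hPQ⟩ := h1
  have h2 : Tendsto (fun z : M × ℝ => (z.1, z.2 - t)) (𝓝 (p, s + t)) (𝓝 (p, s)) := by
    have : Continuous fun z : M × ℝ => (z.1, z.2 - t) := by fun_prop
    exact this.tendsto' _ _ (by simp)
  filter_upwards [h2.eventually (h _ hP)] with z hz
  obtain ⟨q', hq', hf⟩ := hz
  obtain ⟨r', hr', hf'⟩ := hPQ hq' (hQ.self_of_nhds)
  refine ⟨r', hr', ?_⟩
  simpa using hf.trans hf'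

/-- For nearby starting lines and times, the arrival parameter solves an equation for the flow time.
The intermediate value theorem provides a solution between `u' - r` and `u' + r`. -/
theorem IsNullBox.flowContAt {ψ : Plane → M} (h : M.IsNullBox ψ) (v u u' : ℝ) :
    FlowContAt (ψ !₂[v, u]) (h.time v u' - h.time v u) (ψ !₂[v, u']) := by
  intro W hW
  have h1 : ∀ᶠ z : ℝ × ℝ in 𝓝 (v, u'), ψ !₂[z.1, z.2] ∈ W :=
    (h.smooth.continuous.comp continuous_toLp_pair).continuousAt hW
  obtain ⟨ε, hε, hεW⟩ := Metric.eventually_nhds_iff_ball.1 h1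
  set r := ε / 2 with hr
  have hr0 : 0 < r := half_pos hε
  have hm := h.strictMono_time v
  have c1 : Continuous fun z : (ℝ × ℝ) × ℝ => h.time z.1.1 z.1.2 + z.2 - h.time z.1.1 (u' - r) :=
    ((h.continuous_time.comp continuous_fst).add continuous_snd).sub
      (h.continuous_time.comp ((continuous_fst.comp continuous_fst).prodMk continuous_const))
  have c2 : Continuous fun z : (ℝ × ℝ) × ℝ => h.time z.1.1 (u' + r) - (h.time z.1.1 z.1.2 + z.2) :=
    (h.continuous_time.comp ((continuous_fst.comp continuous_fst).prodMk continuous_const)).sub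
      ((h.continuous_time.comp continuous_fst).add continuous_snd)
  have e1 := (c1.continuousAt (x := ((v, u), h.time v u' - h.time v u))).eventually (lt_mem_nhds
    (a := 0) (by
      have := hm (show u' - r < u' by linarith)
      simp only
      linarith))
  have e2 := (c2.continuousAt (x := ((v, u), h.time v u' - h.time v u))).eventually (lt_mem_nhds
    (a := 0) (by
      have := hm (show u' < u' + r by linarith)
      simp only
      linarith))
  have e3 : ∀ᶠ z : (ℝ × ℝ) × ℝ in 𝓝 ((v, u), h.time v u' - h.time v u), z.1.1 ∈ Metric.ball v ε :=
    (continuous_fst.comp continuous_fst).continuousAt (Metric.ball_mem_nhds v hε)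
  have key : ∀ᶠ z : (ℝ × ℝ) × ℝ in 𝓝 ((v, u), h.time v u' - h.time v u),
      ∃ q' ∈ W, M.Flow (ψ !₂[z.1.1, z.1.2]) z.2 q' := by
    filter_upwards [e1, e2, e3] with z h1 h2 h3
    obtain ⟨w, hw, hwz⟩ := intermediate_value_Icc (show u' - r ≤ u' + r by linarith)
      (h.contDiff_time z.1.1).continuous.continuousOn
      (show h.time z.1.1 z.1.2 + z.2 ∈ Icc _ _ from ⟨by linarith, by linarith⟩)
    refine ⟨ψ !₂[z.1.1, w], hεW (z.1.1, w) ?_, ?_⟩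
    · rw [← ball_prod_same]
      refine ⟨h3, ?_⟩
      rw [Real.ball_eq_Ioo]
      constructor <;> linarith [hw.1, hw.2]
    · have := h.flow z.1.1 z.1.2 w
      rwa [hwz, add_sub_cancel_left] at this
  -- transport along the box
  have hopen : IsOpenMap fun z : ℝ × ℝ => ψ !₂[z.1, z.2] := by
    refine h.isOpenEmbedding.isOpenMap.comp (g := ψ) ?_
    let e : ℝ × ℝ ≃ₜ Plane :=
      { toFun := fun z => !₂[z.1, z.2]
        invFun := fun w => (w 0, w 1)
        left_inv := fun z => rfl
        right_inv := fun w => by ext i; fin_cases i <;> rfl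
        continuous_toFun := continuous_toLp_pair
        continuous_invFun := by fun_prop }
    exact e.isOpenMap
  rw [nhds_prod_eq, eventually_prod_iff] at key ⊢
  obtain ⟨P, hP, Q, hQ, hPQ⟩ := key
  refine ⟨fun x => ∃ z : ℝ × ℝ, P z ∧ ψ !₂[z.1, z.2] = x, ?_, Q, hQ, ?_⟩
  · exact hopen.image_mem_nhds hP
  · rintro _ ⟨z, hz, rfl⟩ t ht
    exact hPQ hz ht

/-- Continuity holds for short stretches inside a box and is composed along the curve. Both
directions are carried through the argument because `t` may be negative. -/
theorem Flow.flowContAt {p q : M} {t : ℝ} (h : M.Flow p t q) : FlowContAt p t q := by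
  obtain ⟨γ, a, b, hγ, h0, ht, rfl, rfl⟩ := h
  have key : ∀ s ∈ Ioo a b, ∀ s' ∈ Ioo a b, s ≤ s' →
      FlowContAt (γ s) (s' - s) (γ s') ∧ FlowContAt (γ s') (s - s') (γ s) := by
    intro s hs s' hs' hss
    refine rel_endpoints_of_locally (R := fun s s' =>
      FlowContAt (γ s) (s' - s) (γ s') ∧ FlowContAt (γ s') (s - s') (γ s)) ?_ ?_ hss ?_
    · intro x
      obtain ⟨ψ, hψ, hψ0, -⟩ := M.exists_isNullBox (p := γ x) univ_mem
      have e1 : (!₂[(0 : ℝ), 0] : Plane) = 0 := by ext i; fin_cases i <;> rfl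
      have := hψ.flowContAt 0 0 0
      rw [sub_self, e1, hψ0] at this
      rw [sub_self]
      exact ⟨this, this⟩
    · rintro x y z ⟨h1, h2⟩ ⟨h3, h4⟩
      have h5 := h1.trans h3
      have h6 := h4.trans h2
      rw [show y - x + (z - y) = z - x by ring] at h5
      rw [show y - z + (x - y) = x - z by ring] at h6
      exact ⟨h5, h6⟩
    · intro r hr
      have hr' : r ∈ Ioo a b := ⟨hs.1.trans_le hr.1, hr.2.trans_lt hs'.2⟩
      obtain ⟨ψ, hψ, hψ0, -⟩ := M.exists_isNullBox (p := γ r) univ_mem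
      have hev := (eventuallyEq_of_isMIntegralCurveAt
        (hγ.isMIntegralCurveAt (Ioo_mem_nhds hr'.1 hr'.2)) hψ hψ0).2
      have hpair : ∀ x ∈ {s | ∃ u, γ s = ψ !₂[0, u] ∧ hψ.time 0 u = s - r},
          ∀ y ∈ {s | ∃ u, γ s = ψ !₂[0, u] ∧ hψ.time 0 u = s - r},
          FlowContAt (γ x) (y - x) (γ y) := by
        rintro x ⟨u, hu, hu'⟩ y ⟨w, hw, hw'⟩
        have := hψ.flowContAt 0 u w
        rw [hu', hw', ← hu, ← hw] at this
        simpa using this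
      exact ⟨_, hev, fun x hx y hy _ => ⟨hpair x hx.1 y hy.1, hpair y hy.1 x hx.1⟩⟩
  rcases le_total 0 t with h | h
  · simpa using (key 0 h0 t ht h).1
  · simpa using (key t ht 0 h0 h).2

end OrientedSpacetime

/-! ## Spacetimes with a Cauchy surface -/

namespace OrientedSpacetime

variable {M : OrientedSpacetime.{u}}

theorem isRightNull_velocity_of_isMIntegralCurveOn {γ : ℝ → M} {a b t : ℝ}
    (hγ : IsMIntegralCurveOn γ M.rightField (Ioo a b)) (ht : t ∈ Ioo a b) :
    M.IsRightNull (M.velocity γ t) := by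
  rw [velocity_eq_of_hasMFDerivAt ((hγ t ht).hasMFDerivAt (Ioo_mem_nhds ht.1 ht.2))]
  exact M.isRightNull_rightField _

theorem contMDiffAt_of_isMIntegralCurveOn {γ : ℝ → M} {a b t : ℝ}
    (hγ : IsMIntegralCurveOn γ M.rightField (Ioo a b)) (ht : t ∈ Ioo a b) :
    ContMDiffAt 𝓘(ℝ, ℝ) (𝓡 2) ∞ γ t := by
  obtain ⟨ψ, hψ, hψ0, -⟩ := M.exists_isNullBox (p := γ t) univ_mem
  exact (eventuallyEq_of_isMIntegralCurveAt
    (hγ.isMIntegralCurveAt (Ioo_mem_nhds ht.1 ht.2)) hψ hψ0).1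

/-- The times for which the flow from a point is defined. -/
def flowDomain (x : M) : Set ℝ := {t | ∃ y, M.Flow x t y}

open Classical in
/-- The maximal right-moving curve through a point. -/
noncomputable def flowCurve (x : M) (t : ℝ) : M :=
  if h : ∃ y, M.Flow x t y then h.choose else x

theorem flow_flowCurve {x : M} {t : ℝ} (ht : t ∈ flowDomain x) : M.Flow x t (flowCurve x t) := by
  have h : ∃ y, M.Flow x t y := ht
  rw [flowCurve, dif_pos h]
  exact h.choose_spec

theorem Flow.flowCurve_eq {x y : M} {t : ℝ} (h : M.Flow x t y) : flowCurve x t = y :=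
  (flow_flowCurve ⟨y, h⟩).unique h

theorem ordConnected_flowDomain (x : M) : (flowDomain x).OrdConnected := by
  refine ⟨fun s hs t ht r hr => ?_⟩
  rcases le_total 0 r with h | h
  · exact (flow_flowCurve ht).exists_mid (mem_uIcc.2 (Or.inl ⟨h, hr.2⟩))
  · exact (flow_flowCurve hs).exists_mid (mem_uIcc.2 (Or.inr ⟨hr.1, h⟩))

theorem isRightChiral_flowCurve (x : M) : M.IsRightChiral (flowCurve x) (flowDomain x) := by
  have key : ∀ t ∈ flowDomain x, ContMDiffAt 𝓘(ℝ, ℝ) (𝓡 2) ∞ (flowCurve x) t ∧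
      M.IsRightNull (M.velocity (flowCurve x) t) := by
    rintro t ⟨y, γ, a, b, hγ, h0, ht, hx, -⟩
    have heq : flowCurve x =ᶠ[𝓝 t] γ := by
      filter_upwards [Ioo_mem_nhds ht.1 ht.2] with s hs
      exact Flow.flowCurve_eq ⟨γ, a, b, hγ, h0, hs, hx, rfl⟩
    exact ⟨(contMDiffAt_of_isMIntegralCurveOn hγ ht).congr_of_eventuallyEq heq,
      (isRightNull_velocity_congr heq).2 (isRightNull_velocity_of_isMIntegralCurveOn hγ ht)⟩
  exact ⟨fun t ht => (key t ht).1.contMDiffWithinAt,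
    Or.inl fun t ht => (key t (interior_subset ht)).2⟩

theorem zero_mem_flowDomain (x : M) : 0 ∈ flowDomain x := ⟨x, M.flow_zero x⟩

/-- Suppose there is a limit at the upper end, and take a box around it. The curve eventually stays
in the part of the box where coordinate `1` is below `1`; but the flow inside the box carries it on
to the line where this coordinate equals `1`, at a later time still in its domain. The lower end is
symmetric. -/
theorem isInextendable_flowCurve (x : M) : M.IsInextendable (flowCurve x) (flowDomain x) := by
  have : Nonempty (flowDomain x) := ⟨⟨0, zero_mem_flowDomain x⟩⟩
  constructor
  · rintro ⟨z, hz⟩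
    obtain ⟨ψ, h, rfl, -⟩ := M.exists_isNullBox (p := z) univ_mem
    have hU : ψ '' {w | -1 < w 1} ∈ 𝓝 (ψ 0) := by
      refine h.isOpenEmbedding.isOpenMap.image_mem_nhds (IsOpen.mem_nhds ?_ ?_)
      · exact isOpen_lt continuous_const (EuclideanSpace.proj (𝕜 := ℝ) 1).continuous
      · simp
    obtain ⟨⟨t, ht⟩, htU⟩ := eventually_atBot.1 (hz hU)
    obtain ⟨w, hw, hwt⟩ := htU ⟨t, ht⟩ le_rfl
    have hw2 : (!₂[w 0, w 1] : Plane) = w := by ext i; fin_cases i <;> rfl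
    have hf := h.flow (w 0) (w 1) (-1)
    rw [hw2, hwt] at hf
    have hf2 := (flow_flowCurve ht).trans hf
    have hle : t + (h.time (w 0) (-1) - h.time (w 0) (w 1)) ≤ t := by
      have := h.strictMono_time (w 0) hw
      linarith
    obtain ⟨w', hw', hwt'⟩ := htU ⟨_, ⟨_, hf2⟩⟩ hle
    simp only [hf2.flowCurve_eq] at hwt'
    have := h.injective hwt'
    rw [this] at hw'
    exact lt_irrefl (-1 : ℝ) hw'
  · rintro ⟨z, hz⟩
    obtain ⟨ψ, h, rfl, -⟩ := M.exists_isNullBox (p := z) univ_mem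
    have hU : ψ '' {w | w 1 < 1} ∈ 𝓝 (ψ 0) := by
      refine h.isOpenEmbedding.isOpenMap.image_mem_nhds (IsOpen.mem_nhds ?_ ?_)
      · exact isOpen_lt (EuclideanSpace.proj (𝕜 := ℝ) 1).continuous continuous_const
      · simp
    obtain ⟨⟨t, ht⟩, htU⟩ := eventually_atTop.1 (hz hU)
    obtain ⟨w, hw, hwt⟩ := htU ⟨t, ht⟩ le_rfl
    have hw2 : (!₂[w 0, w 1] : Plane) = w := by ext i; fin_cases i <;> rfl
    have hf := h.flow (w 0) (w 1) 1
    rw [hw2, hwt] at hf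
    have hf2 := (flow_flowCurve ht).trans hf
    have hle : t ≤ t + (h.time (w 0) 1 - h.time (w 0) (w 1)) := by
      have := h.strictMono_time (w 0) hw
      linarith
    obtain ⟨w', hw', hwt'⟩ := htU ⟨_, ⟨_, hf2⟩⟩ hle
    simp only [hf2.flowCurve_eq] at hwt'
    have := h.injective hwt'
    rw [this] at hw'
    exact lt_irrefl (1 : ℝ) hw'

/-- Every right-moving line meets a Cauchy surface at exactly one time. -/
theorem IsChiCauchySurface.existsUnique_time {S : Set M} (hS : M.IsChiCauchySurface S) (x : M) :
    ∃! t, ∃ y ∈ S, M.Flow x t y := by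
  obtain ⟨t, ⟨ht, htS⟩, hu⟩ := hS.2 (flowDomain x) (flowCurve x) ⟨0, zero_mem_flowDomain x⟩
    (ordConnected_flowDomain x) (isRightChiral_flowCurve x) (isInextendable_flowCurve x)
  refine ⟨t, ⟨_, htS, flow_flowCurve ht⟩, ?_⟩
  rintro t' ⟨y, hy, hf⟩
  exact hu t' ⟨⟨y, hf⟩, by rwa [hf.flowCurve_eq]⟩

theorem chi_antisymm_of_no_loop (h : ∀ (x : M) (t : ℝ), 0 < t → ¬ M.Flow x t x) {p q : M}
    (hpq : M.chi p q) (hqp : M.chi q p) : p = q := by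
  rw [chi_iff_flow] at hpq hqp
  obtain ⟨s, hs, hs'⟩ := hpq
  obtain ⟨t, ht, ht'⟩ := hqp
  rcases hs.eq_or_lt with rfl | hs0
  · exact (M.flow_zero p).unique hs'
  · exact absurd (hs'.trans ht') (h p (s + t) (by linarith))

/-- Near any of its points, a Cauchy surface meets all nearby right-moving lines nearby. -/
theorem IsChiCauchySurface.eventually_exists_mem {S : Set M} (hS : M.IsChiCauchySurface S)
    {ψ : Plane → M} (h : M.IsNullBox ψ) (h0 : ψ 0 ∈ S) {ε : ℝ} (hε : 0 < ε) :
    ∀ᶠ v in 𝓝 (0 : ℝ), ∃ u, |u| < ε ∧ ψ !₂[v, u] ∈ S := by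
  obtain ⟨φ, -, hφ0, hφS⟩ := hS.1 _ h0
  obtain ⟨k, hk, hks⟩ := (exists_smooth_inverse h.smooth h.injective_mfderiv h.injective).2 ⟨0⟩
  set c := (φ (ψ 0)) 0 with hc
  -- In the slice chart the surface is an axis; `α` runs along it through the centre of the box.
  set l : ℝ → Plane := fun r => !₂[c + r, 0] with hl
  have hlc : Continuous l := continuous_toLp_pair.comp (by fun_prop : Continuous fun r : ℝ =>
    (c + r, (0 : ℝ)))
  have hl0 : l 0 = φ (ψ 0) := by
    ext i
    fin_cases i
    · simp [hl, hc]
    · exact ((hφS _ hφ0).1 h0).symm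
  set α : ℝ → M := fun r => φ.symm (l r) with hα
  have hα0 : α 0 = ψ 0 := by rw [hα]; simp only [hl0]; exact φ.left_inv hφ0
  have hαc : ∀ r, l r ∈ φ.target → ContinuousAt α r := fun r hr =>
    (φ.continuousAt_symm hr).comp hlc.continuousAt
  have hαS : ∀ r, l r ∈ φ.target → α r ∈ S := by
    intro r hr
    rw [hφS _ (φ.map_target hr), φ.right_inv hr]
    rfl
  have htgt0 : l 0 ∈ φ.target := by rw [hl0]; exact φ.map_source hφ0
  have e1 : ∀ᶠ r in 𝓝 (0 : ℝ), l r ∈ φ.target :=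
    hlc.continuousAt (φ.open_target.mem_nhds htgt0)
  have e2 : ∀ᶠ r in 𝓝 (0 : ℝ), α r ∈ range ψ := by
    refine (hαc 0 htgt0).eventually ?_
    rw [hα0]
    exact h.isOpenEmbedding.isOpen_range.mem_nhds (mem_range_self 0)
  have hkc : ∀ w, ContinuousAt k (ψ w) := fun w => (hks w).continuousAt
  have e3 : ∀ᶠ r in 𝓝 (0 : ℝ), |k (α r) 1| < ε := by
    have h1 : ContinuousAt (fun r => |k (α r) 1|) 0 := by
      refine ((EuclideanSpace.proj (𝕜 := ℝ) (1 : Fin 2)).continuous.continuousAt.comp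
        (ContinuousAt.comp (g := k) ?_ (hαc 0 htgt0))).abs
      rw [hα0]
      exact hkc 0
    refine h1.eventually (gt_mem_nhds ?_)
    simp only [hα0, hk]
    simpa using hε
  obtain ⟨δ, hδ, hball⟩ := Metric.eventually_nhds_iff_ball.1 ((e1.and e2).and e3)
  set d := δ / 2 with hd
  have hd0 : 0 < d := half_pos hδ
  have hmem : ∀ r ∈ Icc (-d) d, (l r ∈ φ.target ∧ α r ∈ range ψ) ∧ |k (α r) 1| < ε := by
    intro r hr
    refine hball r ?_
    rw [Real.ball_eq_Ioo]
    constructor <;> linarith [hr.1, hr.2]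
  have hψk : ∀ r ∈ Icc (-d) d, ψ !₂[k (α r) 0, k (α r) 1] = α r := by
    intro r hr
    obtain ⟨w, hw⟩ := (hmem r hr).1.2
    have hw2 : (!₂[w 0, w 1] : Plane) = w := by ext i; fin_cases i <;> rfl
    rw [← hw, hk, hw2]
  set f : ℝ → ℝ := fun r => k (α r) 0 with hf
  have hfc : ContinuousOn f (Icc (-d) d) := by
    intro r hr
    refine ContinuousAt.continuousWithinAt ?_
    refine (EuclideanSpace.proj (𝕜 := ℝ) (0 : Fin 2)).continuous.continuousAt.comp
        (ContinuousAt.comp (g := k) ?_ (hαc r (hmem r hr).1.1))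
    obtain ⟨w, hw⟩ := (hmem r hr).1.2
    rw [← hw]
    exact hkc w
  -- Two points of the surface on the same line of the box lie on one flow line, which meets the
  -- surface only once.
  have hfi : InjOn f (Icc (-d) d) := by
    intro r hr s hs hrs
    have h1 := h.flow (k (α r) 0) (k (α r) 1) (k (α s) 1)
    have hrs' : k (α r) 0 = k (α s) 0 := hrs
    have h2 := hψk s hs
    rw [← hrs'] at h2
    rw [hψk r hr, h2] at h1
    have h3 := (hS.existsUnique_time (α r)).unique ⟨_, hαS s (hmem s hs).1.1, h1⟩
      ⟨_, hαS r (hmem r hr).1.1, M.flow_zero _⟩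
    have h4 : k (α s) 1 = k (α r) 1 := (h.strictMono_time _).injective (sub_eq_zero.1 h3)
    have h5 : α r = α s := by rw [← hψk r hr, ← h2, h4]
    have h6 := φ.symm.injOn (hmem r hr).1.1 (hmem s hs).1.1 h5
    have h7 := congrArg (fun w : Plane => w 0) h6
    simpa [hl] using h7
  have hf0 : f 0 = 0 := by simp only [hf, hα0, hk]; rfl
  have m0 : (0 : ℝ) ∈ Icc (-d) d := ⟨by linarith, hd0.le⟩
  have m1 : -d ∈ Icc (-d) d := ⟨le_rfl, by linarith⟩
  have m2 : d ∈ Icc (-d) d := ⟨by linarith, le_rfl⟩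
  -- A continuous injective function on an interval is strictly monotone, so its values fill a
  -- neighbourhood of `f 0 = 0`.
  have hnhds : f '' Icc (-d) d ∈ 𝓝 0 := by
    rcases hfc.strictMonoOn_of_injOn_Icc' (by linarith) hfi with hm | hm
    · have h1 := hm m1 m0 (by linarith)
      have h2 := hm m0 m2 hd0
      rw [hf0] at h1 h2
      exact mem_of_superset (Icc_mem_nhds h1 h2) (intermediate_value_Icc (by linarith) hfc)
    · have h1 := hm m1 m0 (by linarith)
      have h2 := hm m0 m2 hd0
      rw [hf0] at h1 h2
      exact mem_of_superset (Icc_mem_nhds h2 h1) (intermediate_value_Icc' (by linarith) hfc)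
  filter_upwards [hnhds] with v hv
  obtain ⟨r, hr, rfl⟩ := hv
  refine ⟨k (α r) 1, (hmem r hr).2, ?_⟩
  rw [hψk r hr]
  exact hαS r (hmem r hr).1.1

/-- The time at which right-moving lines meet a Cauchy surface, and the intersection point, depend
continuously on the starting point. -/
theorem IsChiCauchySurface.eventually_exists_flow {S : Set M} (hS : M.IsChiCauchySurface S)
    {x y : M} {t : ℝ} (hf : M.Flow x t y) (hy : y ∈ S) {ε : ℝ} (hε : 0 < ε) {W : Set M}
    (hW : W ∈ 𝓝 y) : ∀ᶠ x' in 𝓝 x, ∃ t', |t' - t| < ε ∧ ∃ y' ∈ W, y' ∈ S ∧ M.Flow x' t' y' := by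
  obtain ⟨ψ, h, rfl, -⟩ := M.exists_isNullBox (p := y) univ_mem
  have hc1 : Continuous fun z : ℝ × ℝ × ℝ => |h.time z.1 z.2.1 - h.time z.1 z.2.2| :=
    ((h.continuous_time.comp (continuous_fst.prodMk (continuous_fst.comp continuous_snd))).sub
      (h.continuous_time.comp
        (continuous_fst.prodMk (continuous_snd.comp continuous_snd)))).abs
  have hc2 : Continuous fun z : ℝ × ℝ × ℝ => ψ !₂[z.1, z.2.1] :=
    h.smooth.continuous.comp (continuous_toLp_pair.comp
      (continuous_fst.prodMk (continuous_fst.comp continuous_snd)))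
  have e0 : (!₂[(0 : ℝ), 0] : Plane) = 0 := by ext i; fin_cases i <;> rfl
  have e1 : ∀ᶠ z : ℝ × ℝ × ℝ in 𝓝 0, |h.time z.1 z.2.1 - h.time z.1 z.2.2| < ε := by
    refine hc1.continuousAt.eventually (gt_mem_nhds ?_)
    simpa using hε
  have e2 : ∀ᶠ z : ℝ × ℝ × ℝ in 𝓝 0, ψ !₂[z.1, z.2.1] ∈ W := by
    refine hc2.continuousAt.eventually ?_
    simpa [e0] using hW
  obtain ⟨ρ, hρ, hball⟩ := Metric.eventually_nhds_iff_ball.1 (e1.and e2)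
  have hev := hS.eventually_exists_mem h hy hρ
  -- From points of this neighbourhood a flow of duration less than `ε` inside the box reaches the
  -- surface within `W`. It remains to flow from `x'` for the unperturbed time `t` first.
  have hW' : ψ '' {w | (|w 0| < ρ ∧ |w 1| < ρ) ∧ ∃ u, |u| < ρ ∧ ψ !₂[w 0, u] ∈ S} ∈
      𝓝 (ψ 0) := by
    refine h.isOpenEmbedding.isOpenMap.image_mem_nhds ?_
    have p0 : Tendsto (fun w : Plane => w 0) (𝓝 0) (𝓝 0) :=
      (EuclideanSpace.proj (𝕜 := ℝ) (0 : Fin 2)).continuous.tendsto' _ _ rfl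
    have p1 : Tendsto (fun w : Plane => w 1) (𝓝 0) (𝓝 0) :=
      (EuclideanSpace.proj (𝕜 := ℝ) (1 : Fin 2)).continuous.tendsto' _ _ rfl
    have hb : ∀ᶠ r in 𝓝 (0 : ℝ), |r| < ρ :=
      continuous_abs.continuousAt.eventually (gt_mem_nhds (by simpa using hρ))
    exact ((p0.eventually hb).and (p1.eventually hb)).and (p0.eventually hev)
  have hfl := hf.flowContAt _ hW'
  have hslice : Tendsto (fun x' : M => (x', t)) (𝓝 x) (𝓝 (x, t)) :=
    (Continuous.prodMk_left t).tendsto x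
  filter_upwards [hslice.eventually hfl] with x' hx'
  obtain ⟨_, ⟨w, ⟨⟨hw0, hw1⟩, u, hu, huS⟩, rfl⟩, hflow⟩ := hx'
  have hw2 : (!₂[w 0, w 1] : Plane) = w := by ext i; fin_cases i <;> rfl
  have hfl2 := h.flow (w 0) (w 1) u
  rw [hw2] at hfl2
  have hz : ((w 0, u, w 1) : ℝ × ℝ × ℝ) ∈ Metric.ball (0 : ℝ × ℝ × ℝ) ρ := by
    rw [mem_ball_zero_iff, Prod.norm_def, Prod.norm_def, max_lt_iff, max_lt_iff]
    exact ⟨hw0, hu, hw1⟩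
  obtain ⟨h1, h2⟩ := hball _ hz
  refine ⟨_, ?_, _, h2, huS, hflow.trans hfl2⟩
  simpa using h1

/-- A loop would meet the surface at more than one time. For closedness, related points lie on the
same flow line, hence share their hitting point, and the later one has the smaller hitting time.
Both facts pass to the limit because hitting times and points vary continuously. -/
theorem IsChiInitial.isChiSimple (hM : M.IsChiInitial) : M.IsChiSimple := by
  obtain ⟨S, hS⟩ := hM
  refine ⟨fun p q => chi_antisymm_of_no_loop fun x t ht hx => ?_, ?_⟩
  · obtain ⟨s, ⟨y, hy, hs⟩, -⟩ := hS.existsUnique_time x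
    have := (hS.existsUnique_time x).unique ⟨y, hy, hs⟩ ⟨y, hy, hx.trans hs⟩
    linarith
  · refine isClosed_of_closure_subset fun z hz => ?_
    obtain ⟨p, q⟩ := z
    rw [mem_closure_iff_frequently] at hz
    obtain ⟨s, ⟨y, hy, hs⟩, -⟩ := hS.existsUnique_time p
    obtain ⟨t, ⟨w, hw, ht⟩, -⟩ := hS.existsUnique_time q
    have key : ∀ ε > 0, ∀ W ∈ 𝓝 y, ∀ V ∈ 𝓝 w, ∃ s' t', |s' - s| < ε ∧ |t' - t| < ε ∧ t' ≤ s' ∧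
        ∃ y', y' ∈ W ∧ y' ∈ V := by
      intro ε hε W hW V hV
      have h1 := hS.eventually_exists_flow hs hy hε hW
      have h2 := hS.eventually_exists_flow ht hw hε hV
      obtain ⟨⟨p', q'⟩, hpq, ⟨s', hs', y', hyW, hyS, hfs⟩, t', ht', w', hwV, hwS, hft⟩ :=
        (hz.and_eventually ((continuous_fst.tendsto (p, q)).eventually h1 |>.and
          ((continuous_snd.tendsto (p, q)).eventually h2))).exists
      obtain ⟨r, hr, hfr⟩ := chi_iff_flow.1 hpq
      have h3 := (hS.existsUnique_time p').unique ⟨_, hyS, hfs⟩ ⟨_, hwS, hfr.trans hft⟩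
      have h4 : y' = w' := by
        rw [h3] at hfs
        exact hfs.unique (hfr.trans hft)
      exact ⟨s', t', hs', ht', by linarith, y', hyW, by rwa [h4]⟩
    have hyw : y = w := by
      by_contra hne
      obtain ⟨W, V, hW, hV, hd⟩ := t2_separation_nhds hne
      obtain ⟨-, -, -, -, -, y', h1, h2⟩ := key 1 one_pos W hW V hV
      exact hd.le_bot ⟨h1, h2⟩
    have hle : t ≤ s := by
      by_contra hlt
      push Not at hlt
      obtain ⟨s', t', h1, h2, h3, -⟩ := key ((t - s) / 2) (by linarith) univ univ_mem univ univ_mem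
      rw [abs_lt] at h1 h2
      linarith [h1.2, h2.1]
    subst hyw
    refine chi_iff_flow.2 ⟨s - t, by linarith, ?_⟩
    have := hs.trans ht.symm
    rwa [← sub_eq_add_neg] at this

end OrientedSpacetime

/-! ### Causal curves and global hyperbolicity -/

namespace OrientedSpacetime

variable {M N : OrientedSpacetime.{u}}

theorem velocity_comp_affine {γ : ℝ → M} {k l t : ℝ}
    (hγ : MDifferentiableAt 𝓘(ℝ, ℝ) (𝓡 2) γ (k * t + l)) :
    M.velocity (fun s => γ (k * s + l)) t = k • M.velocity γ (k * t + l) := by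
  have h1 : HasDerivAt (fun s : ℝ => k * s + l) k t := by
    simpa using ((hasDerivAt_id t).const_mul k).add_const l
  have h2 : HasMFDerivAt 𝓘(ℝ, ℝ) 𝓘(ℝ, ℝ) (fun s : ℝ => k * s + l) t
      ((1 : ℝ →L[ℝ] ℝ).smulRight k) := h1.hasFDerivAt.hasMFDerivAt
  have h3 := HasMFDerivAt.comp (g := γ) t hγ.hasMFDerivAt h2
  refine (congrArg (fun L : ℝ →L[ℝ] Plane => L 1) h3.mfderiv).trans ?_
  change (mfderiv 𝓘(ℝ, ℝ) (𝓡 2) γ (k * t + l) : ℝ →L[ℝ] Plane) ((1 : ℝ) • k) = _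
  rw [one_smul]
  have h4 := map_smul (mfderiv 𝓘(ℝ, ℝ) (𝓡 2) γ (k * t + l) : ℝ →L[ℝ] Plane) k 1
  exact (congrArg (mfderiv 𝓘(ℝ, ℝ) (𝓡 2) γ (k * t + l) : ℝ →L[ℝ] Plane) (mul_one k).symm).trans h4

theorem IsFutureDirected.smul {x : M} {w : TangentSpace (𝓡 2) x} (hw : M.IsFutureDirected w)
    {c : ℝ} (hc : 0 < c) : M.IsFutureDirected (c • w) := by
  obtain ⟨e, n, h⟩ := M.exists_isNullFrame x
  obtain ⟨a, b, rfl⟩ := h.exists_coord w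
  rw [h.isFutureDirected_iff] at hw
  rw [smul_add, smul_smul, smul_smul, h.isFutureDirected_iff, ← mul_add]
  exact ⟨mul_nonneg hc.le hw.1, mul_nonneg hc.le hw.2.1, mul_pos hc hw.2.2⟩

theorem isFutureDirected_congr_point {x y : M} (h : x = y) (w : Plane) :
    M.IsFutureDirected (x := x) w ↔ M.IsFutureDirected (x := y) w := by
  subst h; rfl

theorem isFutureDirected_velocity_congr {γ δ : ℝ → M} {t : ℝ} (h : γ =ᶠ[𝓝 t] δ) :
    M.IsFutureDirected (M.velocity γ t) ↔ M.IsFutureDirected (M.velocity δ t) := by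
  have h1 : (M.velocity γ t : Plane) = M.velocity δ t :=
    congrArg (fun L : ℝ →L[ℝ] Plane => L 1) h.mfderiv_eq
  exact (isFutureDirected_congr_point h.eq_of_nhds _).trans (by rw [h1])

/-- A smooth future-directed causal curve on `[a, b]`. -/
def IsCausalPiece (M : OrientedSpacetime.{u}) (γ : ℝ → M) (a b : ℝ) : Prop :=
  ContMDiffOn 𝓘(ℝ, ℝ) (𝓡 2) ∞ γ (Icc a b) ∧
    ∀ t ∈ Ioo a b, M.IsFutureDirected (M.velocity γ t)

theorem IsCausalPiece.reparam {γ η : ℝ → M} {a b c d k l : ℝ} (hγ : M.IsCausalPiece γ a b)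
    (hk : 0 < k) (hc : k * c + l = a) (hd : k * d + l = b)
    (hη : ∀ t ∈ Icc c d, η t = γ (k * t + l)) : M.IsCausalPiece η c d := by
  have hmaps : MapsTo (fun t => k * t + l) (Icc c d) (Icc a b) := fun t ht => by
    rw [← hc, ← hd]
    exact ⟨by simpa using (mul_le_mul_iff_right₀ hk).2 ht.1,
      by simpa using (mul_le_mul_iff_right₀ hk).2 ht.2⟩
  have hmaps' : MapsTo (fun t => k * t + l) (Ioo c d) (Ioo a b) := fun t ht => by
    rw [← hc, ← hd]
    exact ⟨by simpa using (mul_lt_mul_iff_right₀ hk).2 ht.1,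
      by simpa using (mul_lt_mul_iff_right₀ hk).2 ht.2⟩
  have haff : ContMDiff 𝓘(ℝ, ℝ) 𝓘(ℝ, ℝ) ∞ fun t : ℝ => k * t + l :=
    ContDiff.contMDiff (by fun_prop)
  refine ⟨(hγ.1.comp haff.contMDiffOn hmaps).congr hη, fun t ht => ?_⟩
  have hev : η =ᶠ[𝓝 t] fun s => γ (k * s + l) :=
    eventually_of_mem (Icc_mem_nhds ht.1 ht.2) hη
  rw [isFutureDirected_velocity_congr hev, velocity_comp_affine]
  · exact (hγ.2 _ (hmaps' ht)).smul hk
  · exact (hγ.1.contMDiffAt (Icc_mem_nhds (hmaps' ht).1 (hmaps' ht).2)).mdifferentiableAt (by simp)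

/-- There is a future-directed causal curve from one point to another. -/
def CausalCurveRel (M : OrientedSpacetime.{u}) (p q : M) : Prop :=
  ∃ γ : ℝ → M, M.IsFutureCausalCurve γ ∧ γ 0 = p ∧ γ 1 = q

theorem IsCausalPiece.causalCurveRel {γ : ℝ → M} (hγ : M.IsCausalPiece γ 0 1) :
    M.CausalCurveRel (γ 0) (γ 1) := by
  refine ⟨γ, ⟨hγ.1.continuousOn, 1, ![0, 1], ?_, rfl, rfl, fun i => ?_⟩, rfl, rfl⟩
  · rw [Fin.strictMono_iff_lt_succ]
    intro i
    fin_cases i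
    simp
  · fin_cases i
    exact hγ

/-- Adding one smooth piece at a time keeps the subdivision simple: the old nodes are halved and `1`
is adjoined. `CausalCurveRel.trans` then adds the pieces of the second curve one after another. -/
theorem CausalCurveRel.append {p : M} {δ : ℝ → M} {a b : ℝ} (hab : a < b)
    (hp : M.CausalCurveRel p (δ a)) (hδ : M.IsCausalPiece δ a b) :
    M.CausalCurveRel p (δ b) := by
  obtain ⟨γ, ⟨hγc, n, s, hs, hs0, hs1, hγ⟩, rfl, hγ1⟩ := hp
  -- The affine map in the second branch sends `1 / 2` to `a` and `1` to `b`; the summand `0` in the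
  -- first brings it to the form used by `IsCausalPiece.reparam`.
  set η : ℝ → M := fun t => if t ≤ 1 / 2 then γ (2 * t + 0) else
    δ ((2 * (b - a)) * t + (2 * a - b)) with hη
  have hη1 : ∀ t ≤ 1 / 2, η t = γ (2 * t + 0) := fun t ht => if_pos ht
  have hη2 : ∀ t, 1 / 2 ≤ t → η t = δ ((2 * (b - a)) * t + (2 * a - b)) := by
    intro t ht
    rcases ht.eq_or_lt with rfl | ht
    · rw [hη1 _ le_rfl]
      norm_num
      rw [hγ1]
      congr 1
      ring
    · exact if_neg (not_le.2 ht)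
  have hlast : M.IsCausalPiece η (1 / 2) 1 :=
    hδ.reparam (k := 2 * (b - a)) (l := 2 * a - b) (by linarith) (by ring) (by ring)
      fun t ht => hη2 t ht.1
  refine ⟨η, ⟨?_, n + 1, Fin.snoc (α := fun _ => ℝ) (fun i => s i / 2) 1, ?_, ?_, ?_, ?_⟩, ?_, ?_⟩
  · have h1 : ContinuousOn η (Icc 0 (1 / 2)) := by
      refine ContinuousOn.congr (f := fun t => γ (2 * t + 0)) (hγc.comp (by fun_prop) ?_)
        fun t ht => hη1 t ht.2
      intro t ht
      constructor <;> linarith [ht.1, ht.2]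
    have := h1.union_of_isClosed hlast.1.continuousOn isClosed_Icc isClosed_Icc
    rwa [Icc_union_Icc_eq_Icc (by norm_num) (by norm_num)] at this
  · rw [Fin.strictMono_iff_lt_succ]
    intro i
    induction i using Fin.lastCases with
    | last => rw [Fin.succ_last, Fin.snoc_last, Fin.snoc_castSucc, hs1]; norm_num
    | cast i =>
      rw [Fin.succ_castSucc, Fin.snoc_castSucc, Fin.snoc_castSucc]
      have := hs i.castSucc_lt_succ
      linarith
  · rw [← Fin.castSucc_zero, Fin.snoc_castSucc, hs0, zero_div]
  · rw [Fin.snoc_last]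
  · intro i
    induction i using Fin.lastCases with
    | last =>
      rw [Fin.succ_last, Fin.snoc_last, Fin.snoc_castSucc, hs1]
      exact hlast
    | cast i =>
      rw [Fin.succ_castSucc, Fin.snoc_castSucc, Fin.snoc_castSucc]
      refine IsCausalPiece.reparam (γ := γ) (k := 2) (l := 0) (hγ i) two_pos (by ring) (by ring)
        fun t ht => hη1 t ?_
      have := hs.monotone (Fin.le_last i.succ)
      rw [hs1] at this
      linarith [ht.2]
  · rw [hη1 _ (by norm_num)]
    norm_num
  · rw [hη2 _ (by norm_num)]
    congr 1
    ring

theorem CausalCurveRel.trans {p q r : M} (h : M.CausalCurveRel p q) (h' : M.CausalCurveRel q r) :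
    M.CausalCurveRel p r := by
  obtain ⟨δ, ⟨-, n, s, hs, hs0, hs1, hδ⟩, rfl, rfl⟩ := h'
  have key : ∀ k, M.CausalCurveRel p (δ (s k)) := by
    intro k
    induction k using Fin.induction with
    | zero => rwa [hs0]
    | succ k ih => exact ih.append (hs k.castSucc_lt_succ) (hδ k)
  rw [← hs1]
  exact key _

theorem causalRel_iff {p q : M} : M.causalRel p q ↔ p = q ∨ M.CausalCurveRel p q := Iff.rfl

theorem CausalCurveRel.causalRel {p q : M} (h : M.CausalCurveRel p q) : M.causalRel p q := Or.inr h

theorem causalRel_trans {p q r : M} (h : M.causalRel p q) (h' : M.causalRel q r) :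
    M.causalRel p r := by
  rcases causalRel_iff.1 h with rfl | h
  · exact h'
  · rcases causalRel_iff.1 h' with rfl | h'
    · exact h.causalRel
    · exact (h.trans h').causalRel

theorem causalCurveRel_of_causalRel {p q r : M} (h : M.causalRel p q)
    (h' : M.CausalCurveRel q r) : M.CausalCurveRel p r := by
  rcases causalRel_iff.1 h with rfl | h
  · exact h'
  · exact h.trans h'

theorem IsRightMoving.causalCurveRel {γ : ℝ → M} (hγ : M.IsRightMoving γ (Icc 0 1)) :
    M.CausalCurveRel (γ 0) (γ 1) := by
  refine IsCausalPiece.causalCurveRel ⟨hγ.1, fun t ht => (hγ.2 t ?_).2.1⟩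
  rwa [interior_Icc]

theorem causalRel_of_chi {p q : M} (h : M.chi p q) : M.causalRel p q := by
  rcases h with rfl | ⟨γ, hγ, rfl, rfl⟩
  · exact Or.inl rfl
  · exact hγ.causalCurveRel.causalRel

theorem IsConformalMorphism.map_isFutureCausalCurve {f : M → N} (hf : IsConformalMorphism M N f)
    {γ : ℝ → M} (hγ : M.IsFutureCausalCurve γ) : N.IsFutureCausalCurve (f ∘ γ) := by
  obtain ⟨hc, n, s, hs, hs0, hs1, h⟩ := hγ
  refine ⟨hf.smooth.continuous.comp_continuousOn hc, n, s, hs, hs0, hs1, fun i =>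
    ⟨hf.smooth.comp_contMDiffOn (h i).1, fun t ht => ?_⟩⟩
  have hγt : MDifferentiableAt 𝓘(ℝ, ℝ) (𝓡 2) γ t :=
    ((h i).1.contMDiffAt (Icc_mem_nhds ht.1 ht.2)).mdifferentiableAt (by simp)
  have key : N.velocity (f ∘ γ) t = mfderiv (𝓡 2) (𝓡 2) f (γ t) (M.velocity γ t) :=
    mfderiv_comp_apply t (hf.smooth.mdifferentiableAt (by simp)) hγt _
  rw [key]
  exact hf.timeOrientation _ _ ((h i).2 t ht)

theorem IsNullBox.causalCurveRel {ψ : Plane → M} (h : M.IsNullBox ψ) {w w' : Plane}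
    (hw : ∀ i, w i ≤ w' i) (hne : w ≠ w') : M.CausalCurveRel (ψ w) (ψ w') := by
  have h1 : mink.{u}.causalRel (coord.symm w) (coord.symm w') := by
    rw [mink_causalRel_iff]
    simpa using hw
  rcases h1 with h1 | ⟨γ, hγ, h0, h1⟩
  · exact absurd (coord.symm.injective h1) hne
  · refine ⟨_, h.isConformalMorphism.map_isFutureCausalCurve hγ, ?_, ?_⟩
    · simp [h0]
    · simp [h1]

theorem IsNullBox.causalRel {ψ : Plane → M} (h : M.IsNullBox ψ) {w w' : Plane}
    (hw : ∀ i, w i ≤ w' i) : M.causalRel (ψ w) (ψ w') := by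
  by_cases hne : w = w'
  · exact Or.inl (by rw [hne])
  · exact (h.causalCurveRel hw hne).causalRel

/-- Initial segments of a right-moving line can be removed in the closure of `χ⁺`. -/
theorem mem_closure_chi_of_chi {p q x : M} (hc : (p, q) ∈ closure {z : M × M | M.chi z.1 z.2})
    (hpq : ¬ M.chi p q) (hx : M.chi p x) : (x, q) ∈ closure {z : M × M | M.chi z.1 z.2} := by
  obtain ⟨t, ht, hfx⟩ := chi_iff_flow.1 hx
  -- The flow of `p` over the compact interval `Icc 0 t` avoids `q`, and this persists for nearby
  -- pairs. Related pairs near `(p, q)` are therefore joined only by times exceeding `t`, so the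
  -- initial stretch can be removed.
  have hex : ∀ᶠ z : M × M in 𝓝 (p, q), ∀ s ∈ Icc 0 t, ¬ M.Flow z.1 s z.2 := by
    refine isCompact_Icc.eventually_forall_of_forall_eventually
      (P := fun (z : M × M) s => ¬ M.Flow z.1 s z.2) fun s hs => ?_
    obtain ⟨y, hy⟩ := hfx.exists_mid (s := s) (by rwa [uIcc_of_le ht])
    have hyq : y ≠ q := by
      rintro rfl
      exact hpq (chi_iff_flow.2 ⟨s, hs.1, hy⟩)
    obtain ⟨W, V, hW, hV, hd⟩ := t2_separation_nhds hyq
    have h1 : Tendsto (fun z : (M × M) × ℝ => (z.1.1, z.2)) (𝓝 ((p, q), s)) (𝓝 (p, s)) :=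
      (by fun_prop : Continuous fun z : (M × M) × ℝ => (z.1.1, z.2)).tendsto _
    have h2 : Tendsto (fun z : (M × M) × ℝ => z.1.2) (𝓝 ((p, q), s)) (𝓝 q) :=
      (by fun_prop : Continuous fun z : (M × M) × ℝ => z.1.2).tendsto _
    filter_upwards [h1.eventually (hy.flowContAt W hW), h2 hV] with z hz hzV hflow
    obtain ⟨y', hy', hf'⟩ := hz
    exact hd.le_bot ⟨hy', (hf'.unique hflow : y' = z.1.2) ▸ hzV⟩
  rw [mem_closure_iff_nhds]
  intro U hU
  obtain ⟨W, hW, V, hV, hWV⟩ := mem_nhds_prod_iff.1 hU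
  have hslice : Tendsto (fun z : M × M => (z.1, t)) (𝓝 (p, q)) (𝓝 (p, t)) :=
    (by fun_prop : Continuous fun z : M × M => (z.1, t)).tendsto _
  rw [mem_closure_iff_frequently] at hc
  obtain ⟨⟨p', q'⟩, hpq', hne, ⟨x', hx', hfx'⟩, hq'⟩ := (hc.and_eventually (hex.and
    ((hslice.eventually (hfx.flowContAt W hW)).and ((continuous_snd.tendsto (p, q)) hV)))).exists
  obtain ⟨t', ht', hf'⟩ := chi_iff_flow.1 hpq'
  have htt : t ≤ t' := by
    by_contra hlt
    exact hne t' ⟨ht', (not_le.1 hlt).le⟩ hf'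
  exact ⟨(x', q'), hWV ⟨hx', hq'⟩, chi_iff_flow.2 ⟨t' - t, sub_nonneg.2 htt, hfx'.of_sub hf'⟩⟩

namespace IsGloballyHyperbolic

variable (hM : M.IsGloballyHyperbolic)

include hM

theorem not_causalCurveRel_self (p : M) : ¬ M.CausalCurveRel p p := by
  rintro ⟨γ, hγ, h0, h1⟩
  exact hM.1 ⟨γ, hγ, h0.trans h1.symm⟩

theorem isClosed_diamond (p q : M) : IsClosed {r : M | M.causalRel p r ∧ M.causalRel r q} :=
  (hM.2 p q).isClosed

/-- Pushing the first point slightly into the past and the second slightly into the future places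
the nearby related pairs between fixed endpoints, where the closed diamonds control the limit. The
two displacements are then removed one at a time. -/
theorem isClosed_causalRel : IsClosed {z : M × M | M.causalRel z.1 z.2} := by
  refine isClosed_of_closure_subset fun z hz => ?_
  obtain ⟨p, q⟩ := z
  obtain ⟨ψ, h, rfl, -⟩ := M.exists_isNullBox (p := p) univ_mem
  obtain ⟨φ, k, rfl, -⟩ := M.exists_isNullBox (p := q) univ_mem
  have hdiag : Tendsto (fun s : ℝ => φ !₂[s, s]) (𝓝[>] 0) (𝓝 (φ 0)) := by
    have e0 : (!₂[(0 : ℝ), 0] : Plane) = 0 := by ext i; fin_cases i <;> rfl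
    refine ((k.smooth.continuous.comp (continuous_toLp_pair.comp
      (by fun_prop : Continuous fun s : ℝ => (s, s)))).tendsto' 0 _ ?_).mono_left
      nhdsWithin_le_nhds
    simp [e0]
  have hlt : ∀ s : ℝ, 0 < s → ∀ᶠ w : Plane in 𝓝 0, ∀ i, |w i| < s := by
    intro s hs
    rw [eventually_all]
    intro i
    have : Tendsto (fun w : Plane => |w i|) (𝓝 0) (𝓝 0) :=
      ((EuclideanSpace.proj (𝕜 := ℝ) i).continuous.abs).tendsto' _ _ (by simp)
    exact this.eventually (gt_mem_nhds hs)
  have h1 : ∀ s : ℝ, 0 < s → M.causalRel (ψ 0) (φ !₂[s, s]) := by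
    intro s hs
    refine ((hM.isClosed_diamond (ψ !₂[-s, -s]) (φ !₂[s, s])).closure_subset ?_).2
    rw [mem_closure_iff_frequently] at hz ⊢
    have hp : ∀ᶠ x in 𝓝 (ψ 0), M.causalRel (ψ !₂[-s, -s]) x := by
      rw [← h.isOpenEmbedding.map_nhds_eq, eventually_map]
      filter_upwards [hlt s hs] with w hw
      refine h.causalRel fun i => ?_
      have := (abs_lt.1 (hw i)).1.le
      fin_cases i <;> exact this
    have hq : ∀ᶠ x in 𝓝 (φ 0), M.causalRel x (φ !₂[s, s]) := by
      rw [← k.isOpenEmbedding.map_nhds_eq, eventually_map]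
      filter_upwards [hlt s hs] with w hw
      refine k.causalRel fun i => ?_
      have := (abs_lt.1 (hw i)).2.le
      fin_cases i <;> exact this
    have := (hz.and_eventually (((continuous_fst.tendsto (ψ 0, φ 0)).eventually hp).and
      ((continuous_snd.tendsto (ψ 0, φ 0)).eventually hq))).mono
      (fun z hz => (⟨hz.2.1, causalRel_trans hz.1 hz.2.2⟩ :
        z.1 ∈ {r : M | M.causalRel (ψ !₂[-s, -s]) r ∧ M.causalRel r (φ !₂[s, s])}))
    exact (continuous_fst.tendsto (ψ 0, φ 0)).frequently this
  refine ((hM.isClosed_diamond (ψ 0) (φ !₂[1, 1])).mem_of_tendsto hdiag ?_).1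
  filter_upwards [Ioc_mem_nhdsGT (zero_lt_one (α := ℝ))] with s hs
  refine ⟨h1 s hs.1, k.causalRel fun i => ?_⟩
  fin_cases i <;> exact hs.2

/-- Suppose `(p, q)` is a limit of related pairs but is not related itself. By
`mem_closure_chi_of_chi` the whole right-moving ray from `p` stays in the diamond of `p` and `q`. By
compactness the closures of its tails have a common point `z`, and every point of the ray causally
precedes `z`. In a box around `z` the ray returns arbitrarily close to the centre and each time
continues to the line where coordinate `1` equals `1`. In the limit `ψ !₂[0, 1]` precedes `z`,
although it lies strictly in the future of `z`. -/
theorem isChiSimple : M.IsChiSimple := by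
  refine ⟨fun p q => chi_antisymm_of_no_loop fun x t ht hx => ?_, ?_⟩
  · obtain ⟨γ, hγ, h0, h1⟩ := hx.exists_isRightMoving ht
    have := hγ.causalCurveRel
    rw [h0, h1] at this
    exact hM.not_causalCurveRel_self x this
  refine isClosed_of_closure_subset fun z hz => ?_
  obtain ⟨p, q⟩ := z
  by_contra hpq
  have hJ : closure {z : M × M | M.chi z.1 z.2} ⊆ {z : M × M | M.causalRel z.1 z.2} :=
    closure_minimal (fun z hz => causalRel_of_chi hz) hM.isClosed_causalRel
  have hsub : ∀ x, M.chi p x → closure {y | M.chi x y} ⊆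
      {r : M | M.causalRel p r ∧ M.causalRel r q} := fun x hx =>
    closure_minimal (fun y hy => ⟨causalRel_of_chi (chi_trans hx hy),
      hJ (mem_closure_chi_of_chi hz hpq (chi_trans hx hy))⟩) (hM.isClosed_diamond p q)
  have : Nonempty {x : M // M.chi p x} := ⟨⟨p, chi_refl p⟩⟩
  obtain ⟨z, hzA⟩ : (⋂ x : {x : M // M.chi p x}, closure {y | M.chi x y}).Nonempty := by
    refine IsCompact.nonempty_iInter_of_directed_nonempty_isCompact_isClosed
      (fun x : {x : M // M.chi p x} => closure {y | M.chi x y}) ?_ ?_ ?_ fun x => isClosed_closure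
    · intro x y
      rcases chi_or_chi x.2 y.2 with hxy | hxy
      · exact ⟨y, closure_mono fun w hw => chi_trans hxy hw, subset_rfl⟩
      · exact ⟨x, subset_rfl, closure_mono fun w hw => chi_trans hxy hw⟩
    · exact fun x => ⟨x, subset_closure (chi_refl _)⟩
    · exact fun x => (hM.2 p q).of_isClosed_subset isClosed_closure (hsub x x.2)
  rw [mem_iInter] at hzA
  have hAz : ∀ x, M.chi p x → M.causalRel x z := fun x hx => by
    refine hJ (a := (x, z)) (closure_mono (s := {x} ×ˢ {y | M.chi x y}) ?_ ?_)
    · rintro ⟨_, y⟩ ⟨rfl, hy⟩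
      exact hy
    · rw [closure_prod_eq]
      exact ⟨subset_closure rfl, hzA ⟨x, hx⟩⟩
  obtain ⟨ψ, h, rfl, -⟩ := M.exists_isNullBox (p := z) univ_mem
  have hcl : IsClosed {w : Plane | M.causalRel (ψ !₂[w 0, 1]) (ψ 0)} := by
    have hc : Continuous fun w : Plane => (ψ !₂[w 0, 1], ψ 0) := by
      refine (h.smooth.continuous.comp (continuous_toLp_pair.comp
        (((EuclideanSpace.proj (𝕜 := ℝ) (0 : Fin 2)).continuous).prodMk
          continuous_const))).prodMk continuous_const
    exact hM.isClosed_causalRel.preimage hc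
  have h0 : (0 : Plane) ∈ {w : Plane | M.causalRel (ψ !₂[w 0, 1]) (ψ 0)} := by
    refine hcl.closure_subset (mem_closure_iff_frequently.2 ?_)
    have hfr := mem_closure_iff_frequently.1 (hzA ⟨p, chi_refl p⟩)
    rw [← h.isOpenEmbedding.map_nhds_eq, frequently_map] at hfr
    have hlt : ∀ᶠ w : Plane in 𝓝 0, w 1 < 1 :=
      ((EuclideanSpace.proj (𝕜 := ℝ) (1 : Fin 2)).continuous.tendsto' 0 0 rfl).eventually
        (gt_mem_nhds one_pos)
    refine (hfr.and_eventually hlt).mono fun w hw => hAz _ (chi_trans hw.1 ?_)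
    have := h.chi (w 0) hw.2.le
    have hw2 : (!₂[w 0, w 1] : Plane) = w := by ext i; fin_cases i <;> rfl
    rwa [hw2] at this
  refine hM.not_causalCurveRel_self _ (causalCurveRel_of_causalRel h0 (h.causalCurveRel ?_ ?_))
  · intro i
    fin_cases i
    · exact le_rfl
    · exact zero_le_one
  · intro h1
    exact zero_ne_one (congrArg (fun w : Plane => w 1) h1)

end IsGloballyHyperbolic

end OrientedSpacetime

/-! ### Overlap-monic morphisms and reflection of the right-chiral relation -/

namespace OrientedSpacetime

variable {M N : OrientedSpacetime.{u}}

theorem isRightMoving_reverse {γ : ℝ → M} (hs : ContMDiffOn 𝓘(ℝ, ℝ) (𝓡 2) ∞ γ (Icc 0 1))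
    (h : ∀ t ∈ interior (Icc (0 : ℝ) 1), M.IsNull (M.velocity γ t) ∧
      M.IsPastDirected (M.velocity γ t) ∧ M.IsLeftPointing (M.velocity γ t)) :
    M.IsRightMoving (fun t => γ (-1 * t + 1)) (Icc 0 1) := by
  have haff : ContMDiff 𝓘(ℝ, ℝ) 𝓘(ℝ, ℝ) ∞ fun t : ℝ => -1 * t + 1 :=
    ContDiff.contMDiff (by fun_prop)
  refine ⟨hs.comp haff.contMDiffOn fun t ht => ?_, fun t ht => ?_⟩
  · constructor <;> linarith [ht.1, ht.2]
  · rw [interior_Icc] at ht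
    have ht' : -1 * t + 1 ∈ interior (Icc (0 : ℝ) 1) := by
      rw [interior_Icc]
      constructor <;> linarith [ht.1, ht.2]
    change M.IsRightNull _
    rw [velocity_comp_affine ((hs.contMDiffAt
      (mem_interior_iff_mem_nhds.1 ht')).mdifferentiableAt (by simp)), neg_one_smul,
      isRightNull_neg]
    exact h _ ht'

/-- A constant curve has zero velocity, and null vectors are non-zero by convention. -/
theorem IsRightMoving.eq_of_forall_eq {γ : ℝ → M} (hγ : M.IsRightMoving γ (Icc 0 1)) (x : M)
    (h : ∀ t ∈ Icc (0 : ℝ) 1, γ t = x) : False := by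
  have hI : Icc (0 : ℝ) 1 ∈ 𝓝 (1 / 2) := Icc_mem_nhds (by norm_num) (by norm_num)
  have h1 : M.IsRightNull (M.velocity γ (1 / 2)) := hγ.2 _ (mem_interior_iff_mem_nhds.2 hI)
  rw [isRightNull_velocity_congr (δ := fun _ => x) (eventually_of_mem hI h)] at h1
  refine h1.1.1 ?_
  rw [velocity, mfderiv_const]
  rfl

/-- A conformal morphism between simple spacetimes is injective along right-moving lines. -/
theorem IsConformalMorphism.eq_of_chi {f : M → N} (hf : IsConformalMorphism M N f)
    (hN : N.IsChiSimple) {p q : M} (h : M.chi p q) (h' : N.chi (f q) (f p)) : p = q := by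
  rcases h with rfl | ⟨γ, hγ, rfl, rfl⟩
  · rfl
  · refine ((hf.map_isRightMoving hγ).eq_of_forall_eq (f (γ 0)) fun t ht => ?_).elim
    -- Each point of the image curve lies after `f p` and before `f q`, hence before `f p` too;
    -- antisymmetry makes the image curve constant.
    have h0 := (hf.map_isRightMoving hγ).chi ordConnected_Icc (left_mem_Icc.2 zero_le_one) ht ht.1
    have h1 := (hf.map_isRightMoving hγ).chi ordConnected_Icc ht (right_mem_Icc.2 zero_le_one) ht.2
    exact hN.1 _ _ (chi_trans h1 h') h0

theorem IsChiSimple.isClosed_sChi (hM : M.IsChiSimple) :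
    IsClosed {z : M × M | M.sChi z.1 z.2} :=
  hM.2.union (hM.2.preimage continuous_swap)

/-- The inclusion of a null box, as a morphism from Minkowski spacetime. -/
noncomputable def IsNullBox.hom {ψ : Plane → M} (h : M.IsNullBox ψ) : mink.{u} ⟶ M :=
  Hom.mk (ψ ∘ coord) h.isConformalMorphism

section Property

variable {κ : ObjectProperty OrientedSpacetime.{u}}

/-- Unrelated points of a simple spacetime can be separated by unrelated neighbourhoods, and boxes
inside these are test morphisms from Minkowski space. Overlap-monicity thus detects relations
between points. -/
theorem overlapMonic_iff_reflectsChi (hκ : ∀ M, κ M → M.IsChiSimple) (hm : κ mink.{u})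
    {X Y : κ.FullSubcategory} (f : X ⟶ Y) :
    (chiralDisjointnessOn κ).OverlapMonic f ↔ ReflectsChi f.hom.toFun := by
  constructor
  · intro h p q hpq
    have hs : X.obj.sChi p q := by
      by_contra hcon
      obtain ⟨U, hU, V, hV, hUV⟩ := mem_nhds_prod_iff.1
        ((hκ _ X.property).isClosed_sChi.isOpen_compl.mem_nhds (x := (p, q)) hcon)
      obtain ⟨ψ, k, rfl, hψ⟩ := X.obj.exists_isNullBox hU
      obtain ⟨φ, l, rfl, hφ⟩ := X.obj.exists_isNullBox hV
      have hd : (chiralDisjointnessOn κ).Rel (b₁ := ⟨mink, hm⟩) (b₂ := ⟨mink, hm⟩)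
          (ObjectProperty.homMk k.hom) (ObjectProperty.homMk l.hom : _ ⟶ X) := fun w w' =>
        hUV (mk_mem_prod (hψ (mem_range_self (coord w))) (hφ (mem_range_self (coord w'))))
      -- The boxes are centred at `p` and `q`, so their images under `f` contain the related points
      -- `f p` and `f q`.
      refine h _ _ _ _ hd (coord.symm 0) (coord.symm 0) (Or.inl ?_)
      have e1 : ψ (coord.{u} (coord.symm 0)) = ψ 0 := by rw [Homeomorph.apply_symm_apply]
      have e2 : φ (coord.{u} (coord.symm 0)) = φ 0 := by rw [Homeomorph.apply_symm_apply]
      change Y.obj.chi (f.hom.toFun (ψ (coord (coord.symm 0))))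
        (f.hom.toFun (φ (coord (coord.symm 0))))
      rwa [e1, e2]
    rcases hs with hs | hs
    · exact hs
    -- If the relation in the source runs the wrong way, the two relations in the target form a
    -- loop, which forces `p = q`.
    · exact Or.inl (f.hom.isConformalMorphism.eq_of_chi (hκ _ Y.property) hs hpq).symm
  · intro h B₁ B₂ f₁ f₂ hd p₁ p₂ hs
    exact hd p₁ p₂ (hs.imp (h _ _) (h _ _))

end Property

theorem ReflectsChi.injective {f : M → N} (h : ReflectsChi f) (hM : M.IsChiSimple) :
    Function.Injective f := fun p q hpq =>
  hM.1 p q (h p q (Or.inl hpq)) (h q p (Or.inl hpq.symm))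

/-- Reflection provides a curve from `p` to `q`. Every point of its image is comparable with `a`, as
both come after `f p`. The parameters before `a` and those after `a` form closed sets covering a
connected interval, so they share a parameter, whose image is `a` by antisymmetry. -/
theorem ReflectsChi.mem_range_of_chi {f : M → N} (h : ReflectsChi f)
    (hf : IsConformalMorphism M N f) (hN : N.IsChiSimple) {p q : M} {a : N}
    (hpa : N.chi (f p) a) (haq : N.chi a (f q)) : a ∈ range f := by
  rcases h p q (chi_trans hpa haq) with rfl | ⟨γ, hγ, rfl, rfl⟩
  · exact ⟨p, hN.1 _ _ hpa haq⟩
  · have hfγ := hf.map_isRightMoving hγ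
    have hc : ContinuousOn (f ∘ γ) (Icc 0 1) := hfγ.1.continuousOn
    have h0 : (0 : ℝ) ∈ Icc (0 : ℝ) 1 := left_mem_Icc.2 zero_le_one
    have h1 : (1 : ℝ) ∈ Icc (0 : ℝ) 1 := right_mem_Icc.2 zero_le_one
    have hA : IsClosed (Icc 0 1 ∩ (f ∘ γ) ⁻¹' {x | N.chi x a}) :=
      hc.preimage_isClosed_of_isClosed isClosed_Icc
        (hN.2.preimage (by fun_prop : Continuous fun x : N => (x, a)))
    have hB : IsClosed (Icc 0 1 ∩ (f ∘ γ) ⁻¹' {x | N.chi a x}) :=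
      hc.preimage_isClosed_of_isClosed isClosed_Icc
        (hN.2.preimage (by fun_prop : Continuous fun x : N => (a, x)))
    obtain ⟨s, -, ⟨-, hsA⟩, -, hsB⟩ := isPreconnected_closed_iff.1 isPreconnected_Icc _ _ hA hB
      (fun s hs => (chi_or_chi (hfγ.chi ordConnected_Icc h0 hs hs.1) hpa).imp
        (fun h => ⟨hs, h⟩) fun h => ⟨hs, h⟩) ⟨0, h0, h0, hpa⟩ ⟨1, h1, h1, haq⟩
    exact ⟨γ s, hN.1 _ _ hsA hsB⟩

/-- One direction rests on `ReflectsChi.mem_range_of_chi`, with reversal of the parameter for the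
past-directed alternative. In the other, convexity keeps a connecting curve inside the image, where
it lifts. -/
theorem IsConformalMorphism.reflectsChi_iff {f : M → N} (hf : IsConformalMorphism M N f)
    (hM : M.IsChiSimple) (hN : N.IsChiSimple) :
    ReflectsChi f ↔ Function.Injective f ∧ N.IsChiConvex (range f) := by
  constructor
  · refine fun h => ⟨h.injective hM, ?_⟩
    have key : ∀ γ : ℝ → N, N.IsRightMoving γ (Icc 0 1) → γ 0 ∈ range f → γ 1 ∈ range f →
        ∀ t ∈ Icc (0 : ℝ) 1, γ t ∈ range f := by
      rintro γ hγ ⟨p, hp⟩ ⟨q, hq⟩ t ht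
      refine h.mem_range_of_chi hf hN (p := p) (q := q) ?_ ?_
      · rw [hp]
        exact hγ.chi ordConnected_Icc (left_mem_Icc.2 zero_le_one) ht ht.1
      · rw [hq]
        exact hγ.chi ordConnected_Icc ht (right_mem_Icc.2 zero_le_one) ht.2
    rintro γ ⟨hs, hγ | hγ⟩ h0 h1 _ ⟨t, ht, rfl⟩
    · exact key γ ⟨hs, hγ⟩ h0 h1 t ht
    · have := key _ (isRightMoving_reverse hs hγ) (by simpa using h1) (by simpa using h0) (1 - t)
        ⟨by linarith [ht.2], by linarith [ht.1]⟩
      simpa using this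
  · rintro ⟨hinj, hconv⟩ p q (h | ⟨γ, hγ, h0, h1⟩)
    · exact Or.inl (hinj h)
    · have hr := hconv γ ⟨hγ.1, Or.inl hγ.2⟩ (h0 ▸ mem_range_self p) (h1 ▸ mem_range_self q)
      obtain ⟨δ, hδ, hfδ⟩ := hf.exists_lift hinj (nonempty_Icc.2 zero_le_one) hγ
        fun t ht => hr (mem_image_of_mem γ ht)
      refine Or.inr ⟨δ, hδ, hinj ?_, hinj ?_⟩
      · rw [hfδ 0 (left_mem_Icc.2 zero_le_one), h0]
      · rw [hfδ 1 (right_mem_Icc.2 zero_le_one), h1]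

/-- Isolates all that is used of the three categories: simple objects, and Minkowski space among
them. -/
theorem overlapMonic_iff_and_reflectsChi_iff {κ : ObjectProperty OrientedSpacetime.{u}}
    (hκ : ∀ M, κ M → M.IsChiSimple) (hm : κ mink.{u}) {X Y : κ.FullSubcategory} (f : X ⟶ Y) :
    ((chiralDisjointnessOn κ).OverlapMonic f ↔ ReflectsChi f.hom.toFun) ∧
      (ReflectsChi f.hom.toFun ↔
        Function.Injective f.hom.toFun ∧ Y.obj.IsChiConvex (range f.hom.toFun)) :=
  ⟨overlapMonic_iff_reflectsChi hκ hm f,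
    f.hom.isConformalMorphism.reflectsChi_iff (hκ _ X.property) (hκ _ Y.property)⟩

end OrientedSpacetime

theorem mainTheorem5 :
    -- overlap-monics among `χ⁺`-simple spacetimes
    (∀ {M N : OrientedSpacetime.chiSimple.{u}.FullSubcategory} (f : M ⟶ N),
      ((OrientedSpacetime.chiralDisjointnessOn OrientedSpacetime.chiSimple).OverlapMonic f ↔
        OrientedSpacetime.ReflectsChi f.hom.toFun) ∧
      (OrientedSpacetime.ReflectsChi f.hom.toFun ↔
        Function.Injective f.hom.toFun ∧ N.obj.IsChiConvex (Set.range f.hom.toFun))) ∧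
    -- overlap-monics among `χ⁺`-initial spacetimes
    (∀ {M N : OrientedSpacetime.chiInitial.{u}.FullSubcategory} (f : M ⟶ N),
      ((OrientedSpacetime.chiralDisjointnessOn OrientedSpacetime.chiInitial).OverlapMonic f ↔
        OrientedSpacetime.ReflectsChi f.hom.toFun) ∧
      (OrientedSpacetime.ReflectsChi f.hom.toFun ↔
        Function.Injective f.hom.toFun ∧ N.obj.IsChiConvex (Set.range f.hom.toFun))) ∧
    -- overlap-monics among globally hyperbolic spacetimes
    (∀ {M N : OrientedSpacetime.globallyHyperbolic.{u}.FullSubcategory} (f : M ⟶ N),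
      ((OrientedSpacetime.chiralDisjointnessOn OrientedSpacetime.globallyHyperbolic).OverlapMonic f ↔
        OrientedSpacetime.ReflectsChi f.hom.toFun) ∧
      (OrientedSpacetime.ReflectsChi f.hom.toFun ↔
        Function.Injective f.hom.toFun ∧ N.obj.IsChiConvex (Set.range f.hom.toFun))) ∧
    -- the objects of `χLoc`
    (∀ M : OrientedSpacetime.{u},
      (∃ X : OrientedSpacetime.ChiLoc.{u}, OrientedSpacetime.ChiLoc.inclusion.obj X = M) ↔
        ∃ S : Set M, M.IsChiCauchySurface S) ∧
    -- the morphisms of `χLoc`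
    (∀ (X Y : OrientedSpacetime.ChiLoc.{u})
      (f : OrientedSpacetime.ChiLoc.inclusion.obj X ⟶ OrientedSpacetime.ChiLoc.inclusion.obj Y),
      (∃ φ : X ⟶ Y, OrientedSpacetime.ChiLoc.inclusion.map φ = f) ↔
        Function.Injective f.toFun ∧
          (OrientedSpacetime.ChiLoc.inclusion.obj Y).IsChiConvex (Set.range f.toFun)) := by
  -- The initial case is named because it also describes the morphisms of `ChiLoc`.
  have hinit := fun {X Y : OrientedSpacetime.chiInitial.{u}.FullSubcategory} (f : X ⟶ Y) =>
    OrientedSpacetime.overlapMonic_iff_and_reflectsChi_iff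
      (fun _ h => OrientedSpacetime.IsChiInitial.isChiSimple h)
      OrientedSpacetime.mink_isChiInitial f
  refine ⟨fun f => OrientedSpacetime.overlapMonic_iff_and_reflectsChi_iff (fun _ h => h)
      OrientedSpacetime.mink_isChiSimple f, hinit,
    fun f => OrientedSpacetime.overlapMonic_iff_and_reflectsChi_iff
      (fun _ h => OrientedSpacetime.IsGloballyHyperbolic.isChiSimple h)
      OrientedSpacetime.mink_isGloballyHyperbolic f, fun M => ⟨?_, fun h => ⟨⟨⟨M, h⟩⟩, rfl⟩⟩,
    fun X Y f => ⟨?_, fun h => ?_⟩⟩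
  · rintro ⟨X, rfl⟩
    exact X.obj.property
  · rintro ⟨φ, rfl⟩
    exact (hinit φ.hom).2.1 ((hinit φ.hom).1.1 φ.property)
  · exact ⟨⟨ObjectProperty.homMk f, (hinit _).1.2 ((hinit _).2.2 h)⟩, rfl⟩
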